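/- Let $k$ be a field, and let $\otimes$ denote $\otimes_k$. For a dg $k$-algebra $A$ (a $\mathbb Z$-graded unital associative $k$-algebra with a differential of degree $+1$ satisfying the graded Leibniz rule) let $D(A)$ be the derived category of right dg $A$-modules. For an object $E$ of $D(A)$ let $[E]_0$ be the class of objects isomorphic to finite direct sums of shifts of $E$, let $[E]_n=[E]_0\star\cdots\star[E]_0$ ($n+1$ factors), where $\mathcal X\star \mathcal Y$ is the class of objects $F$ that admit a distinguished triangle $X\to F\to Y\to X[1]$ with $X\in \mathcal X$, $Y\in \mathcal Y$, and let $\langle E\rangle_n$ be the class of direct summands of objects of $[E]_n$. Let $\mathrm{Perf}(A)=\bigcup_n\langle A\rangle_n\subset D(A)$. The diagonal dimension $\mathrm{Ddim}\,\mathrm{Perf}(A)$ is the least integer $n\ge 0$ for which there exist $F\in \mathrm{Perf}(A^{\mathrm{op}})$ and $G\in\mathrm{Perf}(A)$ such that the diagonal dg $A^{\mathrm{op}}\otimes A$-module $A$ belongs to $\langle F\boxtimes G\rangle_n\subset D(A^{\mathrm{op}}\otimes A)$, where $F\boxtimes G$ is the tensor product over $k$; it is $\infty$ if no such $n$ exists.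 Let $A$ and $B$ be dg $k$-algebras. Then $$\mathrm{Ddim}\,\mathrm{Perf}(A\otimes B)\le \mathrm{Ddim}\,\mathrm{Perf}(A)+\mathrm{Ddim}\,\mathrm{Perf}(B).$$ -/

import Mathlib

open CategoryTheory DirectSum TensorProduct

universe u

noncomputable section

namespace DG

section Graded

variable {k : Type u} [Field k] {M N P : Type u} [AddCommGroup M] [AddCommGroup N] [AddCommGroup P]
  [Module k M] [Module k N] [Module k P]

lemma sgn_sq (n : ℤ) : (-1 : k) ^ n * (-1 : k) ^ n = 1 := by
  rw [← mul_zpow]; simp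

lemma sgn_pow_two (n : ℤ) : ((-1 : k) ^ n) ^ 2 = 1 := by
  rw [sq, sgn_sq]

lemma sgn_add (m n : ℤ) : (-1 : k) ^ (m + n) = (-1 : k) ^ m * (-1 : k) ^ n :=
  zpow_add₀ (by simp) m n

lemma sgn_add_one (n : ℤ) : (-1 : k) ^ (n + 1) = -(-1 : k) ^ n := by
  rw [sgn_add]; simp

lemma units_smul_eq (n : ℤ) (x : M) : ((-1 : ℤˣ) ^ n) • x = ((-1 : k) ^ n) • x := by
  rcases Int.even_or_odd n with h | h
  · simp [h.neg_one_zpow]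
  · simp [h.neg_one_zpow]

/-- An element of a graded vector space is a sum of homogeneous ones. -/
lemma graded_induction (ℳ : ℤ → Submodule k M) [Decomposition ℳ] {p : M → Prop}
    (hom : ∀ i, ∀ x ∈ ℳ i, p x) (add : ∀ x y, p x → p y → p (x + y)) (x : M) : p x :=
  Decomposition.inductionOn ℳ (hom 0 0 (zero_mem _)) (fun m => hom _ _ m.2) add x

lemma graded_hom_ext (ℳ : ℤ → Submodule k M) [Decomposition ℳ] {f g : M →ₗ[k] P}
    (h : ∀ i, ∀ x ∈ ℳ i, f x = g x) : f = g :=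
  decompose_lhom_ext ℳ fun i => LinearMap.ext fun x => h i x x.2

lemma tensor_induction (ℳ : ℤ → Submodule k M) [Decomposition ℳ] (𝒩 : ℤ → Submodule k N)
    [Decomposition 𝒩] {p : M ⊗[k] N → Prop}
    (hom : ∀ i j, ∀ x ∈ ℳ i, ∀ y ∈ 𝒩 j, p (x ⊗ₜ y)) (add : ∀ x y, p x → p y → p (x + y))
    (x : M ⊗[k] N) : p x := by
  induction x with
  | zero => simpa using hom 0 0 0 (zero_mem _) 0 (zero_mem _)
  | add x y hx hy => exact add x y hx hy
  | tmul x y =>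
    induction x using graded_induction ℳ with
    | add x x' hx hx' => rw [add_tmul]; exact add _ _ hx hx'
    | hom i x hx =>
      induction y using graded_induction 𝒩 with
      | add y y' hy hy' => rw [tmul_add]; exact add _ _ hy hy'
      | hom j y hy => exact hom i j x hx y hy

/-- To give a decomposition of `M` it is enough to give a linear map that splits every homogeneous
element in the obvious way and whose components sum up to the given element. -/
abbrev decompositionMk (ℳ : ℤ → Submodule k M) (D : M →ₗ[k] ⨁ i, ℳ i)
    (h₁ : ∀ x, DirectSum.coeLinearMap ℳ (D x) = x)
    (h₂ : ∀ i (x : ℳ i), D x = DirectSum.lof k ℤ (fun i => ℳ i) i x) : Decomposition ℳ :=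
  Decomposition.ofLinearMap ℳ D (LinearMap.ext h₁) (by
    ext i x : 2
    simpa using h₂ i x)

/-- A linear map out of a graded vector space, given on the homogeneous components. -/
def gradedLift {Q : Type u} [AddCommMonoid Q] [Module k Q] (ℳ : ℤ → Submodule k M)
    [Decomposition ℳ] (f : ∀ i, ℳ i →ₗ[k] Q) : M →ₗ[k] Q :=
  DirectSum.toModule k ℤ Q f ∘ₗ (decomposeLinearEquiv ℳ).toLinearMap

lemma gradedLift_of_mem {Q : Type u} [AddCommMonoid Q] [Module k Q] (ℳ : ℤ → Submodule k M)
    [Decomposition ℳ] (f : ∀ i, ℳ i →ₗ[k] Q) {i : ℤ} {x : M} (hx : x ∈ ℳ i) : gradedLift ℳ f x = f i ⟨x, hx⟩ := by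
  have : decomposeLinearEquiv ℳ x = lof k ℤ (fun i => ℳ i) i ⟨x, hx⟩ :=
    decomposeLinearEquiv_apply_coe ℳ i ⟨x, hx⟩
  simp [gradedLift, this]

/-- The sign operator `x ↦ (-1)^|x| x`. -/
def signMap (ℳ : ℤ → Submodule k M) [Decomposition ℳ] : M →ₗ[k] M :=
  gradedLift ℳ fun i => ((-1 : k) ^ i) • (ℳ i).subtype

lemma signMap_of_mem (ℳ : ℤ → Submodule k M) [Decomposition ℳ] {i : ℤ} {x : M} (hx : x ∈ ℳ i) :
    signMap ℳ x = (-1 : k) ^ i • x := by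
  simp [signMap, gradedLift_of_mem ℳ _ hx]

/-- The Koszul symmetry `x ⊗ y ↦ (-1)^(|x||y|) y ⊗ x`. -/
def koszulSwap (ℳ : ℤ → Submodule k M) [Decomposition ℳ] (𝒩 : ℤ → Submodule k N)
    [Decomposition 𝒩] : M ⊗[k] N →ₗ[k] N ⊗[k] M :=
  TensorProduct.lift (gradedLift ℳ fun i => LinearMap.flip (gradedLift 𝒩 fun j =>
    ((-1 : k) ^ (i * j)) • ((TensorProduct.mk k N M).compl₂ (ℳ i).subtype ∘ₗ (𝒩 j).subtype)))

lemma koszulSwap_tmul (ℳ : ℤ → Submodule k M) [Decomposition ℳ] (𝒩 : ℤ → Submodule k N)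
    [Decomposition 𝒩] {i j : ℤ} {x : M} (hx : x ∈ ℳ i) {y : N} (hy : y ∈ 𝒩 j) :
    koszulSwap ℳ 𝒩 (x ⊗ₜ y) = (-1 : k) ^ (i * j) • (y ⊗ₜ x) := by
  simp [koszulSwap, gradedLift_of_mem ℳ _ hx, gradedLift_of_mem 𝒩 _ hy]

/-- The total grading on a tensor product: degree `n` is spanned by the `x ⊗ y` with `x`, `y`
homogeneous and `|x| + |y| = n`. -/
def tensorGrading (ℳ : ℤ → Submodule k M) (𝒩 : ℤ → Submodule k N) (n : ℤ) :
    Submodule k (M ⊗[k] N) :=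
  Submodule.span k {t | ∃ i j x y, i + j = n ∧ x ∈ ℳ i ∧ y ∈ 𝒩 j ∧ x ⊗ₜ y = t}

lemma tmul_mem_tensorGrading {ℳ : ℤ → Submodule k M} {𝒩 : ℤ → Submodule k N} {i j n : ℤ}
    (h : i + j = n) {x : M} (hx : x ∈ ℳ i) {y : N} (hy : y ∈ 𝒩 j) :
    x ⊗ₜ[k] y ∈ tensorGrading ℳ 𝒩 n :=
  Submodule.subset_span ⟨i, j, x, y, h, hx, hy, rfl⟩

/-- Linear maps out of the tensor product that respect the degree on homogeneous tensors respect
the degree. -/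
lemma map_mem_of_tensorGrading {ℳ : ℤ → Submodule k M} {𝒩 : ℤ → Submodule k N} {n : ℤ}
    (f : M ⊗[k] N →ₗ[k] P) (S : Submodule k P)
    (h : ∀ i j x y, i + j = n → x ∈ ℳ i → y ∈ 𝒩 j → f (x ⊗ₜ y) ∈ S)
    {t : M ⊗[k] N} (ht : t ∈ tensorGrading ℳ 𝒩 n) : f t ∈ S := by
  have : tensorGrading ℳ 𝒩 n ≤ S.comap f := by
    refine Submodule.span_le.2 ?_
    rintro _ ⟨i, j, x, y, hn, hx, hy, rfl⟩
    exact h i j x y hn hx hy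
  exact this ht

/-- The decomposition of a tensor product into its total degrees, as a map. -/
def tensorDecompose (ℳ : ℤ → Submodule k M) [Decomposition ℳ] (𝒩 : ℤ → Submodule k N)
    [Decomposition 𝒩] : M ⊗[k] N →ₗ[k] ⨁ n, tensorGrading ℳ 𝒩 n :=
  TensorProduct.lift (gradedLift ℳ fun i => LinearMap.flip (gradedLift 𝒩 fun j =>
    LinearMap.mk₂ k (fun (y : 𝒩 j) (x : ℳ i) =>
      lof k ℤ (fun n => tensorGrading ℳ 𝒩 n) (i + j)
        ⟨x.1 ⊗ₜ y.1, tmul_mem_tensorGrading rfl x.2 y.2⟩)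
      (fun y y' x => by rw [← map_add]; congr 1; ext; simp [tmul_add])
      (fun c y x => by rw [← map_smul]; congr 1; ext; simp)
      (fun y x x' => by rw [← map_add]; congr 1; ext; simp [add_tmul])
      (fun c y x => by rw [← map_smul]; congr 1)))

lemma tensorDecompose_tmul (ℳ : ℤ → Submodule k M) [Decomposition ℳ] (𝒩 : ℤ → Submodule k N)
    [Decomposition 𝒩] {i j n : ℤ} (h : i + j = n) {x : M} (hx : x ∈ ℳ i) {y : N} (hy : y ∈ 𝒩 j) :
    tensorDecompose ℳ 𝒩 (x ⊗ₜ y) = lof k ℤ (fun n => tensorGrading ℳ 𝒩 n) n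
      ⟨x ⊗ₜ y, tmul_mem_tensorGrading h hx hy⟩ := by
  subst h
  simp [tensorDecompose, gradedLift_of_mem ℳ _ hx, gradedLift_of_mem 𝒩 _ hy]

instance tensorDecomposition (ℳ : ℤ → Submodule k M) [Decomposition ℳ] (𝒩 : ℤ → Submodule k N)
    [Decomposition 𝒩] : Decomposition (tensorGrading ℳ 𝒩) :=
  decompositionMk _ (tensorDecompose ℳ 𝒩)
    (fun t => by
      induction t using tensor_induction ℳ 𝒩 with
      | add x y hx hy => rw [map_add, map_add, hx, hy]
      | hom i j x hx y hy => simp [tensorDecompose_tmul ℳ 𝒩 rfl hx hy])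
    (by
      rintro n ⟨t, ht⟩
      induction ht using Submodule.span_induction with
      | mem t h =>
        obtain ⟨i, j, x, y, h, hx, hy, rfl⟩ := h
        exact tensorDecompose_tmul ℳ 𝒩 h hx hy
      | zero => exact (map_zero _).trans (map_zero _).symm
      | add x y hx hy ihx ihy =>
        rw [map_add, ihx, ihy, ← map_add]; rfl
      | smul c x hx ih => rw [map_smul, ih, ← map_smul]; rfl)

/-- The differential `d (x ⊗ y) = dx ⊗ y + (-1)^|x| x ⊗ dy` of a tensor product. -/
def tensorD (ℳ : ℤ → Submodule k M) [Decomposition ℳ] (dM : M →ₗ[k] M) (dN : N →ₗ[k] N) :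
    M ⊗[k] N →ₗ[k] M ⊗[k] N :=
  TensorProduct.map dM LinearMap.id + TensorProduct.map (signMap ℳ) dN

lemma tensorD_tmul (ℳ : ℤ → Submodule k M) [Decomposition ℳ] (dM : M →ₗ[k] M) (dN : N →ₗ[k] N)
    {i : ℤ} {x : M} (hx : x ∈ ℳ i) (y : N) :
    tensorD ℳ dM dN (x ⊗ₜ y) = dM x ⊗ₜ y + (-1 : k) ^ i • (x ⊗ₜ dN y) := by
  simp [tensorD, signMap_of_mem ℳ hx, smul_tmul']

lemma tensorD_mem {ℳ : ℤ → Submodule k M} [Decomposition ℳ] {𝒩 : ℤ → Submodule k N}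
    {dM : M →ₗ[k] M} {dN : N →ₗ[k] N} (hM : ∀ i, ∀ x ∈ ℳ i, dM x ∈ ℳ (i + 1))
    (hN : ∀ i, ∀ x ∈ 𝒩 i, dN x ∈ 𝒩 (i + 1)) (n : ℤ) (t : M ⊗[k] N)
    (ht : t ∈ tensorGrading ℳ 𝒩 n) : tensorD ℳ dM dN t ∈ tensorGrading ℳ 𝒩 (n + 1) := by
  refine map_mem_of_tensorGrading _ _ (fun i j x y h hx hy => ?_) ht
  rw [tensorD_tmul ℳ dM dN hx]
  exact add_mem (tmul_mem_tensorGrading (by omega) (hM i x hx) hy)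
    (Submodule.smul_mem _ _ (tmul_mem_tensorGrading (by omega) hx (hN j y hy)))

lemma tensorD_tensorD {ℳ : ℤ → Submodule k M} [Decomposition ℳ] 
    {dM : M →ₗ[k] M} {dN : N →ₗ[k] N} (hM : ∀ i, ∀ x ∈ ℳ i, dM x ∈ ℳ (i + 1))
    (hdM : ∀ x, dM (dM x) = 0) (hdN : ∀ y, dN (dN y) = 0) (t : M ⊗[k] N) :
    tensorD ℳ dM dN (tensorD ℳ dM dN t) = 0 := by
  induction t with
  | zero => simp
  | add x y hx hy => rw [map_add, map_add, hx, hy, add_zero]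
  | tmul x y =>
    induction x using graded_induction ℳ with
    | add x x' hx hx' => rw [add_tmul, map_add, map_add, hx, hx', add_zero]
    | hom i x hx =>
      rw [tensorD_tmul ℳ dM dN hx, map_add, map_smul, tensorD_tmul ℳ dM dN hx,
        tensorD_tmul ℳ dM dN (hM i x hx), hdM, hdN, sgn_add_one]
      simp

instance shiftDecomposition (ℳ : ℤ → Submodule k M) [Decomposition ℳ] (n : ℤ) :
    Decomposition (fun i => ℳ (i + n)) :=
  decompositionMk _
    (gradedLift ℳ fun j => lof k ℤ (fun i => ℳ (i + n)) (j - n) ∘ₗ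
      (Submodule.inclusion (le_of_eq (by rw [sub_add_cancel]))))
    (fun x => by
      induction x using graded_induction ℳ with
      | add x y hx hy => rw [map_add, map_add, hx, hy]
      | hom i x hx => simp [gradedLift_of_mem ℳ _ hx])
    (by
      rintro i ⟨x, hx⟩
      rw [gradedLift_of_mem ℳ _ hx]
      have : ∀ j (h : j = i) (hx' : x ∈ ℳ (j + n)),
          lof k ℤ (fun i => ℳ (i + n)) j ⟨x, hx'⟩ = lof k ℤ (fun i => ℳ (i + n)) i ⟨x, hx⟩ := by
        rintro j rfl hx'; rfl
      exact this (i + n - n) (by omega) _)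

/-- The decomposition of a direct sum of graded vector spaces, as a map. -/
def prodDecompose (ℳ : ℤ → Submodule k M) [Decomposition ℳ] (𝒩 : ℤ → Submodule k N)
    [Decomposition 𝒩] : M × N →ₗ[k] ⨁ i, (ℳ i).prod (𝒩 i) :=
  LinearMap.coprod
    (gradedLift ℳ fun i => lof k ℤ (fun i => (ℳ i).prod (𝒩 i)) i ∘ₗ
      LinearMap.codRestrict ((ℳ i).prod (𝒩 i)) (LinearMap.inl k M N ∘ₗ (ℳ i).subtype)
        (fun x => by simp))
    (gradedLift 𝒩 fun i => lof k ℤ (fun i => (ℳ i).prod (𝒩 i)) i ∘ₗ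
      LinearMap.codRestrict ((ℳ i).prod (𝒩 i)) (LinearMap.inr k M N ∘ₗ (𝒩 i).subtype)
        (fun x => by simp))

lemma prodDecompose_of_mem (ℳ : ℤ → Submodule k M) [Decomposition ℳ] (𝒩 : ℤ → Submodule k N)
    [Decomposition 𝒩] {i : ℤ} {x : M × N} (hx : x ∈ (ℳ i).prod (𝒩 i)) :
    prodDecompose ℳ 𝒩 x = lof k ℤ (fun i => (ℳ i).prod (𝒩 i)) i ⟨x, hx⟩ := by
  rw [prodDecompose, LinearMap.coprod_apply, gradedLift_of_mem ℳ _ hx.1,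
    gradedLift_of_mem 𝒩 _ hx.2, LinearMap.comp_apply, LinearMap.comp_apply, ← map_add]
  congr 1
  ext
  · exact add_zero x.1
  · exact zero_add x.2

instance prodDecomposition (ℳ : ℤ → Submodule k M) [Decomposition ℳ] (𝒩 : ℤ → Submodule k N)
    [Decomposition 𝒩] : Decomposition (fun i => (ℳ i).prod (𝒩 i)) :=
  decompositionMk _ (prodDecompose ℳ 𝒩)
    (by
      rintro ⟨x, y⟩
      have h1 : DirectSum.coeLinearMap (fun i => (ℳ i).prod (𝒩 i))
          (prodDecompose ℳ 𝒩 (x, 0)) = (x, 0) := by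
        induction x using graded_induction ℳ with
        | add x x' hx hx' =>
          rw [show (x + x', (0 : N)) = (x, 0) + (x', 0) by simp, map_add, map_add, hx, hx']
        | hom i x hx =>
          rw [prodDecompose_of_mem ℳ 𝒩 (i := i) (x := (x, 0)) ⟨hx, zero_mem _⟩]
          simp
      have h2 : DirectSum.coeLinearMap (fun i => (ℳ i).prod (𝒩 i))
          (prodDecompose ℳ 𝒩 (0, y)) = (0, y) := by
        induction y using graded_induction 𝒩 with
        | add y y' hy hy' =>
          rw [show ((0 : M), y + y') = (0, y) + (0, y') by simp, map_add, map_add, hy, hy']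
        | hom i y hy =>
          rw [prodDecompose_of_mem ℳ 𝒩 (i := i) (x := (0, y)) ⟨zero_mem _, hy⟩]
          simp
      rw [show (x, y) = (x, 0) + (0, y) by simp, map_add, map_add, h1, h2])
    (by
      rintro i ⟨x, hx⟩
      exact prodDecompose_of_mem ℳ 𝒩 hx)

instance zeroDecomposition [Subsingleton M] : Decomposition (fun _ : ℤ => (⊥ : Submodule k M)) :=
  decompositionMk (fun _ : ℤ => (⊥ : Submodule k M)) 0 (fun _ => Subsingleton.elim _ _)
    (fun i x => by
      rw [LinearMap.zero_apply, Subsingleton.elim x 0, map_zero])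

end Graded

/-- A differential graded algebra over `k`: a `ℤ`-graded associative unital `k`-algebra with a
differential of degree `+1` satisfying the graded Leibniz rule. -/
structure DGAlgebra (k : Type u) [Field k] where
  carrier : Type u
  [ring : Ring carrier]
  [algebra : Algebra k carrier]
  grading : ℤ → Submodule k carrier
  [graded : GradedAlgebra grading]
  d : carrier →ₗ[k] carrier
  d_mem : ∀ i, ∀ a ∈ grading i, d a ∈ grading (i + 1)
  d_d : ∀ a, d (d a) = 0
  d_mul : ∀ i, ∀ a ∈ grading i, ∀ b, d (a * b) = d a * b + (-1 : k) ^ i • (a * d b)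

namespace DGAlgebra

variable {k : Type u} [Field k]

instance : CoeSort (DGAlgebra k) (Type u) := ⟨carrier⟩
instance (A : DGAlgebra k) : Ring A := A.ring
instance (A : DGAlgebra k) : Algebra k A := A.algebra
instance (A : DGAlgebra k) : GradedAlgebra A.grading := A.graded

variable (A B : DGAlgebra k)

/-- The underlying vector space of the opposite dg algebra. -/
def OpCarrier : Type u := A

instance : AddCommGroup A.OpCarrier := inferInstanceAs (AddCommGroup A)
instance : Module k A.OpCarrier := inferInstanceAs (Module k A)

/-- The identity map from a dg algebra to its opposite. -/
def toOp : A ≃ₗ[k] A.OpCarrier := LinearEquiv.refl k A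

/-- The opposite multiplication `(a, b) ↦ (-1)^(|a||b|) b a`, on the vector space `A`. -/
def opMul : A →ₗ[k] A →ₗ[k] A :=
  (TensorProduct.mk k A A).compr₂ (LinearMap.mul' k A ∘ₗ koszulSwap A.grading A.grading)

variable {A} in
lemma opMul_of_mem {i j : ℤ} {a b : A} (ha : a ∈ A.grading i) (hb : b ∈ A.grading j) :
    A.opMul a b = (-1 : k) ^ (i * j) • (b * a) := by
  simp [opMul, koszulSwap_tmul A.grading A.grading ha hb]

variable {A} in
lemma opMul_mem {i j : ℤ} {a b : A} (ha : a ∈ A.grading i) (hb : b ∈ A.grading j) :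
    A.opMul a b ∈ A.grading (i + j) := by
  rw [opMul_of_mem ha hb, add_comm i j]
  exact Submodule.smul_mem _ _ (SetLike.mul_mem_graded hb ha)

lemma one_opMul (a : A) : A.opMul 1 a = a := by
  induction a using graded_induction A.grading with
  | add x y hx hy => rw [map_add, hx, hy]
  | hom i x hx => rw [opMul_of_mem (SetLike.one_mem_graded A.grading) hx]; simp

lemma opMul_one (a : A) : A.opMul a 1 = a := by
  induction a using graded_induction A.grading with
  | add x y hx hy => rw [map_add, LinearMap.add_apply, hx, hy]
  | hom i x hx => rw [opMul_of_mem hx (SetLike.one_mem_graded A.grading)]; simp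

lemma opMul_assoc (a b c : A) : A.opMul (A.opMul a b) c = A.opMul a (A.opMul b c) := by
  induction a using graded_induction A.grading with
  | add x y hx hy => simp only [map_add, LinearMap.add_apply, hx, hy]
  | hom i a ha =>
    induction b using graded_induction A.grading with
    | add x y hx hy => simp only [map_add, LinearMap.add_apply, hx, hy]
    | hom j b hb =>
      induction c using graded_induction A.grading with
      | add x y hx hy => simp only [map_add, hx, hy]
      | hom l c hc =>
        rw [opMul_of_mem (opMul_mem ha hb) hc, opMul_of_mem ha (opMul_mem hb hc),
          opMul_of_mem ha hb, opMul_of_mem hb hc]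
        simp only [mul_smul_comm, smul_mul_assoc, smul_smul, mul_assoc, add_mul, mul_add, sgn_add]
        congr 1
        ring

lemma d_opMul {i : ℤ} {a : A} (ha : a ∈ A.grading i) (b : A) :
    A.d (A.opMul a b) = A.opMul (A.d a) b + (-1 : k) ^ i • A.opMul a (A.d b) := by
  induction b using graded_induction A.grading with
  | add x y hx hy => simp only [map_add, hx, hy, smul_add]; abel
  | hom j b hb =>
    rw [opMul_of_mem ha hb, opMul_of_mem (A.d_mem i a ha) hb, opMul_of_mem ha (A.d_mem j b hb),
      map_smul, A.d_mul j b hb, add_mul, mul_add, sgn_add, sgn_add, one_mul, mul_one, smul_add,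
      smul_smul, smul_smul, add_comm, mul_comm ((-1 : k) ^ i), mul_assoc, sgn_sq, mul_one]

instance : Mul A.OpCarrier := ⟨fun a b => A.toOp (A.opMul (A.toOp.symm a) (A.toOp.symm b))⟩
instance : One A.OpCarrier := ⟨A.toOp 1⟩

lemma op_mul_def (a b : A) : A.toOp a * A.toOp b = A.toOp (A.opMul a b) := rfl

instance : Ring A.OpCarrier :=
  { (inferInstance : AddCommGroup A.OpCarrier), (inferInstance : Mul A.OpCarrier),
    (inferInstance : One A.OpCarrier) with
    left_distrib := fun a b c => map_add (A.opMul a) b c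
    right_distrib := fun a b c => LinearMap.map_add₂ A.opMul a b c
    zero_mul := fun a => LinearMap.map_zero₂ A.opMul a
    mul_zero := fun a => map_zero (A.opMul a)
    mul_assoc := fun a b c => A.opMul_assoc a b c
    one_mul := fun a => A.one_opMul a
    mul_one := fun a => A.opMul_one a }

instance : Algebra k A.OpCarrier :=
  Algebra.ofModule (fun r a b => LinearMap.map_smul₂ A.opMul r a b)
    (fun r a b => map_smul (A.opMul a) r b)

/-- The grading of the opposite dg algebra is that of `A`. -/
def opGrading (i : ℤ) : Submodule k A.OpCarrier :=
  (A.grading i : Submodule k A)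

instance : Decomposition A.opGrading := inferInstanceAs (Decomposition A.grading)

instance : GradedAlgebra A.opGrading where
  one_mem := SetLike.one_mem_graded A.grading
  mul_mem _ _ _ _ ha hb := opMul_mem (A := A) ha hb

/-- The opposite dg algebra `A^op`: same graded space and differential, with multiplication
`(a, b) ↦ (-1)^(|a||b|) b a`. -/
def op : DGAlgebra k where
  carrier := A.OpCarrier
  grading := A.opGrading
  d := A.toOp.toLinearMap ∘ₗ A.d ∘ₗ A.toOp.symm.toLinearMap
  d_mem := A.d_mem
  d_d := A.d_d
  d_mul _ _ ha b := A.d_opMul ha b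

/-- The underlying graded algebra of `A ⊗ B`, with
`(a ⊗ b) (a' ⊗ b') = (-1)^(|b||a'|) a a' ⊗ b b'`. -/
abbrev TensorCarrier : Type u := GradedTensorProduct k A.grading B.grading

/-- The identity map from the plain tensor product to the graded one. -/
abbrev toTensor : A ⊗[k] B ≃ₗ[k] TensorCarrier A B := GradedTensorProduct.of k A.grading B.grading

variable {A B} in
lemma toTensor_mul {i j : ℤ} (a : A) {b : B} (hb : b ∈ B.grading j) {a' : A}
    (ha' : a' ∈ A.grading i) (b' : B) :
    toTensor A B (a ⊗ₜ b) * toTensor A B (a' ⊗ₜ b') =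
      (-1 : k) ^ (j * i) • toTensor A B ((a * a') ⊗ₜ (b * b')) := by
  have h := GradedTensorProduct.tmul_coe_mul_coe_tmul (R := k) A.grading B.grading a ⟨b, hb⟩
    ⟨a', ha'⟩ b'
  rw [← units_smul_eq]
  exact h

/-- The total grading of the tensor product of dg algebras. -/
def tensorAlgGrading (n : ℤ) : Submodule k (TensorCarrier A B) :=
  (tensorGrading A.grading B.grading n : Submodule k (A ⊗[k] B))

instance : Decomposition (tensorAlgGrading A B) :=
  inferInstanceAs (Decomposition (tensorGrading A.grading B.grading))

variable {A B} in
lemma toTensor_mem {i j n : ℤ} (h : i + j = n) {a : A} (ha : a ∈ A.grading i) {b : B}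
    (hb : b ∈ B.grading j) : toTensor A B (a ⊗ₜ b) ∈ tensorAlgGrading A B n :=
  tmul_mem_tensorGrading h ha hb

instance : GradedAlgebra (tensorAlgGrading A B) where
  one_mem := toTensor_mem (add_zero 0) (SetLike.one_mem_graded A.grading)
    (SetLike.one_mem_graded B.grading)
  mul_mem m n s t hs ht := by
    refine map_mem_of_tensorGrading
      ((GradedTensorProduct.mulHom A.grading B.grading).flip t ∘ₗ (toTensor A B).toLinearMap) _ (fun i j a b h ha hb => ?_) hs
    refine map_mem_of_tensorGrading
      (GradedTensorProduct.mulHom A.grading B.grading (toTensor A B (a ⊗ₜ b)) ∘ₗ (toTensor A B).toLinearMap) _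
      (fun i' j' a' b' h' ha' hb' => ?_) ht
    change toTensor A B (a ⊗ₜ b) * toTensor A B (a' ⊗ₜ b') ∈ _
    rw [toTensor_mul a hb ha' b']
    exact Submodule.smul_mem _ _ (toTensor_mem (by omega) (SetLike.mul_mem_graded ha ha')
      (SetLike.mul_mem_graded hb hb'))

/-- The differential `d (a ⊗ b) = da ⊗ b + (-1)^|a| a ⊗ db`. -/
def tensorAlgD : TensorCarrier A B →ₗ[k] TensorCarrier A B :=
  (toTensor A B).toLinearMap ∘ₗ tensorD A.grading A.d B.d ∘ₗ (toTensor A B).symm.toLinearMap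

variable {A B} in
lemma tensorAlgD_toTensor {i : ℤ} {a : A} (ha : a ∈ A.grading i) (b : B) :
    tensorAlgD A B (toTensor A B (a ⊗ₜ b)) =
      toTensor A B (A.d a ⊗ₜ b) + (-1 : k) ^ i • toTensor A B (a ⊗ₜ B.d b) := by
  rw [← map_smul, ← map_add, ← tensorD_tmul A.grading A.d B.d ha]
  rfl

variable {A B} in
lemma toTensor_induction {p : TensorCarrier A B → Prop}
    (hom : ∀ i j, ∀ a ∈ A.grading i, ∀ b ∈ B.grading j, p (toTensor A B (a ⊗ₜ b)))
    (add : ∀ x y, p x → p y → p (x + y)) (x : TensorCarrier A B) : p x :=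
  tensor_induction A.grading B.grading (p := p) hom add x

lemma tensorAlgD_mul (n : ℤ) (s : TensorCarrier A B) (hs : s ∈ tensorAlgGrading A B n)
    (t : TensorCarrier A B) : tensorAlgD A B (s * t) =
      tensorAlgD A B s * t + (-1 : k) ^ n • (s * tensorAlgD A B t) := by
  have key : ∀ i j, i + j = n → ∀ a ∈ A.grading i, ∀ b ∈ B.grading j,
      tensorAlgD A B (toTensor A B (a ⊗ₜ b) * t) = tensorAlgD A B (toTensor A B (a ⊗ₜ b)) * t +
        (-1 : k) ^ n • (toTensor A B (a ⊗ₜ b) * tensorAlgD A B t) := by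
    rintro i j rfl a ha b hb
    induction t using toTensor_induction with
    | add x y hx hy => simp only [mul_add, map_add, hx, hy, smul_add]; abel
    | hom i' j' a' ha' b' hb' =>
      rw [toTensor_mul a hb ha' b', map_smul,
        tensorAlgD_toTensor (SetLike.mul_mem_graded ha ha'), tensorAlgD_toTensor ha,
        tensorAlgD_toTensor ha', mul_add, add_mul, smul_mul_assoc, mul_smul_comm,
        toTensor_mul _ hb ha', toTensor_mul _ (B.d_mem j b hb) ha',
        toTensor_mul _ hb (A.d_mem i' a' ha'), toTensor_mul _ hb ha', A.d_mul i a ha,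
        B.d_mul j b hb, add_tmul, tmul_add, map_add, map_add, ← smul_tmul', tmul_smul, map_smul,
        map_smul]
      simp only [smul_add, smul_smul, sgn_add, add_mul, mul_add, one_mul, mul_one]
      match_scalars <;> ring_nf
      simp only [sgn_pow_two, mul_one]
  let μ := GradedTensorProduct.mulHom A.grading B.grading
  have := map_mem_of_tensorGrading (P := TensorCarrier A B)
      ((tensorAlgD A B ∘ₗ μ.flip t - μ.flip t ∘ₗ tensorAlgD A B
        - (-1 : k) ^ n • μ.flip (tensorAlgD A B t)) ∘ₗ (toTensor A B).toLinearMap) ⊥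
      (fun i j a b h ha hb => by
        have := key i j h a ha b hb
        rw [Submodule.mem_bot]
        change tensorAlgD A B (toTensor A B (a ⊗ₜ b) * t) -
          tensorAlgD A B (toTensor A B (a ⊗ₜ b)) * t -
          (-1 : k) ^ n • (toTensor A B (a ⊗ₜ b) * tensorAlgD A B t) = 0
        rw [this]; abel) hs
  rw [Submodule.mem_bot] at this
  have h2 : tensorAlgD A B (s * t) - tensorAlgD A B s * t -
    (-1 : k) ^ n • (s * tensorAlgD A B t) = 0 := this
  rw [sub_sub, sub_eq_zero] at h2
  exact h2

/-- The tensor product `A ⊗ B` of dg algebras over `k`. -/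
def tensor : DGAlgebra k where
  carrier := TensorCarrier A B
  grading := tensorAlgGrading A B
  d := tensorAlgD A B
  d_mem := tensorD_mem A.d_mem B.d_mem
  d_d := tensorD_tensorD A.d_mem A.d_d B.d_d
  d_mul := tensorAlgD_mul A B

end DGAlgebra

/-- A right dg module over a dg algebra `A`; `act m a` is the product `m a`. -/
structure DGModule {k : Type u} [Field k] (A : DGAlgebra k) where
  carrier : Type u
  [addCommGroup : AddCommGroup carrier]
  [module : Module k carrier]
  grading : ℤ → Submodule k carrier
  [decomposition : Decomposition grading]
  act : carrier →ₗ[k] A.carrier →ₗ[k] carrier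
  act_one : ∀ m, act m 1 = m
  act_mul : ∀ m a b, act m (a * b) = act (act m a) b
  act_mem : ∀ i j, ∀ m ∈ grading i, ∀ a ∈ A.grading j, act m a ∈ grading (i + j)
  d : carrier →ₗ[k] carrier
  d_mem : ∀ i, ∀ m ∈ grading i, d m ∈ grading (i + 1)
  d_d : ∀ m, d (d m) = 0
  d_act : ∀ i, ∀ m ∈ grading i, ∀ a, d (act m a) = act (d m) a + (-1 : k) ^ i • act m (A.d a)

namespace DGModule

variable {k : Type u} [Field k] {A B : DGAlgebra k}

instance : CoeSort (DGModule A) (Type u) := ⟨carrier⟩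
instance (M : DGModule A) : AddCommGroup M := M.addCommGroup
instance (M : DGModule A) : Module k M := M.module
instance (M : DGModule A) : Decomposition M.grading := M.decomposition

/-- A morphism of dg modules: a linear map of degree `0`, compatible with the action of `A` and
with the differentials. -/
@[ext]
structure Hom (M N : DGModule A) where
  toLin : M →ₗ[k] N
  map_mem : ∀ i, ∀ m ∈ M.grading i, toLin m ∈ N.grading i
  map_act : ∀ m a, toLin (M.act m a) = N.act (toLin m) a
  map_d : ∀ m, toLin (M.d m) = N.d (toLin m)

instance : Category (DGModule A) where
  Hom := Hom
  id M := ⟨LinearMap.id, fun _ _ h => h, fun _ _ => rfl, fun _ => rfl⟩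
  comp f g := ⟨g.toLin ∘ₗ f.toLin, fun i m h => g.map_mem i _ (f.map_mem i m h),
    fun m a => by simp [f.map_act, g.map_act], fun m => by simp [f.map_d, g.map_d]⟩

@[ext]
lemma hom_ext {M N : DGModule A} {f g : M ⟶ N} (h : ∀ m, f.toLin m = g.toLin m) : f = g :=
  Hom.ext (LinearMap.ext h)

@[simp]
lemma id_toLin (M : DGModule A) : Hom.toLin (𝟙 M) = LinearMap.id := rfl

@[simp]
lemma comp_toLin {M N P : DGModule A} (f : M ⟶ N) (g : N ⟶ P) :
    (f ≫ g).toLin = g.toLin ∘ₗ f.toLin := rfl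

variable (A) in
/-- The dg algebra `A` as a right dg module over itself. -/
def self : DGModule A where
  carrier := A
  grading := A.grading
  act := LinearMap.mul k A
  act_one m := mul_one m
  act_mul m a b := (mul_assoc m a b).symm
  act_mem _ _ _ hm _ ha := SetLike.mul_mem_graded hm ha
  d := A.d
  d_mem := A.d_mem
  d_d := A.d_d
  d_act := A.d_mul

/-- The zero dg module. -/
def zero : DGModule A where
  carrier := PUnit
  grading := fun _ => ⊥
  act := 0
  act_one _ := rfl
  act_mul _ _ _ := rfl
  act_mem _ _ _ _ _ _ := zero_mem _
  d := 0
  d_mem _ _ _ := zero_mem _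
  d_d _ := rfl
  d_act _ _ _ _ := rfl

/-- The direct sum `M ⊕ N`. -/
def prod (M N : DGModule A) : DGModule A where
  carrier := M × N
  grading := fun i => (M.grading i).prod (N.grading i)
  act := LinearMap.mk₂ k (fun x a => (M.act x.1 a, N.act x.2 a)) (by intros; simp) (by intros; simp)
    (by intros; simp) (by intros; simp)
  act_one x := by simp [M.act_one, N.act_one]
  act_mul x a b := by simp [M.act_mul, N.act_mul]
  act_mem i j x hx a ha := ⟨M.act_mem i j _ hx.1 a ha, N.act_mem i j _ hx.2 a ha⟩
  d := LinearMap.prodMap M.d N.d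
  d_mem i x hx := ⟨M.d_mem i _ hx.1, N.d_mem i _ hx.2⟩
  d_d x := by simp [M.d_d, N.d_d]
  d_act i x hx a := by simp [M.d_act i _ hx.1, N.d_act i _ hx.2]

/-- The shift `M[n]`: `M[n]^i = M^(i+n)`, with differential `(-1)^n d` and the action of `M`. -/
def shift (n : ℤ) (M : DGModule A) : DGModule A where
  carrier := M
  grading := fun i => M.grading (i + n)
  act := M.act
  act_one := M.act_one
  act_mul := M.act_mul
  act_mem i j m hm a ha := by
    have := M.act_mem (i + n) j m hm a ha
    rwa [add_right_comm] at this
  d := (-1 : k) ^ n • M.d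
  d_mem i m hm := by
    have := M.d_mem (i + n) m hm
    rw [add_right_comm] at this
    exact Submodule.smul_mem _ _ this
  d_d m := by simp [M.d_d]
  d_act i m hm a := by
    simp only [LinearMap.smul_apply, M.d_act (i + n) m hm a, map_smul, smul_add, smul_smul, sgn_add]
    rw [mul_left_comm, sgn_sq, mul_one]

/-- The mapping cone of `f : M ⟶ N`: the graded module `N ⊕ M[1]` with differential
`d (y, x) = (dy + f x, -dx)`. -/
def cone {M N : DGModule A} (f : M ⟶ N) : DGModule A where
  carrier := N × M
  grading := fun i => (N.grading i).prod (M.grading (i + 1))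
  decomposition := prodDecomposition N.grading (fun i => M.grading (i + 1))
  act := LinearMap.mk₂ k (fun x a => (N.act x.1 a, M.act x.2 a)) (by intros; simp) (by intros; simp)
    (by intros; simp) (by intros; simp)
  act_one x := by simp [M.act_one, N.act_one]
  act_mul x a b := by simp [M.act_mul, N.act_mul]
  act_mem i j x hx a ha := ⟨N.act_mem i j _ hx.1 a ha, (M.shift 1).act_mem i j _ hx.2 a ha⟩
  d := LinearMap.prod (N.d ∘ₗ LinearMap.fst k N M + f.toLin ∘ₗ LinearMap.snd k N M)
    (-(M.d ∘ₗ LinearMap.snd k N M))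
  d_mem i x hx := ⟨add_mem (N.d_mem i _ hx.1) (f.map_mem _ _ hx.2),
    neg_mem (M.d_mem (i + 1) _ hx.2)⟩
  d_d x := by simp [M.d_d, N.d_d, f.map_d]
  d_act i x hx a := by
    ext
    · simp [N.d_act i _ hx.1, f.map_act]; abel
    · simp [M.d_act (i + 1) _ hx.2, sgn_add_one, add_comm]

/-- The inclusion `N ⟶ Cone f`. -/
def coneInl {M N : DGModule A} (f : M ⟶ N) : N ⟶ cone f where
  toLin := LinearMap.inl k N M
  map_mem _ _ h := ⟨h, zero_mem _⟩
  map_act m a := by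
    change (N.act m a, (0 : M)) = (N.act m a, M.act 0 a)
    simp
  map_d m := by
    change (N.d m, (0 : M)) = (N.d m + f.toLin 0, -M.d 0)
    simp

/-- The projection `Cone f ⟶ M[1]`. -/
def coneSnd {M N : DGModule A} (f : M ⟶ N) : cone f ⟶ M.shift 1 where
  toLin := LinearMap.snd k N M
  map_mem _ _ h := h.2
  map_act _ _ := rfl
  map_d m := by
    change -M.d m.2 = ((-1 : k) ^ (1 : ℤ) • M.d) m.2
    simp

/-- The shift functor on dg modules. -/
def shiftFunctor (A : DGAlgebra k) (n : ℤ) : DGModule A ⥤ DGModule A where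
  obj M := M.shift n
  map {M N} f := ⟨f.toLin, fun i => f.map_mem (i + n), f.map_act, fun m => by
    change f.toLin ((-1 : k) ^ n • M.d m) = (-1 : k) ^ n • N.d (f.toLin m)
    exact (map_smul f.toLin _ _).trans (congrArg _ (f.map_d m))⟩

/-- The right action of `A ⊗ B` on `M ⊗ N`,
`(m ⊗ n) (a ⊗ b) = (-1)^(|n||a|) m a ⊗ n b`. -/
def tensorAct (M : DGModule A) (N : DGModule B) :
    M ⊗[k] N →ₗ[k] A.TensorCarrier B →ₗ[k] M ⊗[k] N :=
  (TensorProduct.curry (TensorProduct.map (TensorProduct.lift M.act) (TensorProduct.lift N.act) ∘ₗ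
    (TensorProduct.assoc k M A (N ⊗[k] B)).symm.toLinearMap ∘ₗ
    LinearMap.lTensor M ((TensorProduct.assoc k A N B).toLinearMap ∘ₗ
      LinearMap.rTensor B (koszulSwap N.grading A.grading) ∘ₗ
      (TensorProduct.assoc k N A B).symm.toLinearMap) ∘ₗ
    (TensorProduct.assoc k M N (A ⊗[k] B)).toLinearMap)).compl₂ (A.toTensor B).symm.toLinearMap

lemma tensorAct_tmul (M : DGModule A) (N : DGModule B) (m : M) {i j : ℤ} {n : N}
    (hn : n ∈ N.grading i) {a : A} (ha : a ∈ A.grading j) (b : B) :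
    tensorAct M N (m ⊗ₜ n) (A.toTensor B (a ⊗ₜ b)) =
      (-1 : k) ^ (i * j) • (M.act m a ⊗ₜ N.act n b) := by
  simp [tensorAct, koszulSwap_tmul N.grading A.grading hn ha, ← smul_tmul']

lemma tensorAct_one (M : DGModule A) (N : DGModule B) (t : M ⊗[k] N) :
    tensorAct M N t (1 : A.TensorCarrier B) = t := by
  induction t using tensor_induction M.grading N.grading with
  | add x y hx hy => rw [map_add, LinearMap.add_apply, hx, hy]
  | hom i j m hm n hn =>
    refine (tensorAct_tmul M N m hn (SetLike.one_mem_graded A.grading) 1).trans ?_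
    simp [M.act_one, N.act_one]

/-- The exterior tensor product `M ⊗ N` over `k`, a right dg module over `A ⊗ B`. -/
def tensor (M : DGModule A) (N : DGModule B) : DGModule (A.tensor B) where
  carrier := M ⊗[k] N
  grading := tensorGrading M.grading N.grading
  act := tensorAct M N
  act_one := tensorAct_one M N
  act_mul t x y := by
    change A.TensorCarrier B at x y
    change tensorAct M N t (x * y) = tensorAct M N (tensorAct M N t x) y
    induction t using tensor_induction M.grading N.grading with
    | add t t' ht ht' => simp only [map_add, LinearMap.add_apply, ht, ht']
    | hom i j m hm n hn =>
      induction x using DGAlgebra.toTensor_induction with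
      | add x x' hx hx' => simp only [add_mul, map_add, LinearMap.add_apply, hx, hx']
      | hom p q a ha b hb =>
        induction y using DGAlgebra.toTensor_induction with
        | add y y' hy hy' => simp only [mul_add, map_add, hy, hy']
        | hom r s a' ha' b' hb' =>
          rw [DGAlgebra.toTensor_mul a hb ha' b', map_smul, tensorAct_tmul M N m hn ha,
            tensorAct_tmul M N m hn (SetLike.mul_mem_graded ha ha'), map_smul,
            LinearMap.smul_apply,
            tensorAct_tmul M N _ (N.act_mem j q n hn b hb) ha', smul_smul, smul_smul, M.act_mul,
            N.act_mul, add_mul, mul_add, sgn_add, sgn_add]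
          congr 1
          ring
  act_mem i j t ht x hx := by
    refine map_mem_of_tensorGrading ((tensorAct M N).flip x) _ (fun p q m n h hm hn => ?_) ht
    refine map_mem_of_tensorGrading (tensorAct M N (m ⊗ₜ n) ∘ₗ (A.toTensor B).toLinearMap) _
      (fun p' q' a b h' ha hb => ?_) hx
    refine (tensorAct_tmul M N m hn ha b).symm ▸ Submodule.smul_mem _ _
      (tmul_mem_tensorGrading (by omega) (M.act_mem _ _ m hm a ha) (N.act_mem _ _ n hn b hb))
  d := tensorD M.grading M.d N.d
  d_mem := tensorD_mem M.d_mem N.d_mem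
  d_d := tensorD_tensorD M.d_mem M.d_d N.d_d
  d_act i t ht x := by
    change A.TensorCarrier B at x
    change tensorD M.grading M.d N.d (tensorAct M N t x) =
      tensorAct M N (tensorD M.grading M.d N.d t) x +
        (-1 : k) ^ i • tensorAct M N t (DGAlgebra.tensorAlgD A B x)
    have := map_mem_of_tensorGrading
      (tensorD M.grading M.d N.d ∘ₗ (tensorAct M N).flip x -
        (tensorAct M N).flip x ∘ₗ tensorD M.grading M.d N.d -
        (-1 : k) ^ i • (tensorAct M N).flip (DGAlgebra.tensorAlgD A B x)) ⊥
      (fun p q m n h hm hn => by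
        subst h
        simp only [Submodule.mem_bot, LinearMap.sub_apply, LinearMap.comp_apply,
          LinearMap.flip_apply, LinearMap.smul_apply]
        rw [sub_sub, sub_eq_zero]
        induction x using DGAlgebra.toTensor_induction with
        | add x x' hx hx' => simp only [map_add, hx, hx', smul_add]; abel
        | hom r s a ha b hb =>
          rw [tensorAct_tmul M N m hn ha, DGAlgebra.tensorAlgD_toTensor ha,
            tensorD_tmul M.grading M.d N.d hm, map_add, map_add, map_smul, map_smul, map_smul,
            LinearMap.add_apply, LinearMap.smul_apply,
            tensorD_tmul M.grading M.d N.d (M.act_mem p r m hm a ha),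
            tensorAct_tmul M N _ hn ha, tensorAct_tmul M N _ (N.d_mem q n hn) ha,
            tensorAct_tmul M N _ hn (A.d_mem r a ha), tensorAct_tmul M N _ hn ha,
            M.d_act p m hm, N.d_act q n hn, add_tmul, tmul_add, ← smul_tmul', tmul_smul]
          simp only [sgn_add, add_mul, mul_add, one_mul, mul_one]
          match_scalars <;> ring_nf
          simp only [sgn_pow_two, mul_one]) ht
    rw [Submodule.mem_bot] at this
    simp only [LinearMap.sub_apply, LinearMap.comp_apply, LinearMap.flip_apply,
      LinearMap.smul_apply] at this
    rwa [sub_sub, sub_eq_zero] at this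

/-- The action `x (a ⊗ b) = (-1)^(|a||x|) a x b` of `A^op ⊗ A` on `A`. -/
def diagonalAct (A : DGAlgebra k) : A →ₗ[k] A.op.TensorCarrier A →ₗ[k] A :=
  (TensorProduct.curry (LinearMap.mul' k A ∘ₗ
    LinearMap.rTensor A (TensorProduct.lift (A.opMul.compl₂ A.toOp.symm.toLinearMap)) ∘ₗ
    (TensorProduct.assoc k A A.OpCarrier A).symm.toLinearMap)).compl₂
      (A.op.toTensor A).symm.toLinearMap

lemma diagonalAct_apply (x a b : A) :
    diagonalAct A x (A.op.toTensor A (A.toOp a ⊗ₜ b)) = A.opMul x a * b := by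
  rfl

lemma diagonalAct_one (x : A) : diagonalAct A x (1 : A.op.TensorCarrier A) = x :=
  (diagonalAct_apply x 1 1).trans (by rw [A.opMul_one, mul_one])

lemma diagonalAct_mul (t : A) (x y : A.op.TensorCarrier A) :
    diagonalAct A t (x * y) = diagonalAct A (diagonalAct A t x) y := by
  induction t using graded_induction A.grading with
  | add t t' ht ht' => simp only [map_add, LinearMap.add_apply, ht, ht']
  | hom i t ht =>
    induction x using DGAlgebra.toTensor_induction with
    | add x x' hx hx' => simp only [add_mul, map_add, LinearMap.add_apply, hx, hx']
    | hom p q a ha b hb =>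
      induction y using DGAlgebra.toTensor_induction with
      | add y y' hy hy' => simp only [mul_add, map_add, hy, hy']
      | hom r s a' ha' b' hb' =>
        change A at a a'
        rw [DGAlgebra.toTensor_mul (A := A.op) a hb ha' b', map_smul]
        change (-1 : k) ^ (q * r) • (A.opMul t (A.opMul a a') * (b * b')) =
          A.opMul (A.opMul t a * b) a' * b'
        have h := DGAlgebra.opMul_mem (A := A) ht ha
        rw [← DGAlgebra.opMul_assoc, DGAlgebra.opMul_of_mem h ha',
          DGAlgebra.opMul_of_mem (SetLike.mul_mem_graded h hb) ha', smul_mul_assoc,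
          smul_mul_assoc, smul_smul, add_mul (i + p) q r, sgn_add, mul_comm]
        simp only [mul_assoc]

lemma d_diagonalAct {i : ℤ} {t : A} (ht : t ∈ A.grading i) (x : A.op.TensorCarrier A) :
    A.d (diagonalAct A t x) = diagonalAct A (A.d t) x +
      (-1 : k) ^ i • diagonalAct A t (DGAlgebra.tensorAlgD A.op A x) := by
  induction x using DGAlgebra.toTensor_induction with
  | add x x' hx hx' => simp only [map_add, hx, hx', smul_add]; abel
  | hom p q a ha b hb =>
    rw [DGAlgebra.tensorAlgD_toTensor (A := A.op) ha b, map_add, map_smul]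
    change A at a
    change A.d (A.opMul t a * b) = A.opMul (A.d t) a * b +
      (-1 : k) ^ i • (A.opMul t (A.d a) * b + (-1 : k) ^ p • (A.opMul t a * A.d b))
    rw [A.d_mul _ _ (DGAlgebra.opMul_mem (A := A) ht ha), A.d_opMul ht, add_mul, smul_add,
      smul_smul, smul_mul_assoc, sgn_add, add_assoc]

/-- The diagonal dg module: `A` as a right dg module over `A^op ⊗ A`. -/
def diagonal (A : DGAlgebra k) : DGModule (A.op.tensor A) where
  carrier := A
  grading := A.grading
  act := diagonalAct A
  act_one := diagonalAct_one
  act_mul := diagonalAct_mul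
  act_mem i j t ht x hx := by
    refine map_mem_of_tensorGrading (diagonalAct A t ∘ₗ (A.op.toTensor A).toLinearMap) _
      (fun p q a b h ha hb => ?_) hx
    subst h
    rw [← add_assoc]
    exact SetLike.mul_mem_graded (DGAlgebra.opMul_mem (A := A) ht ha) hb
  d := A.d
  d_mem := A.d_mem
  d_d := A.d_d
  d_act _ _ ht x := d_diagonalAct ht x

/-- The total cohomology `ker d / im d` of a dg module. -/
abbrev Cohomology (M : DGModule A) : Type u :=
  LinearMap.ker M.d ⧸ (LinearMap.range M.d).submoduleOf (LinearMap.ker M.d)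

/-- The map induced on cohomology by a morphism of dg modules. -/
def cohomologyMap {M N : DGModule A} (f : M ⟶ N) : M.Cohomology →ₗ[k] N.Cohomology :=
  Submodule.mapQ _ _
    (f.toLin.restrict (p := LinearMap.ker M.d) (q := LinearMap.ker N.d) fun m hm => by
      rw [LinearMap.mem_ker] at hm ⊢
      rw [← f.map_d, hm, map_zero])
    (by
      rintro ⟨_, _⟩ ⟨y, rfl⟩
      exact ⟨f.toLin y, (f.map_d y).symm⟩)

/-- A quasi-isomorphism is a morphism inducing a bijection on cohomology. -/
def quasiIso (A : DGAlgebra k) : MorphismProperty (DGModule A) :=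
  fun _ _ f => Function.Bijective (cohomologyMap f)

lemma quasiIso_iff {M N : DGModule A} (f : M ⟶ N) : quasiIso A f ↔
    (∀ m n, M.d m = 0 → f.toLin m = N.d n → ∃ m', m = M.d m') ∧
      ∀ n, N.d n = 0 → ∃ m n', M.d m = 0 ∧ n = f.toLin m + N.d n' := by
  have h0 : ∀ m : LinearMap.ker M.d, cohomologyMap f (Submodule.Quotient.mk m) = 0 ↔
      ∃ n, f.toLin m = N.d n := fun m => by
    refine (Submodule.Quotient.mk_eq_zero _).trans ⟨?_, ?_⟩
    · rintro ⟨n, hn⟩; exact ⟨n, hn.symm⟩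
    · rintro ⟨n, hn⟩; exact ⟨n, hn.symm⟩
  refine and_congr ?_ ?_
  · rw [injective_iff_map_eq_zero]
    constructor
    · intro h m n hm hn
      have := h (Submodule.Quotient.mk ⟨m, hm⟩) ((h0 _).2 ⟨n, hn⟩)
      obtain ⟨m', hm'⟩ := (Submodule.Quotient.mk_eq_zero _).1 this
      exact ⟨m', hm'.symm⟩
    · intro h x hx
      obtain ⟨⟨m, hm⟩, rfl⟩ := Submodule.Quotient.mk_surjective _ x
      obtain ⟨n, hn⟩ := (h0 _).1 hx
      obtain ⟨m', hm'⟩ := h m n hm hn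
      exact (Submodule.Quotient.mk_eq_zero _).2 ⟨m', hm'.symm⟩
  · constructor
    · intro h n hn
      obtain ⟨x, hx⟩ := h (Submodule.Quotient.mk ⟨n, hn⟩)
      obtain ⟨⟨m, hm⟩, rfl⟩ := Submodule.Quotient.mk_surjective _ x
      obtain ⟨n', hn'⟩ := (Submodule.Quotient.eq _).1 hx
      have hn' : N.d n' = f.toLin m - n := hn'
      exact ⟨m, -n', hm, by rw [map_neg, hn']; abel⟩
    · intro h y
      obtain ⟨⟨n, hn⟩, rfl⟩ := Submodule.Quotient.mk_surjective _ y
      obtain ⟨m, n', hm, hn'⟩ := h n hn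
      refine ⟨Submodule.Quotient.mk ⟨m, hm⟩, (Submodule.Quotient.eq _).2 ⟨-n', ?_⟩⟩
      change N.d (-n') = f.toLin m - n
      rw [hn', map_neg]; abel

lemma quasiIso_shift {M N : DGModule A} {f : M ⟶ N} (hf : quasiIso A f) (n : ℤ) :
    quasiIso A ((shiftFunctor A n).map f) := by
  have e : ∀ (P : DGModule A) (x : P), (P.shift n).d x = (-1 : k) ^ n • P.d x := fun _ _ => rfl
  have hn := sgn_sq (k := k) n
  have h0 : ∀ (P : DGModule A) (x : P), (P.shift n).d x = 0 ↔ P.d x = 0 := fun P x =>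
    smul_eq_zero_iff_right (M := P) (zpow_ne_zero n (by simp))
  have h1 : ∀ (P : DGModule A) (x : P), P.d x = (P.shift n).d ((-1 : k) ^ n • x : P) :=
    fun P x => by rw [e, map_smul, smul_smul, hn, one_smul]
  have h2 : ∀ (P : DGModule A) (x : P), (P.shift n).d x = P.d ((-1 : k) ^ n • x : P) :=
    fun P x => by rw [e, map_smul]
  rw [quasiIso_iff] at hf ⊢
  obtain ⟨hi, hs⟩ := hf
  refine ⟨fun (m : M) (y : N) hm hy => ?_, fun (y : N) hy => ?_⟩
  · obtain ⟨m', hm'⟩ := hi m _ ((h0 M m).1 hm) (hy.trans (h2 N y))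
    exact ⟨_, hm'.trans (h1 M m')⟩
  · obtain ⟨m, n', hm, hn'⟩ := hs y ((h0 N y).1 hy)
    exact ⟨m, _, (h0 M m).2 hm, hn'.trans (congrArg (f.toLin m + ·) (h1 N n'))⟩

end DGModule

open DGModule

variable {k : Type u} [Field k]

/-- The derived category `D(A)` of right dg `A`-modules: the localization of the category of dg
modules at the quasi-isomorphisms. -/
abbrev Derived (A : DGAlgebra k) := (quasiIso A).Localization

/-- The localization functor from dg modules to the derived category. -/
abbrev toDerived (A : DGAlgebra k) : DGModule A ⥤ Derived A := (quasiIso A).Q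

variable {A : DGAlgebra k}

lemma shift_isInvertedBy (A : DGAlgebra k) (n : ℤ) :
    (quasiIso A).IsInvertedBy (DGModule.shiftFunctor A n ⋙ toDerived A) :=
  fun _ _ _ hf => Localization.inverts (toDerived A) (quasiIso A) _ (quasiIso_shift hf n)

/-- The shift functor `X ↦ X[n]` of the derived category. -/
def derivedShift (A : DGAlgebra k) (n : ℤ) : Derived A ⥤ Derived A :=
  Localization.lift (DGModule.shiftFunctor A n ⋙ toDerived A) (shift_isInvertedBy A n)
    (toDerived A)

/-- The shift of the derived category is computed by the shift of dg modules. -/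
def derivedShiftIso (A : DGAlgebra k) (n : ℤ) :
    toDerived A ⋙ derivedShift A n ≅ DGModule.shiftFunctor A n ⋙ toDerived A :=
  Localization.fac _ (shift_isInvertedBy A n) (toDerived A)

/-- Distinguished triangles `X ⟶ Y ⟶ Z ⟶ X[1]` of the derived category: those that are isomorphic
to the image of the triangle `M ⟶ N ⟶ Cone f ⟶ M[1]` of a morphism `f : M ⟶ N` of dg modules. -/
def IsDistinguished {X Y Z : Derived A} (u : X ⟶ Y) (v : Y ⟶ Z)
    (w : Z ⟶ (derivedShift A 1).obj X) : Prop :=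
  ∃ (M N : DGModule A) (f : M ⟶ N) (a : X ≅ (toDerived A).obj M) (b : Y ≅ (toDerived A).obj N)
    (c : Z ≅ (toDerived A).obj (cone f)),
    u ≫ b.hom = a.hom ≫ (toDerived A).map f ∧
    v ≫ c.hom = b.hom ≫ (toDerived A).map (coneInl f) ∧
    w ≫ (derivedShift A 1).map a.hom ≫ (derivedShiftIso A 1).hom.app M =
      c.hom ≫ (toDerived A).map (coneSnd f)

/-- `P ⋆ R`: the objects `F` that sit in a distinguished triangle `X ⟶ F ⟶ Y ⟶ X[1]` with `X` in
`P` and `Y` in `R`. -/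
def star (P R : ObjectProperty (Derived A)) : ObjectProperty (Derived A) := fun F =>
  ∃ (X Y : Derived A) (u : X ⟶ F) (v : F ⟶ Y) (w : Y ⟶ (derivedShift A 1).obj X),
    IsDistinguished u v w ∧ P X ∧ R Y

/-- The finite direct sum of the shifts `E[n]`, for `n` in the list `l`. -/
def sumOfShifts (E : DGModule A) (l : List ℤ) : DGModule A :=
  l.foldr (fun n S => (E.shift n).prod S) DGModule.zero

/-- `[E]_n`: for `n = 0` the objects of `D(A)` isomorphic to a finite direct sum of shifts of `E`,
and in general the star product of `n + 1` copies of `[E]_0`. -/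
def built (E : DGModule A) : ℕ → ObjectProperty (Derived A)
  | 0 => fun X => ∃ l : List ℤ, Nonempty (X ≅ (toDerived A).obj (sumOfShifts E l))
  | n + 1 => star (built E n) (built E 0)

/-- `⟨E⟩_n`: the direct summands in `D(A)` of the objects of `[E]_n`. -/
def generated (E : DGModule A) (n : ℕ) : ObjectProperty (Derived A) :=
  (built E n).retractClosure

/-- The objects of `Perf(A)`, the thick subcategory `⟨A⟩ = ⋃ n, ⟨A⟩_n` of `D(A)` generated by the
dg module `A`. -/
def IsPerfect (M : DGModule A) : Prop :=
  ∃ n, generated (DGModule.self A) n ((toDerived A).obj M)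

/-- The diagonal dimension of `Perf(A)`: the least `n` such that the diagonal dg module `A` lies in
`⟨F ⊠ G⟩_n` for some `F` in `Perf(A^op)` and `G` in `Perf(A)`, and `⊤` if there is no such `n`. -/
def diagonalDimension (A : DGAlgebra k) : ℕ∞ :=
  sInf ((fun n : ℕ => (n : ℕ∞)) '' {n | ∃ (F : DGModule A.op) (G : DGModule A),
    IsPerfect F ∧ IsPerfect G ∧
      generated (F.tensor G) n ((toDerived (A.op.tensor A)).obj (DGModule.diagonal A))})

end DG

end

/-!
If `diag A` is built in `m` cones from `F₁ ⊠ G₁` and `diag B` in `n` cones from `F₂ ⊠ G₂`, then the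
exterior tensor product `diag A ⊠ diag B` should be built in `m + n` cones from
`(F₁ ⊠ G₁) ⊠ (F₂ ⊠ G₂)`. Since `diag A ⊠ diag B` is `diag (A ⊗ B)`, and
`(F₁ ⊠ G₁) ⊠ (F₂ ⊠ G₂)` is `(F₁ ⊠ F₂) ⊠ (G₁ ⊠ G₂)`, up to the interchange of tensor factors, this
gives the bound (`generated_diagonal_tensor`).

The additivity `generated_tensor` is proved on the level of dg modules, not of triangles: knowing
only that an object is an iterated cone gives `m` cones for each of `n`, and so a bound of the order
of `m * n`. A dg module is called filtered of length `n` (`IsFiltered`) if its underlying graded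
module is a finite direct sum of dg modules quasi-isomorphic to sums of shifts of `E`, each with a
rank in `{0, …, n}`, and if the differential is that of the direct sum up to terms that strictly
lower the rank (`TwistedSum`). Such a dg module is in `[E]_n`, by induction on the largest rank
(`IsFiltered.built`), and conversely every object of `[E]_n` has a filtered model
(`exists_isFiltered_of_built`), because an extension can be realized by a homotopy pushout, whose
underlying graded module is a direct sum. On tensor products the ranks add up
(`TwistedSum.tensor`), so that lengths do as well.

For this, cones and isomorphisms of the derived category have to be lifted to dg modules. Homotopy
pushouts along quasi-isomorphisms allow to compose left fractions, so every morphism of the derived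
category is one (`leftFractions_eq_top`), and isomorphic objects are joined by two
quasi-isomorphisms (`DIso.exists_cospan`). Tensor products preserve quasi-isomorphisms because over
a field a quasi-isomorphism has a homotopy inverse as a map of complexes of vector spaces, which
comes from a contraction of its cone (`exists_contraction`, `quasiIso_tensorRight`,
`quasiIso_tensorLeft`).

The two comparisons of tensor products hold on the nose, with Koszul signs
(`diagonal_tensor_dIso`, `interchange_dIso`); they are linear over the morphisms of dg algebras
`opTensor` and `interchange`, along which the scalars are restricted.
-/

noncomputable section

namespace DG

variable {k : Type u} [Field k]

namespace DGModule

section Derived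

variable {A : DGAlgebra k}

/-! ### Quasi-isomorphisms and the derived category -/

lemma quasiIso_of_bijective {M N : DGModule A} (f : M ⟶ N) (hf : Function.Bijective f.toLin) :
    quasiIso A f := by
  rw [quasiIso_iff]
  refine ⟨fun m n hm hn => ?_, fun n hn => ?_⟩
  · obtain ⟨m', rfl⟩ := hf.2 n
    exact ⟨m', hf.1 (hn.trans (f.map_d m').symm)⟩
  · obtain ⟨m, rfl⟩ := hf.2 n
    refine ⟨m, 0, hf.1 ?_, by simp⟩
    rw [f.map_d, hn, map_zero]

/-- Total cohomology as a functor to vector spaces. -/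
def cohomologyFunctor (A : DGAlgebra k) : DGModule A ⥤ ModuleCat.{u} k where
  obj M := ModuleCat.of k M.Cohomology
  map f := ModuleCat.ofHom (cohomologyMap f)
  map_id M := by
    ext x
    rfl
  map_comp f g := by
    ext x
    rfl

lemma isIso_cohomologyFunctor_map_iff {M N : DGModule A} (f : M ⟶ N) :
    IsIso ((cohomologyFunctor A).map f) ↔ quasiIso A f :=
  ConcreteCategory.isIso_iff_bijective _

/-- A morphism of dg modules that becomes invertible in the derived category is a
quasi-isomorphism, since cohomology factors through the derived category. -/
lemma quasiIso_of_isIso {M N : DGModule A} (f : M ⟶ N) [IsIso ((toDerived A).map f)] :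
    quasiIso A f := by
  have hH : (quasiIso A).IsInvertedBy (cohomologyFunctor A) := fun _ _ f hf =>
    (isIso_cohomologyFunctor_map_iff f).2 hf
  rw [← isIso_cohomologyFunctor_map_iff]
  exact (NatIso.isIso_map_iff (Localization.fac _ hH (toDerived A)) f).1
    (inferInstanceAs (IsIso ((Localization.lift _ hH (toDerived A)).map ((toDerived A).map f))))

lemma quasiIso_comp {M N P : DGModule A} {f : M ⟶ N} {g : N ⟶ P} (hf : quasiIso A f)
    (hg : quasiIso A g) : quasiIso A (f ≫ g) := by
  rw [← isIso_cohomologyFunctor_map_iff] at *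
  rw [Functor.map_comp]
  infer_instance

lemma isIso_of_quasiIso {M N : DGModule A} {f : M ⟶ N} (hf : quasiIso A f) :
    IsIso ((toDerived A).map f) :=
  Localization.inverts (toDerived A) (quasiIso A) f hf

/-- Two dg modules are quasi-isomorphic if they are isomorphic in the derived category. -/
def DIso (M N : DGModule A) : Prop := Nonempty ((toDerived A).obj M ≅ (toDerived A).obj N)

lemma DIso.refl (M : DGModule A) : DIso M M := ⟨Iso.refl _⟩

lemma DIso.symm {M N : DGModule A} (h : DIso M N) : DIso N M := h.map Iso.symm

lemma DIso.trans {M N P : DGModule A} (h : DIso M N) (h' : DIso N P) : DIso M P :=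
  h.elim fun e => h'.map fun e' => e ≪≫ e'

lemma DIso.of_quasiIso {M N : DGModule A} {f : M ⟶ N} (hf : quasiIso A f) : DIso M N :=
  have := isIso_of_quasiIso hf
  ⟨asIso ((toDerived A).map f)⟩

lemma DIso.of_bijective {M N : DGModule A} (f : M ⟶ N) (hf : Function.Bijective f.toLin) :
    DIso M N :=
  .of_quasiIso (quasiIso_of_bijective f hf)

section Functor

variable {B : DGAlgebra k} (Φ : DGModule A ⥤ DGModule B)

lemma isInvertedBy_of_preserves
    (hΦ : ∀ {M N : DGModule A} (f : M ⟶ N), quasiIso A f → quasiIso B (Φ.map f)) :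
    (quasiIso A).IsInvertedBy (Φ ⋙ toDerived B) :=
  fun _ _ f hf => isIso_of_quasiIso (hΦ f hf)

lemma DIso.map
    (hΦ : ∀ {M N : DGModule A} (f : M ⟶ N), quasiIso A f → quasiIso B (Φ.map f))
    {M N : DGModule A} (h : DIso M N) : DIso (Φ.obj M) (Φ.obj N) :=
  let i := Localization.fac _ (isInvertedBy_of_preserves Φ hΦ) (toDerived A)
  h.elim fun e => ⟨(i.app M).symm ≪≫ (Localization.lift _ (isInvertedBy_of_preserves Φ hΦ)
    (toDerived A)).mapIso e ≪≫ i.app N⟩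

lemma retract_map
    (hΦ : ∀ {M N : DGModule A} (f : M ⟶ N), quasiIso A f → quasiIso B (Φ.map f))
    {M N : DGModule A}
    (h : Nonempty (Retract ((toDerived A).obj M) ((toDerived A).obj N))) :
    Nonempty (Retract ((toDerived B).obj (Φ.obj M)) ((toDerived B).obj (Φ.obj N))) :=
  let i := Localization.fac _ (isInvertedBy_of_preserves Φ hΦ) (toDerived A)
  h.map fun e => (Retract.ofIso (i.app M).symm).trans ((e.map (Localization.lift _
    (isInvertedBy_of_preserves Φ hΦ) (toDerived A))).trans (Retract.ofIso (i.app N)))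

end Functor

lemma DIso.shift {M N : DGModule A} (h : DIso M N) (n : ℤ) : DIso (M.shift n) (N.shift n) :=
  h.map (DGModule.shiftFunctor A n) fun _ hf => quasiIso_shift hf n

/-! ### Direct sums -/

/-- The first projection of a direct sum. -/
def fst (M N : DGModule A) : M.prod N ⟶ M where
  toLin := LinearMap.fst k M N
  map_mem _ _ h := h.1
  map_act _ _ := rfl
  map_d _ := rfl

/-- The second projection of a direct sum. -/
def snd (M N : DGModule A) : M.prod N ⟶ N where
  toLin := LinearMap.snd k M N
  map_mem _ _ h := h.2
  map_act _ _ := rfl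
  map_d _ := rfl

/-- The morphism to a direct sum with the given components. -/
def prodLift {L M N : DGModule A} (f : L ⟶ M) (g : L ⟶ N) : L ⟶ M.prod N where
  toLin := LinearMap.prod f.toLin g.toLin
  map_mem i m h := ⟨f.map_mem i m h, g.map_mem i m h⟩
  map_act m a := Prod.ext (f.map_act m a) (g.map_act m a)
  map_d m := Prod.ext (f.map_d m) (g.map_d m)

/-- The functor `M ↦ M ⊕ S`. -/
def prodRight (S : DGModule A) : DGModule A ⥤ DGModule A where
  obj M := M.prod S
  map f := prodLift (fst _ _ ≫ f) (snd _ _)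

/-- The functor `M ↦ S ⊕ M`. -/
def prodLeft (S : DGModule A) : DGModule A ⥤ DGModule A where
  obj M := S.prod M
  map f := prodLift (fst _ _) (snd _ _ ≫ f)

lemma quasiIso_prodRight (S : DGModule A) {M N : DGModule A} (f : M ⟶ N) (hf : quasiIso A f) :
    quasiIso A ((prodRight S).map f) := by
  rw [quasiIso_iff] at hf ⊢
  refine ⟨?_, ?_⟩
  · rintro ⟨m, s⟩ ⟨n, t⟩ hm hn
    obtain ⟨m', hm'⟩ := hf.1 m n (congrArg Prod.fst hm) (congrArg Prod.fst hn)
    exact ⟨(m', t), Prod.ext hm' (congrArg (Prod.snd : N × S → S) hn)⟩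
  · rintro ⟨n, t⟩ hn
    obtain ⟨m, n', hm, hn'⟩ := hf.2 n (congrArg Prod.fst hn)
    exact ⟨(m, t), (n', 0), Prod.ext hm (congrArg (Prod.snd : N × S → S) hn),
      Prod.ext hn' (by change t = t + S.d 0; simp)⟩

lemma quasiIso_prodLeft (S : DGModule A) {M N : DGModule A} (f : M ⟶ N) (hf : quasiIso A f) :
    quasiIso A ((prodLeft S).map f) := by
  rw [quasiIso_iff] at hf ⊢
  refine ⟨?_, ?_⟩
  · rintro ⟨s, m⟩ ⟨t, n⟩ hm hn
    obtain ⟨m', hm'⟩ := hf.1 m n (congrArg Prod.snd hm) (congrArg Prod.snd hn)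
    exact ⟨(t, m'), Prod.ext (congrArg (Prod.fst : S × N → S) hn) hm'⟩
  · rintro ⟨t, n⟩ hn
    obtain ⟨m, n', hm, hn'⟩ := hf.2 n (congrArg Prod.snd hn)
    exact ⟨(t, m), (0, n'), Prod.ext (congrArg (Prod.fst : S × N → S) hn) hm,
      Prod.ext (by change t = t + S.d 0; simp) hn'⟩

lemma DIso.prod {M M' N N' : DGModule A} (h : DIso M M') (h' : DIso N N') :
    DIso (M.prod N) (M'.prod N') :=
  (h.map (prodRight N) (quasiIso_prodRight N)).trans (h'.map (prodLeft M') (quasiIso_prodLeft M'))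

lemma sumOfShifts_append (E : DGModule A) (l l' : List ℤ) :
    DIso ((sumOfShifts E l).prod (sumOfShifts E l')) (sumOfShifts E (l ++ l')) := by
  induction l with
  | nil =>
    refine .of_bijective (snd _ _) ⟨?_, fun y => ⟨(PUnit.unit, y), rfl⟩⟩
    rintro ⟨x, y⟩ ⟨x', y'⟩ h
    exact Prod.ext rfl h
  | cons n l ih =>
    refine DIso.trans (.of_bijective
      (prodLift (fst _ _ ≫ fst _ _) (prodLift (fst _ _ ≫ snd _ _) (snd _ _))) ⟨?_, ?_⟩)
      ((DIso.refl (E.shift n)).prod ih)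
    · rintro ⟨⟨x, y⟩, z⟩ ⟨⟨x', y'⟩, z'⟩ h
      obtain ⟨h₁, h₂⟩ := Prod.mk.inj h
      obtain ⟨h₂, h₃⟩ := Prod.mk.inj h₂
      exact Prod.ext (Prod.ext h₁ h₂) h₃
    · rintro ⟨x, y, z⟩
      exact ⟨((x, y), z), rfl⟩

/-! ### Objects that are sums of shifts, or built from them -/

lemma built_zero_iff {E : DGModule A} {X : Derived A} :
    built E 0 X ↔ ∃ l, Nonempty (X ≅ (toDerived A).obj (sumOfShifts E l)) := by
  rw [built]

lemma built_succ_iff {E : DGModule A} {n : ℕ} {X : Derived A} :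
    built E (n + 1) X ↔ star (built E n) (built E 0) X :=
  iff_of_eq (congrFun (built.eq_2 E n) X)

lemma built_of_iso {E : DGModule A} {n : ℕ} {X Y : Derived A} (e : X ≅ Y) (h : built E n Y) :
    built E n X := by
  cases n with
  | zero =>
    obtain ⟨l, ⟨e'⟩⟩ := built_zero_iff.1 h
    exact built_zero_iff.2 ⟨l, ⟨e ≪≫ e'⟩⟩
  | succ n =>
    obtain ⟨X', Y', u, v, w, ⟨M, N, f, a, b, c, h₁, h₂, h₃⟩, hX, hY⟩ := built_succ_iff.1 h
    refine built_succ_iff.2 ⟨X', Y', u ≫ e.inv, e.hom ≫ v, w,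
      ⟨M, N, f, a, e ≪≫ b, c, ?_, ?_, h₃⟩, hX, hY⟩
    · simpa using h₁
    · simp [h₂]

/-- `IsSum E M` means that `M` is quasi-isomorphic to a finite direct sum of shifts of `E`. -/
def IsSum (E M : DGModule A) : Prop := built E 0 ((toDerived A).obj M)

lemma isSum_iff {E M : DGModule A} : IsSum E M ↔ ∃ l, DIso M (sumOfShifts E l) :=
  built_zero_iff

lemma IsSum.of_dIso {E M N : DGModule A} (hN : IsSum E N) (h : DIso M N) : IsSum E M :=
  h.elim fun e => built_of_iso e hN

lemma isSum_zero (E : DGModule A) : IsSum E zero :=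
  isSum_iff.2 ⟨[], .refl _⟩

lemma isSum_shift (E : DGModule A) (n : ℤ) : IsSum E (E.shift n) := by
  refine isSum_iff.2 ⟨[n], .symm (.of_bijective (fst _ _) ⟨?_, fun y => ⟨(y, PUnit.unit), rfl⟩⟩)⟩
  rintro ⟨x, y⟩ ⟨x', y'⟩ h
  exact Prod.ext h rfl

lemma IsSum.prod {E M N : DGModule A} (hM : IsSum E M) (hN : IsSum E N) : IsSum E (M.prod N) := by
  obtain ⟨l, hl⟩ := isSum_iff.1 hM
  obtain ⟨l', hl'⟩ := isSum_iff.1 hN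
  exact isSum_iff.2 ⟨l ++ l', (hl.prod hl').trans (sumOfShifts_append E l l')⟩

lemma IsSum.mono {E E' M : DGModule A} (hM : IsSum E M) (h : DIso E E') : IsSum E' M := by
  obtain ⟨l, hl⟩ := isSum_iff.1 hM
  refine IsSum.of_dIso ?_ hl
  clear hl
  induction l with
  | nil => exact isSum_zero E'
  | cons n l ih => exact ((isSum_shift E' n).of_dIso (h.shift n)).prod ih

lemma built_mono {E E' : DGModule A} (h : DIso E E') (n : ℕ) {X : Derived A} (hX : built E n X) :
    built E' n X := by
  have h0 : ∀ X, built E 0 X → built E' 0 X := by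
    intro X hX
    obtain ⟨l, ⟨e⟩⟩ := built_zero_iff.1 hX
    have hs : IsSum E (sumOfShifts E l) := isSum_iff.2 ⟨l, .refl _⟩
    exact built_of_iso e (hs.mono h)
  induction n generalizing X with
  | zero => exact h0 X hX
  | succ n ih =>
    obtain ⟨X', Y', u, v, w, hd, hX', hY'⟩ := built_succ_iff.1 hX
    exact built_succ_iff.2 ⟨X', Y', u, v, w, hd, ih hX', h0 _ hY'⟩

lemma generated_mono {E E' : DGModule A} (h : DIso E E') {n : ℕ} {X : Derived A}
    (hX : generated E n X) : generated E' n X := by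
  obtain ⟨Y, hY, r⟩ := hX
  exact ⟨Y, built_mono h n hY, r⟩

lemma generated_of_iso {E : DGModule A} {n : ℕ} {X Y : Derived A} (e : X ≅ Y)
    (hY : generated E n Y) : generated E n X := by
  obtain ⟨Z, hZ, ⟨r⟩⟩ := hY
  exact ⟨Z, hZ, ⟨(Retract.ofIso e).trans r⟩⟩

/-! ### Cones of quasi-isomorphic morphisms -/

/-- The cone of the first map of a short exact sequence is quasi-isomorphic to the third term. -/
lemma cone_dIso_of_exact {M N P : DGModule A} (f : M ⟶ N) (g : N ⟶ P)
    (hf : Function.Injective f.toLin) (hg : Function.Surjective g.toLin)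
    (h : ∀ y, g.toLin y = 0 ↔ ∃ x, f.toLin x = y) : DIso (cone f) P := by
  have h0 : ∀ x, g.toLin (f.toLin x) = 0 := fun x => (h _).2 ⟨x, rfl⟩
  let p : cone f ⟶ P :=
    { toLin := g.toLin ∘ₗ LinearMap.fst k N M
      map_mem := fun i m hm => g.map_mem i _ hm.1
      map_act := fun m a => g.map_act m.1 a
      map_d := fun m => by
        change g.toLin (N.d m.1 + f.toLin m.2) = P.d (g.toLin m.1)
        rw [map_add, h0, add_zero, g.map_d] }
  refine .of_quasiIso (f := p) ((quasiIso_iff p).2 ⟨?_, ?_⟩)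
  · rintro ⟨y, x⟩ n hm hn
    obtain ⟨h₁, h₂⟩ := Prod.mk.inj hm
    obtain ⟨y', rfl⟩ := hg n
    have : g.toLin (y - N.d y') = 0 := by
      rw [map_sub, g.map_d]
      exact sub_eq_zero.2 hn
    obtain ⟨x', hx'⟩ := (h _).1 this
    refine ⟨(y', x'), Prod.ext ?_ (hf ?_)⟩
    · change y = N.d y' + f.toLin x'
      rw [hx']; abel
    · change f.toLin x = f.toLin (-M.d x')
      rw [map_neg, f.map_d, hx', map_sub, N.d_d, sub_zero, eq_neg_iff_add_eq_zero, add_comm]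
      exact h₁
  · intro n hn
    obtain ⟨y, rfl⟩ := hg n
    rw [← g.map_d] at hn
    obtain ⟨x, hx⟩ := (h _).1 hn
    refine ⟨(y, -x), 0, Prod.ext ?_ (hf ?_), ?_⟩
    · change N.d y + f.toLin (-x) = 0
      rw [map_neg, hx, add_neg_cancel]
    · change f.toLin (-M.d (-x)) = f.toLin 0
      rw [map_neg M.d, neg_neg, f.map_d, hx, N.d_d, map_zero]
    · rw [map_zero, add_zero]; rfl

/-- Precomposition with a quasi-isomorphism does not change the cone. -/
lemma cone_comp_dIso {L M N : DGModule A} (t : L ⟶ M) (f : M ⟶ N) (ht : quasiIso A t) :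
    DIso (cone (t ≫ f)) (cone f) := by
  let p : cone (t ≫ f) ⟶ cone f :=
    { toLin := LinearMap.prodMap LinearMap.id t.toLin
      map_mem := fun i m hm => ⟨hm.1, t.map_mem _ _ hm.2⟩
      map_act := fun m a => Prod.ext rfl (t.map_act m.2 a)
      map_d := fun m => Prod.ext rfl ((map_neg t.toLin _).trans (congrArg _ (t.map_d m.2))) }
  have ht := (quasiIso_iff t).1 ht
  refine .of_quasiIso (f := p) ((quasiIso_iff p).2 ⟨?_, ?_⟩)
  · rintro ⟨y, x⟩ ⟨n, l⟩ hm hn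
    obtain ⟨h₁, h₂⟩ := Prod.mk.inj hm
    obtain ⟨h₃, h₄⟩ := Prod.mk.inj hn
    change y = N.d n + f.toLin l at h₃
    change t.toLin x = -M.d l at h₄
    obtain ⟨x', hx'⟩ := ht.1 x (-l) (neg_eq_zero.1 h₂) (by rw [map_neg, h₄])
    obtain ⟨x'', l'', hx'', hl''⟩ := ht.2 (t.toLin x' + l) (by
      rw [map_add, ← t.map_d, ← hx', h₄, neg_add_cancel])
    refine ⟨(n + f.toLin l'', x'' - x'), Prod.ext ?_ ?_⟩
    · change y = N.d (n + f.toLin l'') + f.toLin (t.toLin (x'' - x'))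
      have : l = t.toLin (x'' - x') + M.d l'' := by
        rw [map_sub, sub_add_eq_add_sub, ← hl'']; abel
      rw [h₃, map_add, ← f.map_d, this, map_add]
      abel
    · change x = -L.d (x'' - x')
      rw [map_sub, hx'', ← hx', zero_sub, neg_neg]
  · rintro ⟨y, l⟩ hn
    obtain ⟨h₁, h₂⟩ := Prod.mk.inj hn
    change N.d y + f.toLin l = 0 at h₁
    obtain ⟨x, l', hx, rfl⟩ := ht.2 l (neg_eq_zero.1 h₂)
    refine ⟨(y + f.toLin l', x), (0, -l'), Prod.ext ?_ ?_, Prod.ext ?_ ?_⟩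
    · change N.d (y + f.toLin l') + f.toLin (t.toLin x) = 0
      rw [← h₁, map_add, map_add, f.map_d]
      abel
    · change -L.d x = 0
      rw [hx, neg_zero]
    · change y = y + f.toLin l' + (N.d 0 + f.toLin (-l'))
      rw [map_zero, map_neg]; abel
    · change t.toLin x + M.d l' = t.toLin x + -M.d (-l')
      rw [map_neg, neg_neg]

/-! ### Homotopy pushouts -/

section HomotopyPushout

variable {L M N T : DGModule A} (f : L ⟶ N) (t : L ⟶ M)

/-- The homotopy pushout `N ⊕ M ⊕ L[1]` of `N ⟵ L ⟶ M`, as the cone of `L ⟶ N ⊕ M`. -/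
abbrev hPushout : DGModule A := cone (prodLift f t)

/-- The inclusion of `N` in the homotopy pushout. -/
def hInl : N ⟶ hPushout f t where
  toLin := LinearMap.inl k (N × M) L ∘ₗ LinearMap.inl k N M
  map_mem _ _ h := ⟨⟨h, zero_mem _⟩, zero_mem _⟩
  map_act y a := by
    change ((N.act y a, (0 : M)), (0 : L)) = ((N.act y a, M.act 0 a), L.act 0 a)
    simp
  map_d y := by
    change ((N.d y, (0 : M)), (0 : L)) = ((N.d y + f.toLin 0, M.d 0 + t.toLin 0), -L.d 0)
    simp

/-- The map `x ↦ -x` from `M` to the homotopy pushout; the sign makes the square with corner `L`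
commute up to homotopy. -/
def hInr : M ⟶ hPushout f t where
  toLin := LinearMap.inl k (N × M) L ∘ₗ LinearMap.inr k N M ∘ₗ (-LinearMap.id)
  map_mem _ _ h := ⟨⟨zero_mem _, neg_mem h⟩, zero_mem _⟩
  map_act x a := by
    change (((0 : N), -M.act x a), (0 : L)) = ((N.act 0 a, M.act (-x) a), L.act 0 a)
    simp
  map_d x := by
    change (((0 : N), -M.d x), (0 : L)) = ((N.d 0 + f.toLin 0, M.d (-x) + t.toLin 0), -L.d 0)
    simp

lemma hInr_apply (x : M) : (hInr f t).toLin x = ((0, -x), 0) := rfl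

/-- The morphism out of a homotopy pushout given by two morphisms and a homotopy. -/
def hDesc (p : N ⟶ T) (q : M ⟶ T) (h : L →ₗ[k] T)
    (h_mem : ∀ i, ∀ x ∈ L.grading (i + 1), h x ∈ T.grading i)
    (h_act : ∀ x a, h (L.act x a) = T.act (h x) a)
    (hh : ∀ x, T.d (h x) + h (L.d x) = p.toLin (f.toLin x) - q.toLin (t.toLin x)) :
    hPushout f t ⟶ T where
  toLin := LinearMap.coprod (LinearMap.coprod p.toLin (-q.toLin)) h
  map_mem i x hx := add_mem (add_mem (p.map_mem _ _ hx.1.1) (neg_mem (q.map_mem _ _ hx.1.2)))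
    (h_mem _ _ hx.2)
  map_act x a := by
    change p.toLin (N.act x.1.1 a) + -q.toLin (M.act x.1.2 a) + h (L.act x.2 a) =
      T.act (p.toLin x.1.1 + -q.toLin x.1.2 + h x.2) a
    simp [p.map_act, q.map_act, h_act]
  map_d x := by
    change p.toLin (N.d x.1.1 + f.toLin x.2) + -q.toLin (M.d x.1.2 + t.toLin x.2) + h (-L.d x.2) =
      T.d (p.toLin x.1.1 + -q.toLin x.1.2 + h x.2)
    have := hh x.2
    rw [← eq_sub_iff_add_eq] at this
    simp only [map_add, map_neg, p.map_d, q.map_d, this]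
    abel

lemma quasiIso_hInl (ht : quasiIso A t) : quasiIso A (hInl f t) := by
  have ht := (quasiIso_iff t).1 ht
  refine (quasiIso_iff _).2 ⟨?_, ?_⟩
  · rintro n ⟨⟨y, x⟩, l⟩ hn h
    obtain ⟨h₁, h₂⟩ := Prod.mk.inj h
    obtain ⟨h₁, h₃⟩ := Prod.mk.inj h₁
    change n = N.d y + f.toLin l at h₁
    change 0 = -L.d l at h₂
    change 0 = M.d x + t.toLin l at h₃
    obtain ⟨l', rfl⟩ := ht.1 l (-x) (neg_eq_zero.1 h₂.symm) (by
      rw [map_neg, eq_neg_iff_add_eq_zero, add_comm]; exact h₃.symm)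
    exact ⟨y + f.toLin l', by rw [h₁, map_add, f.map_d]⟩
  · rintro ⟨⟨y, x⟩, l⟩ h
    obtain ⟨h₁, h₂⟩ := Prod.mk.inj h
    obtain ⟨h₁, h₃⟩ := Prod.mk.inj h₁
    change N.d y + f.toLin l = 0 at h₁
    change -L.d l = 0 at h₂
    change M.d x + t.toLin l = 0 at h₃
    obtain ⟨l', rfl⟩ := ht.1 l (-x) (neg_eq_zero.1 h₂) (by
      rw [map_neg, eq_neg_iff_add_eq_zero, add_comm]; exact h₃)
    obtain ⟨l'', x'', hl'', hx''⟩ := ht.2 (x + t.toLin l') (by rw [map_add, ← t.map_d, h₃])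
    refine ⟨y - f.toLin (l'' - l'), ((0, x''), l'' - l'), ?_, ?_⟩
    · rw [map_sub, ← f.map_d, map_sub L.d, hl'', zero_sub, map_neg, sub_neg_eq_add]
      exact h₁
    · change ((y, x), L.d l') = ((y - f.toLin (l'' - l') + (N.d 0 + f.toLin (l'' - l')),
        0 + (M.d x'' + t.toLin (l'' - l'))), 0 + -L.d (l'' - l'))
      refine Prod.ext (Prod.ext ?_ ?_) ?_
      · simp
      · change x = 0 + (M.d x'' + t.toLin (l'' - l'))
        rw [zero_add, map_sub, add_sub, add_comm (M.d x''), ← hx'']; abel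
      · simp [hl'']

/-- A homotopy pushout is an extension: `M ⟶ hPushout f t` has the same cone as `f`. -/
lemma cone_hInr_dIso : DIso (cone (hInr f t)) (cone f) := by
  let p : hPushout f t ⟶ cone f :=
    { toLin := LinearMap.prodMap (LinearMap.fst k N M) LinearMap.id
      map_mem := fun i m hm => ⟨hm.1.1, hm.2⟩
      map_act := fun m a => rfl
      map_d := fun m => rfl }
  refine cone_dIso_of_exact (hInr f t) p (fun x x' h => ?_) (fun ⟨y, l⟩ => ⟨((y, 0), l), rfl⟩) ?_
  · rw [hInr_apply, hInr_apply] at h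
    exact neg_injective (Prod.mk.inj (Prod.mk.inj h).1).2
  · rintro ⟨⟨y, x⟩, l⟩
    constructor
    · intro h
      obtain ⟨h₁, h₂⟩ := Prod.mk.inj h
      change y = 0 at h₁
      change l = 0 at h₂
      subst h₁ h₂
      exact ⟨-x, by rw [hInr_apply, neg_neg]; rfl⟩
    · rintro ⟨x', h⟩
      rw [hInr_apply] at h
      rw [← h]
      rfl

end HomotopyPushout

/-! ### Homotopies and fractions -/

/-- Homotopic morphisms agree in the derived category; the cylinder is the homotopy pushout of two
identities. -/
lemma toDerived_map_eq_of_homotopy {L T : DGModule A} (p q : L ⟶ T) (h : L →ₗ[k] T)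
    (h_mem : ∀ i, ∀ x ∈ L.grading (i + 1), h x ∈ T.grading i)
    (h_act : ∀ x a, h (L.act x a) = T.act (h x) a)
    (hh : ∀ x, T.d (h x) + h (L.d x) = p.toLin x - q.toLin x) :
    (toDerived A).map p = (toDerived A).map q := by
  let i₀ := hInl (𝟙 L) (𝟙 L)
  let i₁ := hInr (𝟙 L) (𝟙 L)
  let c : hPushout (𝟙 L) (𝟙 L) ⟶ L := hDesc _ _ (𝟙 L) (𝟙 L) 0 (fun _ _ _ => zero_mem _)
    (by simp) (by simp)
  let H : hPushout (𝟙 L) (𝟙 L) ⟶ T := hDesc _ _ p q h h_mem h_act (by simpa using hh)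
  have h₀ : i₀ ≫ c = 𝟙 L := by
    ext x
    change x + -(0 : L) + 0 = x
    simp
  have h₁ : i₁ ≫ c = 𝟙 L := by
    ext x
    change (0 : L) + -(-x) + 0 = x
    simp
  have h₂ : i₀ ≫ H = p := by
    ext x
    change p.toLin x + -q.toLin 0 + h 0 = p.toLin x
    simp
  have h₃ : i₁ ≫ H = q := by
    ext x
    change p.toLin 0 + -q.toLin (-x) + h 0 = q.toLin x
    simp
  have hi : IsIso ((toDerived A).map i₀) :=
    isIso_of_quasiIso (quasiIso_hInl _ _ (quasiIso_of_bijective _ Function.bijective_id))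
  have hc : IsIso ((toDerived A).map c) := by
    have : IsIso ((toDerived A).map i₀ ≫ (toDerived A).map c) := by
      rw [← Functor.map_comp, h₀]; infer_instance
    exact IsIso.of_isIso_comp_left ((toDerived A).map i₀) _
  have : (toDerived A).map i₀ = (toDerived A).map i₁ := by
    rw [← cancel_mono ((toDerived A).map c), ← Functor.map_comp, ← Functor.map_comp, h₀, h₁]
  rw [← h₂, ← h₃, Functor.map_comp, Functor.map_comp, this]

lemma hPushout_comm {L M N : DGModule A} (f : L ⟶ N) (t : L ⟶ M) :
    (toDerived A).map f ≫ (toDerived A).map (hInl f t) =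
      (toDerived A).map t ≫ (toDerived A).map (hInr f t) := by
  rw [← Functor.map_comp, ← Functor.map_comp]
  refine toDerived_map_eq_of_homotopy _ _ (LinearMap.inr k (N × M) L)
    (fun i x hx => ⟨zero_mem ((N.prod M).grading i), hx⟩) (fun x a => ?_) (fun x => ?_)
  · refine Prod.ext (Prod.ext ?_ ?_) rfl
    · change 0 = N.act 0 a
      simp
    · change 0 = M.act 0 a
      simp
  · rw [comp_toLin, comp_toLin, LinearMap.comp_apply, LinearMap.comp_apply, hInr_apply]
    refine Prod.ext (Prod.ext ?_ ?_) ?_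
    · change N.d 0 + f.toLin x + 0 = f.toLin x - 0
      simp
    · change M.d 0 + t.toLin x + 0 = 0 - -t.toLin x
      simp
    · change -L.d x + L.d x = 0 - 0
      simp

/-- The morphisms of the derived category that are left fractions. -/
def leftFractions (A : DGAlgebra k) : MorphismProperty (Derived A) := fun X Y φ =>
  ∃ (M N Z : DGModule A) (a : X = (toDerived A).obj M) (b : Y = (toDerived A).obj N) (f : M ⟶ Z)
    (s : N ⟶ Z), quasiIso A s ∧
      φ ≫ eqToHom b ≫ (toDerived A).map s = eqToHom a ≫ (toDerived A).map f

lemma leftFractions_iff {M N : DGModule A}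
    (φ : (toDerived A).obj M ⟶ (toDerived A).obj N) : leftFractions A φ ↔
      ∃ (Z : DGModule A) (f : M ⟶ Z) (s : N ⟶ Z), quasiIso A s ∧
        φ ≫ (toDerived A).map s = (toDerived A).map f := by
  constructor
  · rintro ⟨M', N', Z, a, b, f, s, hs, h⟩
    obtain rfl : M = M' := (Localization.Construction.objEquiv (quasiIso A)).injective a
    obtain rfl : N = N' := (Localization.Construction.objEquiv (quasiIso A)).injective b
    exact ⟨Z, f, s, hs, by simpa using h⟩
  · rintro ⟨Z, f, s, hs, h⟩
    exact ⟨M, N, Z, rfl, rfl, f, s, hs, by simpa using h⟩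

lemma exists_eq_toDerived_obj (X : Derived A) : ∃ M, (toDerived A).obj M = X :=
  (Localization.Construction.objEquiv (quasiIso A)).surjective X

/-- Every morphism of the derived category is a left fraction. Fractions are composed along
homotopy pushouts. -/
lemma leftFractions_eq_top (A : DGAlgebra k) : leftFractions A = ⊤ := by
  have : (leftFractions A).IsStableUnderComposition := ⟨fun {X Y Z} φ ψ hφ hψ => by
    obtain ⟨M, rfl⟩ := exists_eq_toDerived_obj X
    obtain ⟨N, rfl⟩ := exists_eq_toDerived_obj Y
    obtain ⟨P, rfl⟩ := exists_eq_toDerived_obj Z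
    obtain ⟨U, f, s, hs, h⟩ := (leftFractions_iff φ).1 hφ
    obtain ⟨V, g, t, ht, h'⟩ := (leftFractions_iff ψ).1 hψ
    refine (leftFractions_iff _).2 ⟨hPushout g s, f ≫ hInr g s, t ≫ hInl g s,
      quasiIso_comp ht (quasiIso_hInl g s hs), ?_⟩
    rw [Functor.map_comp, Functor.map_comp, Category.assoc, reassoc_of% h', hPushout_comm,
      reassoc_of% h]⟩
  refine Localization.Construction.morphismProperty_eq_top _ (fun X Y f => ?_)
    (fun X Y w hw => ?_)
  · exact (leftFractions_iff _).2 ⟨Y, f, 𝟙 Y, quasiIso_of_bijective _ Function.bijective_id,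
      by simp⟩
  · exact (leftFractions_iff _).2 ⟨Y, 𝟙 Y, w, hw,
      ((Localization.Construction.wIso w hw).inv_hom_id).trans (by simp)⟩

/-- Quasi-isomorphic dg modules are linked by two quasi-isomorphisms to a third one. -/
lemma DIso.exists_cospan {M N : DGModule A} (h : DIso M N) :
    ∃ (Z : DGModule A) (f : M ⟶ Z) (s : N ⟶ Z), quasiIso A f ∧ quasiIso A s := by
  obtain ⟨e⟩ := h
  obtain ⟨Z, f, s, hs, h⟩ := (leftFractions_iff e.hom).1 (by
    rw [leftFractions_eq_top]; exact MorphismProperty.top_apply _)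
  have := isIso_of_quasiIso hs
  have : IsIso ((toDerived A).map f) := by rw [← h]; infer_instance
  exact ⟨Z, f, s, quasiIso_of_isIso f, hs⟩

/-! ### Twisted direct sums -/

/-- A morphism of the underlying graded modules: it respects degrees and the action, but need not
commute with the differentials. -/
structure IsGradedLinear {M N : DGModule A} (f : M →ₗ[k] N) : Prop where
  map_mem : ∀ i, ∀ m ∈ M.grading i, f m ∈ N.grading i
  map_act : ∀ m a, f (M.act m a) = N.act (f m) a

/-- A twisted direct sum structure: as a graded module, `M` is the direct sum of the `P i`, and its
differential is that of the `P i` plus terms that strictly lower the rank `r`. -/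
structure TwistedSum {I : Type} [Fintype I] (r : I → ℕ) (P : I → DGModule A)
    (M : DGModule A) where
  ι : ∀ i, P i →ₗ[k] M
  π : ∀ i, M →ₗ[k] P i
  ι_graded : ∀ i, IsGradedLinear (ι i)
  π_graded : ∀ i, IsGradedLinear (π i)
  π_ι_self : ∀ i x, π i (ι i x) = x
  π_ι_of_ne : ∀ i j x, i ≠ j → π i (ι j x) = 0
  sum_ι_π : ∀ x, ∑ i, ι i (π i x) = x
  π_d_ι_self : ∀ i x, π i (M.d (ι i x)) = (P i).d x
  π_d_ι : ∀ i j x, i ≠ j → ¬ r i < r j → π i (M.d (ι j x)) = 0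

/-- The dg submodule cut out by a graded idempotent whose image is stable under `d`. -/
def ofIdem (M : DGModule A) (e : M →ₗ[k] M) (he : IsGradedLinear e) (hee : ∀ x, e (e x) = e x)
    (hd : ∀ x, e (M.d (e x)) = M.d (e x)) : DGModule A where
  carrier := LinearMap.range e
  grading i := (M.grading i).comap (LinearMap.range e).subtype
  decomposition := decompositionMk _
    (gradedLift M.grading (fun i =>
      lof k ℤ (fun i => (M.grading i).comap (LinearMap.range e).subtype) i ∘ₗ
        LinearMap.codRestrict _ (e.rangeRestrict ∘ₗ (M.grading i).subtype)
          (fun x => he.map_mem i x x.2)) ∘ₗ (LinearMap.range e).subtype)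
    (by
      have h : ∀ x : M, DirectSum.coeLinearMap
          (fun i => (M.grading i).comap (LinearMap.range e).subtype) (gradedLift M.grading (fun i =>
            lof k ℤ (fun i => (M.grading i).comap (LinearMap.range e).subtype) i ∘ₗ
              LinearMap.codRestrict _ (e.rangeRestrict ∘ₗ (M.grading i).subtype)
                (fun x => he.map_mem i x x.2)) x) = e.rangeRestrict x := fun x => by
        induction x using graded_induction M.grading with
        | add x y hx hy => rw [map_add, map_add, hx, hy, map_add]
        | hom i x hx => rw [gradedLift_of_mem M.grading _ hx]; simp; rfl
      rintro ⟨_, y, rfl⟩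
      exact (h (e y)).trans (Subtype.ext (hee y)))
    (by
      rintro i ⟨⟨_, y, rfl⟩, hx⟩
      refine (gradedLift_of_mem M.grading _ hx).trans ?_
      rw [LinearMap.comp_apply]
      exact congrArg _ (Subtype.ext (Subtype.ext (hee y))))
  act := LinearMap.mk₂ k (fun x a => ⟨M.act x a, by
      obtain ⟨_, y, rfl⟩ := x
      exact ⟨M.act y a, he.map_act y a⟩⟩)
    (by intros; ext; simp) (by intros; ext; simp) (by intros; ext; simp) (by intros; ext; simp)
  act_one x := Subtype.ext (M.act_one x)
  act_mul x a b := Subtype.ext (M.act_mul x a b)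
  act_mem i j x hx a ha := M.act_mem i j _ hx a ha
  d := LinearMap.codRestrict _ (M.d ∘ₗ (LinearMap.range e).subtype) (by
    rintro ⟨_, y, rfl⟩
    exact ⟨_, hd y⟩)
  d_mem i x hx := M.d_mem i _ hx
  d_d x := Subtype.ext (M.d_d x)
  d_act i x hx a := Subtype.ext (M.d_act i _ hx a)

/-- The inclusion of the submodule cut out by an idempotent. -/
def ofIdemIncl (M : DGModule A) (e : M →ₗ[k] M) (he : IsGradedLinear e)
    (hee : ∀ x, e (e x) = e x) (hd : ∀ x, e (M.d (e x)) = M.d (e x)) :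
    M.ofIdem e he hee hd ⟶ M where
  toLin := (LinearMap.range e).subtype
  map_mem _ _ h := h
  map_act _ _ := rfl
  map_d _ := rfl

namespace TwistedSum

variable {I : Type} [Fintype I] {r : I → ℕ} {P : I → DGModule A} {M : DGModule A}
  (S : TwistedSum r P M)

lemma ext_π {x y : M} (h : ∀ i, S.π i x = S.π i y) : x = y := by
  rw [← S.sum_ι_π x, ← S.sum_ι_π y]
  exact Finset.sum_congr rfl fun i _ => by rw [h]

lemma π_d_eq_sum (j : I) (x : M) :
    S.π j (M.d x) = ∑ i, S.π j (M.d (S.ι i (S.π i x))) := by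
  conv_lhs => rw [← S.sum_ι_π x, map_sum, map_sum]

lemma π_d_eq_zero (j : I) (x : M) (h : ∀ i, (i = j ∨ r j < r i) → S.π i x = 0) :
    S.π j (M.d x) = 0 := by
  rw [S.π_d_eq_sum]
  refine Finset.sum_eq_zero fun i _ => ?_
  by_cases hi : i = j ∨ r j < r i
  · rw [h i hi]; simp
  · rw [not_or] at hi
    exact S.π_d_ι _ _ _ (Ne.symm hi.1) hi.2

/-- The projections to the pieces of maximal rank commute with the differentials. -/
lemma π_d_of_maximal (j : I) (hj : ∀ i, r i ≤ r j) (x : M) :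
    S.π j (M.d x) = (P j).d (S.π j x) := by
  rw [S.π_d_eq_sum, Finset.sum_eq_single j, S.π_d_ι_self]
  · exact fun i _ hi => S.π_d_ι _ _ _ hi.symm (hj i).not_gt
  · simp

/-- The projection to a piece of maximal rank, as a morphism of dg modules. -/
def projTop (j : I) (hj : ∀ i, r i ≤ r j) : M ⟶ P j where
  toLin := S.π j
  map_mem := (S.π_graded j).map_mem
  map_act := (S.π_graded j).map_act
  map_d := S.π_d_of_maximal j hj

/-- Pieces of maximal rank split off as a direct sum quotient. -/
lemma exists_topQuotient {E : DGModule A} (hP : ∀ i, IsSum E (P i)) (s : Finset I)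
    (hs : ∀ j ∈ s, ∀ i, r i ≤ r j) : ∃ (T : DGModule A) (g : M ⟶ T), IsSum E T ∧
      Function.Surjective g.toLin ∧ ∀ x, g.toLin x = 0 ↔ ∀ j ∈ s, S.π j x = 0 := by
  classical
  induction s using Finset.induction with
  | empty =>
    exact ⟨zero, ⟨0, fun _ _ _ => zero_mem _, fun _ _ => rfl, fun _ => rfl⟩, isSum_zero E,
      fun _ => ⟨0, rfl⟩, fun _ => ⟨by simp, fun _ => rfl⟩⟩
  | insert j s hj ih =>
    obtain ⟨T, g, hT, hg, h⟩ := ih fun j hj => hs j (Finset.mem_insert_of_mem hj)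
    refine ⟨(P j).prod T, prodLift (S.projTop j (hs j (Finset.mem_insert_self j s))) g,
      (hP j).prod hT, ?_, fun x => ?_⟩
    · rintro ⟨p, t⟩
      obtain ⟨y, rfl⟩ := hg t
      have hι : ∀ z, g.toLin (S.ι j z) = 0 := fun z => (h _).2 fun i hi =>
        S.π_ι_of_ne _ _ _ fun h => hj (h ▸ hi)
      refine ⟨y - S.ι j (S.π j y) + S.ι j p, Prod.ext ?_ ?_⟩
      · change S.π j _ = p
        simp [S.π_ι_self]
      · change g.toLin _ = g.toLin y
        simp [hι]
    · rw [Finset.forall_mem_insert, ← h]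
      exact Prod.mk_inj (a₂ := (0 : P j)) (b₂ := (0 : T))

/-- The projection of a twisted sum onto its part of rank less than `n`. -/
def trunc (n : ℕ) : M →ₗ[k] M := ∑ i, if r i < n then S.ι i ∘ₗ S.π i else 0

lemma π_trunc (n : ℕ) (j : I) (x : M) :
    S.π j (S.trunc n x) = if r j < n then S.π j x else 0 := by
  rw [trunc, LinearMap.sum_apply, map_sum, Finset.sum_eq_single j]
  · split_ifs
    · exact S.π_ι_self _ _
    · simp
  · intro i _ hi
    split_ifs
    · exact S.π_ι_of_ne _ _ _ hi.symm
    · simp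
  · simp

lemma trunc_graded (n : ℕ) : IsGradedLinear (S.trunc n) where
  map_mem i x hx := by
    rw [trunc, LinearMap.sum_apply]
    refine sum_mem fun j _ => ?_
    split_ifs
    · exact (S.ι_graded j).map_mem _ _ ((S.π_graded j).map_mem _ _ hx)
    · exact zero_mem _
  map_act x a := S.ext_π fun j => by
    rw [π_trunc, (S.π_graded j).map_act, (S.π_graded j).map_act, π_trunc]
    split_ifs <;> simp

lemma trunc_trunc (n : ℕ) (x : M) : S.trunc n (S.trunc n x) = S.trunc n x :=
  S.ext_π fun j => by
    rw [π_trunc, π_trunc]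
    split_ifs <;> rfl

lemma trunc_d_trunc (n : ℕ) (x : M) : S.trunc n (M.d (S.trunc n x)) = M.d (S.trunc n x) :=
  S.ext_π fun j => by
    rw [π_trunc]
    split_ifs with hj
    · rfl
    · refine (S.π_d_eq_zero j _ fun i hi => ?_).symm
      rw [π_trunc, if_neg]
      rcases hi with rfl | hi <;> omega

lemma trunc_ι (n : ℕ) (i : I) (hi : r i < n) (x : P i) : S.trunc n (S.ι i x) = S.ι i x :=
  S.ext_π fun j => by
    rw [π_trunc]
    split_ifs with hj
    · rfl
    · exact (S.π_ι_of_ne j i x (by rintro rfl; exact hj hi)).symm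

/-- The part of rank less than `n` of a twisted sum, which is a dg submodule. -/
def below (n : ℕ) : DGModule A :=
  M.ofIdem (S.trunc n) (S.trunc_graded n) (S.trunc_trunc n) (S.trunc_d_trunc n)

/-- The inclusion of the part of rank less than `n`. -/
def belowIncl (n : ℕ) : S.below n ⟶ M := ofIdemIncl ..

lemma belowIncl_injective (n : ℕ) : Function.Injective (S.belowIncl n).toLin :=
  Subtype.val_injective

lemma exists_belowIncl_eq_iff (n : ℕ) (x : M) :
    (∃ y, (S.belowIncl n).toLin y = x) ↔ ∀ j, n ≤ r j → S.π j x = 0 := by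
  constructor
  · rintro ⟨⟨_, y, rfl⟩, rfl⟩ j hj
    exact (S.π_trunc n j y).trans (if_neg hj.not_gt)
  · intro h
    refine ⟨⟨x, x, S.ext_π fun j => ?_⟩, rfl⟩
    rw [π_trunc]
    split_ifs with hj
    · rfl
    · exact (h j (not_lt.1 hj)).symm

/-- The part of rank less than `n` is the twisted sum of the pieces of rank less than `n`. -/
def belowTwistedSum (n : ℕ) :
    TwistedSum (fun i : {i // r i < n} => r i) (fun i => P i) (S.below n) where
  ι i := (S.trunc n).rangeRestrict ∘ₗ S.ι i
  π i := S.π i ∘ₗ (LinearMap.range (S.trunc n)).subtype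
  ι_graded i :=
    { map_mem := fun j x hx => (S.trunc_graded n).map_mem _ _ ((S.ι_graded i).map_mem j x hx)
      map_act := fun x a => Subtype.ext ((congrArg (S.trunc n) ((S.ι_graded i).map_act x a)).trans
        ((S.trunc_graded n).map_act _ a)) }
  π_graded i :=
    { map_mem := fun j x hx => (S.π_graded i).map_mem j _ hx
      map_act := fun x a => (S.π_graded i).map_act _ a }
  π_ι_self i x := by
    change S.π i (S.trunc n (S.ι i x)) = x
    rw [S.trunc_ι n i i.2, S.π_ι_self]
  π_ι_of_ne i j x h := by
    change S.π i (S.trunc n (S.ι j x)) = 0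
    rw [S.trunc_ι n j j.2, S.π_ι_of_ne _ _ _ fun h' => h (Subtype.ext h')]
  sum_ι_π := by
    rintro ⟨_, y, rfl⟩
    refine Subtype.ext ?_
    refine (map_sum (LinearMap.range (S.trunc n)).subtype _ _).trans ?_
    change ∑ i : {i // r i < n}, S.trunc n (S.ι i (S.π i (S.trunc n y))) = S.trunc n y
    rw [← Finset.sum_subtype (Finset.univ.filter fun i => r i < n) (by simp)
      (fun i => S.trunc n (S.ι i (S.π i (S.trunc n y)))), Finset.sum_filter]
    refine Eq.trans (Finset.sum_congr rfl fun i _ => ?_) (S.sum_ι_π _)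
    split_ifs with hi
    · exact S.trunc_ι n i hi _
    · rw [π_trunc, if_neg hi, map_zero]
  π_d_ι_self i x := by
    change S.π i (M.d (S.trunc n (S.ι i x))) = _
    rw [S.trunc_ι n i i.2, S.π_d_ι_self]
  π_d_ι i j x h h' := by
    change S.π i (M.d (S.trunc n (S.ι j x))) = _
    rw [S.trunc_ι n j j.2, S.π_d_ι _ _ _ (fun h' => h (Subtype.ext h')) h']

end TwistedSum

/-! ### Filtered dg modules and the star product -/

/-- `IsFiltered E n M` means that `M` is a twisted sum, of ranks at most `n`, of dg modules that are
quasi-isomorphic to finite direct sums of shifts of `E`. -/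
def IsFiltered (E : DGModule A) (n : ℕ) (M : DGModule A) : Prop :=
  ∃ (I : Type) (_ : Fintype I) (r : I → ℕ) (P : I → DGModule A) (_ : TwistedSum r P M),
    (∀ i, r i ≤ n) ∧ ∀ i, IsSum E (P i)

lemma isDistinguished_cone {M N : DGModule A} (f : M ⟶ N) :
    IsDistinguished ((toDerived A).map f) ((toDerived A).map (coneInl f))
      ((toDerived A).map (coneSnd f) ≫ (derivedShiftIso A 1).inv.app M) :=
  have h : ∀ {X Y Z : Derived A} (s : X ⟶ Y) (i : Z ≅ Y) (φ : Z ⟶ Z), φ = 𝟙 Z →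
      (s ≫ i.inv) ≫ φ ≫ i.hom = 𝟙 X ≫ s := by
    rintro X Y Z s i φ rfl
    simp
  ⟨M, N, f, Iso.refl _, Iso.refl _, Iso.refl _, by simp, by simp,
    h _ ((derivedShiftIso A 1).app M) _ ((derivedShift A 1).map_id _)⟩

/-- A filtered dg module is built from `E`: the part of smaller rank is a dg submodule, and the
quotient is the direct sum of the pieces of top rank. -/
lemma IsFiltered.built {E : DGModule A} {n : ℕ} {M : DGModule A} (h : IsFiltered E n M) :
    built E n ((toDerived A).obj M) := by
  classical
  induction n generalizing M with
  | zero =>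
    obtain ⟨I, _, r, P, S, hr, hP⟩ := h
    obtain ⟨T, g, hT, hg, hg'⟩ := S.exists_topQuotient hP Finset.univ fun j _ i => by
      have := hr i; omega
    refine hT.of_dIso (.of_bijective g ⟨(injective_iff_map_eq_zero _).2 fun x hx => ?_, hg⟩)
    exact S.ext_π fun j => by rw [(hg' x).1 hx j (Finset.mem_univ j), map_zero]
  | succ n ih =>
    obtain ⟨I, _, r, P, S, hr, hP⟩ := h
    obtain ⟨T, g, hT, hg, hg'⟩ := S.exists_topQuotient hP {j | r j = n + 1} fun j hj i => by
      have := hr i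
      have := (Finset.mem_filter.1 hj).2
      omega
    refine built_succ_iff.2 ⟨_, _, _, _, _, isDistinguished_cone (S.belowIncl (n + 1)),
      ih ⟨_, inferInstance, _, _, S.belowTwistedSum (n + 1), fun i => by have := i.2; omega,
        fun i => hP i⟩,
      hT.of_dIso (cone_dIso_of_exact _ g (S.belowIncl_injective _) hg fun x => ?_)⟩
    rw [hg', S.exists_belowIncl_eq_iff]
    refine forall_congr' fun j => ?_
    have := hr j
    rw [Finset.mem_filter]
    constructor
    · exact fun h hj => h ⟨Finset.mem_univ _, by omega⟩
    · exact fun h hj => h (by omega)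

/-- Every dg module is the twisted sum of itself alone, in rank `0`. -/
def twistedSumUnit (M : DGModule A) : TwistedSum (fun _ : Unit => 0) (fun _ => M) M where
  ι _ := LinearMap.id
  π _ := LinearMap.id
  ι_graded _ := ⟨fun _ _ h => h, fun _ _ => rfl⟩
  π_graded _ := ⟨fun _ _ h => h, fun _ _ => rfl⟩
  π_ι_self _ _ := rfl
  π_ι_of_ne _ _ _ h := (h rfl).elim
  sum_ι_π _ := by simp
  π_d_ι_self _ _ := rfl
  π_d_ι _ _ _ h := (h rfl).elim

/-- The homotopy pushout of `N ⟵ L ⟶ M` is filtered by the pieces of `M` and, in a higher rank `n`,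
the cone of `L ⟶ N`. -/
def hPushoutTwistedSum {L M N : DGModule A} (f : L ⟶ N) (t : L ⟶ M) {I : Type} [Fintype I]
    {r : I → ℕ} {P : I → DGModule A} (S : TwistedSum r P M) (n : ℕ) (hn : ∀ i, r i < n) :
    TwistedSum (fun i : Option I => i.elim n r) (fun i => i.elim (cone f) P)
      (hPushout f t) where
  ι := fun
    | none => LinearMap.prodMap (LinearMap.inl k N M) LinearMap.id
    | some i => LinearMap.inl k (N × M) L ∘ₗ LinearMap.inr k N M ∘ₗ S.ι i
  π := fun
    | none => LinearMap.prodMap (LinearMap.fst k N M) LinearMap.id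
    | some i => S.π i ∘ₗ LinearMap.snd k N M ∘ₗ LinearMap.fst k (N × M) L
  ι_graded := fun
    | none => ⟨fun i m hm => ⟨⟨hm.1, zero_mem _⟩, hm.2⟩, fun m a => by
        change ((N.act m.1 a, (0 : M)), L.act m.2 a) = ((N.act m.1 a, M.act 0 a), L.act m.2 a)
        simp⟩
    | some i => ⟨fun j m hm => ⟨⟨zero_mem _, (S.ι_graded i).map_mem j m hm⟩, zero_mem _⟩,
        fun m a => by
          change (((0 : N), S.ι i ((P i).act m a)), (0 : L)) =
            ((N.act 0 a, M.act (S.ι i m) a), L.act 0 a)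
          rw [(S.ι_graded i).map_act m a]
          simp⟩
  π_graded := fun
    | none => ⟨fun i m hm => ⟨hm.1.1, hm.2⟩, fun m a => rfl⟩
    | some i => ⟨fun j m hm => (S.π_graded i).map_mem j _ hm.1.2,
        fun m a => (S.π_graded i).map_act _ a⟩
  π_ι_self := fun
    | none, x => rfl
    | some i, x => S.π_ι_self i x
  π_ι_of_ne := fun
    | none, none, x, h => (h rfl).elim
    | none, some j, x, h => rfl
    | some i, none, x, h => map_zero (S.π i)
    | some i, some j, x, h => S.π_ι_of_ne i j x fun h' => h (congrArg some h')
  sum_ι_π x := by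
    rw [Fintype.sum_option]
    change ((x.1.1, (0 : M)), x.2) + ∑ i, LinearMap.inl k (N × M) L (LinearMap.inr k N M
      (S.ι i (S.π i x.1.2))) = ((x.1.1, x.1.2), x.2)
    rw [← map_sum, ← map_sum, S.sum_ι_π]
    simp
  π_d_ι_self := fun
    | none, x => rfl
    | some i, x => by
      change S.π i (M.d (S.ι i x) + t.toLin 0) = (P i).d x
      rw [map_zero, add_zero]
      exact S.π_d_ι_self i x
  π_d_ι := fun
    | none, none, x, h, h' => (h rfl).elim
    | none, some j, x, h, h' => by
      change (N.d 0 + f.toLin 0, -L.d 0) = ((0 : N), (0 : L))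
      simp
    | some i, none, x, h, h' => (h' (hn i)).elim
    | some i, some j, x, h, h' => by
      change S.π i (M.d (S.ι j x) + t.toLin 0) = 0
      rw [map_zero, add_zero]
      exact S.π_d_ι i j x (fun h' => h (congrArg some h')) h'

/-- Everything built from `E` has a filtered model. The first map of a distinguished triangle comes
from a morphism of dg modules `f : M ⟶ N`; replacing `M` by a quasi-isomorphic filtered dg module
changes `N` to iterated homotopy pushouts, the last of which is filtered. -/
lemma exists_isFiltered_of_built {E : DGModule A} {n : ℕ} {M : DGModule A}
    (h : built E n ((toDerived A).obj M)) : ∃ M', IsFiltered E n M' ∧ DIso M M' := by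
  induction n generalizing M with
  | zero =>
    exact ⟨M, ⟨Unit, inferInstance, _, _, twistedSumUnit M, fun _ => le_rfl, fun _ => h⟩, .refl M⟩
  | succ n ih =>
    obtain ⟨X, Y, u, v, w, ⟨L, N, f, a, b, c, -⟩, hX, hY⟩ := built_succ_iff.1 h
    obtain ⟨L', ⟨I, _, r, P, S, hr, hP⟩, hL⟩ := ih (built_of_iso a.symm hX)
    obtain ⟨Z, s, t, hs, ht⟩ := hL.exists_cospan
    have hid : quasiIso A (𝟙 L') := quasiIso_of_bijective _ Function.bijective_id
    -- Up to quasi-isomorphism `g` is `f` with source the filtered dg module `L'`; the homotopy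
    -- pushout of `g` along the identity of `L'` then has an explicit filtration.
    let g : L' ⟶ hPushout f s := t ≫ hInr f s
    have hg : IsSum E (cone g) := IsSum.of_dIso (built_of_iso c.symm hY)
      ((cone_comp_dIso t _ ht).trans (cone_hInr_dIso f s))
    refine ⟨hPushout g (𝟙 L'), ⟨Option I, inferInstance, _, _,
      hPushoutTwistedSum g (𝟙 L') S (n + 1) fun i => Nat.lt_succ_of_le (hr i), ?_, ?_⟩, ?_⟩
    · rintro (_ | i)
      · exact le_rfl
      · exact (hr i).trans n.le_succ
    · rintro (_ | i)
      · exact hg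
      · exact hP i
    · exact DIso.trans ⟨b⟩ ((DIso.of_quasiIso (quasiIso_hInl f s hs)).trans
        (.of_quasiIso (quasiIso_hInl g (𝟙 L') hid)))

/-- The objects generated by `E` in `n` steps are the retracts of filtered dg modules. -/
lemma generated_iff {E M : DGModule A} {n : ℕ} : generated E n ((toDerived A).obj M) ↔
    ∃ M', IsFiltered E n M' ∧
      Nonempty (Retract ((toDerived A).obj M) ((toDerived A).obj M')) := by
  constructor
  · rintro ⟨Y, hY, ⟨ρ⟩⟩
    obtain ⟨N, rfl⟩ := exists_eq_toDerived_obj Y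
    obtain ⟨M', hM', ⟨e⟩⟩ := exists_isFiltered_of_built hY
    exact ⟨M', hM', ⟨ρ.trans (Retract.ofIso e)⟩⟩
  · rintro ⟨M', hM', h⟩
    exact ⟨_, hM'.built, h⟩

end Derived

end DGModule

/-! ### Contractions of acyclic complexes of vector spaces -/

section Contraction

variable {C : Type u} [AddCommGroup C] [Module k C] (ℳ : ℤ → Submodule k C) [Decomposition ℳ]

/-- The projection to the homogeneous component of degree `j`. -/
def gradedProj (j : ℤ) : C →ₗ[k] C :=
  gradedLift ℳ fun i => if i = j then (ℳ i).subtype else 0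

lemma gradedProj_of_mem {i j : ℤ} {x : C} (hx : x ∈ ℳ i) :
    gradedProj ℳ j x = if i = j then x else 0 := by
  rw [gradedProj, gradedLift_of_mem ℳ _ hx]
  split_ifs <;> rfl

lemma gradedProj_mem (j : ℤ) (x : C) : gradedProj ℳ j x ∈ ℳ j := by
  induction x using graded_induction ℳ with
  | add x y hx hy => rw [map_add]; exact add_mem hx hy
  | hom i x hx =>
    rw [gradedProj_of_mem ℳ hx]
    split_ifs with h
    · exact h ▸ hx
    · exact zero_mem _

lemma gradedProj_d {d : C →ₗ[k] C} (hd : ∀ i, ∀ x ∈ ℳ i, d x ∈ ℳ (i + 1)) (j : ℤ) (x : C) :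
    d (gradedProj ℳ j x) = gradedProj ℳ (j + 1) (d x) := by
  induction x using graded_induction ℳ with
  | add x y hx hy => simp only [map_add, hx, hy]
  | hom i x hx =>
    rw [gradedProj_of_mem ℳ hx, gradedProj_of_mem ℳ (hd i x hx), apply_ite d, map_zero]
    exact if_congr (add_left_inj 1).symm rfl rfl

/-- Over a field an acyclic complex has a contraction, of degree `-1`. -/
lemma exists_contraction {d : C →ₗ[k] C} (hd : ∀ i, ∀ x ∈ ℳ i, d x ∈ ℳ (i + 1))
    (hdd : ∀ x, d (d x) = 0) (hC : ∀ x, d x = 0 → ∃ y, x = d y) :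
    ∃ h : C →ₗ[k] C, (∀ i, ∀ x ∈ ℳ (i + 1), h x ∈ ℳ i) ∧ ∀ x, d (h x) + h (d x) = x := by
  obtain ⟨s, hs⟩ := d.rangeRestrict.exists_rightInverse_of_surjective
    d.range_rangeRestrict
  have hs' : ∀ x, d (s x) = x := fun x => congrArg Subtype.val (LinearMap.congr_fun hs x)
  let p : C →ₗ[k] C := LinearMap.id - s ∘ₗ d.rangeRestrict
  have hp : ∀ x, d (p x) = 0 := fun x => by
    change d (x - s (d.rangeRestrict x)) = 0
    rw [map_sub, hs', sub_eq_zero]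
    rfl
  let h₀ : C →ₗ[k] C := s ∘ₗ LinearMap.codRestrict (LinearMap.range d) p fun x => by
    obtain ⟨y, hy⟩ := hC _ (hp x)
    exact ⟨y, hy.symm⟩
  have hh₀ : ∀ x, d (h₀ x) + h₀ (d x) = x := fun x => by
    have h₁ : d (h₀ x) = x - s (d.rangeRestrict x) := hs' _
    have h₂ : h₀ (d x) = s (d.rangeRestrict x) := congrArg s (Subtype.ext (by
      change d x - s (d.rangeRestrict (d x)) = d x
      rw [show d.rangeRestrict (d x) = 0 from Subtype.ext (hdd x), map_zero, sub_zero]))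
    rw [h₁, h₂, sub_add_cancel]
  -- The component of degree `-1` of an arbitrary contraction is again a contraction.
  let h : C →ₗ[k] C := gradedLift ℳ fun i => gradedProj ℳ (i - 1) ∘ₗ h₀ ∘ₗ (ℳ i).subtype
  have hh : ∀ i, ∀ x ∈ ℳ i, h x = gradedProj ℳ (i - 1) (h₀ x) := fun i x hx =>
    gradedLift_of_mem ℳ _ hx
  refine ⟨h, fun i x hx => ?_, fun x => ?_⟩
  · rw [hh _ x hx, add_sub_cancel_right]
    exact gradedProj_mem ℳ _ _
  · induction x using graded_induction ℳ with
    | add x y hx hy =>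
      conv_rhs => rw [← hx, ← hy]
      simp only [map_add]
      abel
    | hom i x hx =>
      rw [hh i x hx, hh _ _ (hd i x hx), gradedProj_d ℳ hd, sub_add_cancel, add_sub_cancel_right,
        ← map_add, hh₀, gradedProj_of_mem ℳ hx, if_pos rfl]

end Contraction

lemma sgn_sub_one (n : ℤ) : (-1 : k) ^ (n - 1) = -(-1 : k) ^ n := by
  rw [← neg_neg ((-1 : k) ^ (n - 1)), ← sgn_add_one, sub_add_cancel]

lemma sgn_eq_of_even {m n : ℤ} (h : Even (m - n)) : (-1 : k) ^ m = (-1 : k) ^ n := by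
  rw [← sub_add_cancel m n, sgn_add, h.neg_one_zpow, one_mul]

namespace DGModule

variable {A B : DGAlgebra k}

/-- A morphism of dg modules that has an inverse up to homotopy, not necessarily compatible with
the action, is a quasi-isomorphism. -/
lemma quasiIso_of_homotopyInverse {M N : DGModule A} (f : M ⟶ N) (b : N →ₗ[k] M) (a : N →ₗ[k] N)
    (e : M →ₗ[k] M) (hb : ∀ y, b (N.d y) = M.d (b y))
    (ha : ∀ y, N.d (a y) + a (N.d y) + f.toLin (b y) = y)
    (he : ∀ x, M.d (e x) + e (M.d x) + x = b (f.toLin x)) : quasiIso A f := by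
  refine (quasiIso_iff f).2 ⟨fun m n hm hn => ⟨b n - e m, ?_⟩,
    fun n hn => ⟨b n, a n, ?_, ?_⟩⟩
  · have := he m
    rw [hn, hb, hm, map_zero, add_zero] at this
    rw [map_sub, ← this, add_sub_cancel_left]
  · rw [← hb, hn, map_zero]
  · have := ha n
    rw [hn, map_zero, add_zero, add_comm] at this
    exact this.symm

/-- Over a field, a quasi-isomorphism has an inverse up to homotopy as a map of complexes of vector
spaces: its components are those of a contraction of the cone. -/
lemma exists_homotopyInverse {M N : DGModule A} {f : M ⟶ N} (hf : quasiIso A f) :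
    ∃ (b : N →ₗ[k] M) (a : N →ₗ[k] N) (e : M →ₗ[k] M),
      (∀ i, ∀ y ∈ N.grading i, b y ∈ M.grading i) ∧
      (∀ i, ∀ y ∈ N.grading (i + 1), a y ∈ N.grading i) ∧
      (∀ i, ∀ x ∈ M.grading (i + 1), e x ∈ M.grading i) ∧ (∀ y, b (N.d y) = M.d (b y)) ∧
      (∀ y, N.d (a y) + a (N.d y) + f.toLin (b y) = y) ∧
      ∀ x, M.d (e x) + e (M.d x) + x = b (f.toLin x) := by
  have hf := (quasiIso_iff f).1 hf
  obtain ⟨h, h_mem, hh⟩ := exists_contraction (C := cone f) (cone f).grading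
    (cone f).d_mem (cone f).d_d (fun (z : N × M) h => by
      obtain ⟨y, x⟩ := z
      obtain ⟨h₁, h₂⟩ := Prod.mk.inj h
      change N.d y + f.toLin x = 0 at h₁
      change -M.d x = 0 at h₂
      obtain ⟨x', rfl⟩ := hf.1 x (-y) (neg_eq_zero.1 h₂) (by
        rw [map_neg, eq_neg_iff_add_eq_zero, add_comm]; exact h₁)
      obtain ⟨x'', n, hx'', hn⟩ := hf.2 (y + f.toLin x') (by rw [map_add, ← f.map_d, h₁])
      refine ⟨(n, x'' - x'), Prod.ext ?_ ?_⟩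
      · change y = N.d n + f.toLin (x'' - x')
        rw [map_sub, add_sub, add_comm (N.d n), ← hn, add_sub_cancel_right]
      · change M.d x' = -M.d (x'' - x')
        rw [map_sub, hx'', zero_sub, neg_neg])
  let h' : N × M →ₗ[k] N × M := h
  let δ : N × M →ₗ[k] N × M := (cone f).d
  have hN : ∀ y, h' (N.d y, 0) = (y, 0) - δ (h' (y, 0)) := fun y => by
    refine Eq.trans (b := h' (δ (y, 0))) (congrArg h' (Prod.ext ?_ ?_))
      (eq_sub_of_add_eq' (hh (y, 0)))
    · change N.d y = N.d y + f.toLin 0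
      simp
    · change 0 = -M.d 0
      simp
  have hM : ∀ x, h' (f.toLin x, -M.d x) = (0, x) - δ (h' (0, x)) := fun x => by
    refine Eq.trans (b := h' (δ (0, x))) (congrArg h' (Prod.ext ?_ rfl))
      (eq_sub_of_add_eq' (hh (0, x)))
    change f.toLin x = N.d 0 + f.toLin x
    simp
  refine ⟨LinearMap.snd k N M ∘ₗ h' ∘ₗ LinearMap.inl k N M,
    LinearMap.fst k N M ∘ₗ h' ∘ₗ LinearMap.inl k N M,
    LinearMap.snd k N M ∘ₗ h' ∘ₗ LinearMap.inr k N M, fun i y hy => ?_, fun i y hy => ?_,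
    fun i x hx => ?_, fun y => ?_, fun y => ?_, fun x => ?_⟩
  · have := (h_mem (i - 1) (y, (0 : M)) ⟨by rwa [sub_add_cancel], zero_mem _⟩).2
    rwa [sub_add_cancel] at this
  · exact (h_mem i (y, (0 : M)) ⟨hy, zero_mem _⟩).1
  · have := (h_mem (i - 1) ((0 : N), x) ⟨zero_mem _, by rwa [sub_add_cancel]⟩).2
    rwa [sub_add_cancel] at this
  · exact (congrArg Prod.snd (hN y)).trans ((zero_sub _).trans (neg_neg _))
  · change N.d (h' (y, 0)).1 + (h' (N.d y, 0)).1 + f.toLin (h' (y, 0)).2 = y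
    have : (h' (N.d y, 0)).1 = y - (N.d (h' (y, 0)).1 + f.toLin (h' (y, 0)).2) :=
      congrArg Prod.fst (hN y)
    rw [this]
    abel
  · have h₁ : (h' (f.toLin x, -M.d x)).2 = x - -M.d (h' (0, x)).2 := congrArg Prod.snd (hM x)
    have h₂ : (f.toLin x, -M.d x) = (f.toLin x, (0 : M)) - (0, M.d x) := by simp
    rw [h₂, map_sub, Prod.snd_sub, sub_eq_iff_eq_add] at h₁
    change M.d (h' (0, x)).2 + (h' (0, M.d x)).2 + x = (h' (f.toLin x, 0)).2
    rw [h₁]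
    abel

/-! ### Exterior tensor products -/

section Tensor

variable {M M' : DGModule A} {N N' : DGModule B}

lemma tensor_ext {P : DGModule (A.tensor B)} {f g : M.tensor N →ₗ[k] P}
    (h : ∀ i j, ∀ x ∈ M.grading i, ∀ y ∈ N.grading j, f (x ⊗ₜ[k] y) = g (x ⊗ₜ[k] y))
    (t : M.tensor N) : f t = g t := by
  induction t using tensor_induction M.grading N.grading with
  | add x y hx hy => exact (map_add f x y).trans ((congrArg₂ _ hx hy).trans (map_add g x y).symm)
  | hom i j x hx y hy => exact h i j x hx y hy

/-- The tensor product of two linear maps, as a map of exterior tensor products. -/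
def tensorMap (f : M →ₗ[k] M') (g : N →ₗ[k] N') : M.tensor N →ₗ[k] M'.tensor N' :=
  TensorProduct.map f g

lemma isGradedLinear_tensorMap {f : M →ₗ[k] M'} {g : N →ₗ[k] N'} (hf : IsGradedLinear f)
    (hg : IsGradedLinear g) : IsGradedLinear (tensorMap f g) where
  map_mem n t ht := map_mem_of_tensorGrading (TensorProduct.map f g) _
    (fun i j x y h hx hy =>
      tmul_mem_tensorGrading h (hf.map_mem i x hx) (hg.map_mem j y hy)) ht
  map_act t z := by
    change A.TensorCarrier B at z
    change TensorProduct.map f g (tensorAct M N t z) = tensorAct M' N' (TensorProduct.map f g t) z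
    induction t using tensor_induction M.grading N.grading with
    | add x y hx hy => simp only [map_add, LinearMap.add_apply, hx, hy]
    | hom i j x hx y hy =>
      induction z using DGAlgebra.toTensor_induction with
      | add x y hx hy => simp only [map_add, hx, hy]
      | hom p q a ha b hb =>
        rw [tensorAct_tmul M N x hy ha, map_smul, TensorProduct.map_tmul, TensorProduct.map_tmul,
          tensorAct_tmul M' N' _ (hg.map_mem j y hy) ha, hf.map_act, hg.map_act]

/-- The exterior tensor product of two morphisms. -/
def tensorHom (f : M ⟶ M') (g : N ⟶ N') : M.tensor N ⟶ M'.tensor N' where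
  toLin := tensorMap f.toLin g.toLin
  map_mem := (isGradedLinear_tensorMap ⟨f.map_mem, f.map_act⟩ ⟨g.map_mem, g.map_act⟩).map_mem
  map_act := (isGradedLinear_tensorMap ⟨f.map_mem, f.map_act⟩ ⟨g.map_mem, g.map_act⟩).map_act
  map_d t := by
    change TensorProduct.map f.toLin g.toLin (tensorD M.grading M.d N.d t) =
      tensorD M'.grading M'.d N'.d (TensorProduct.map f.toLin g.toLin t)
    induction t using tensor_induction M.grading N.grading with
    | add x y hx hy => simp only [map_add, hx, hy]
    | hom i j x hx y hy =>
      rw [tensorD_tmul M.grading M.d N.d hx, map_add, map_smul, TensorProduct.map_tmul,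
        TensorProduct.map_tmul, TensorProduct.map_tmul,
        tensorD_tmul M'.grading M'.d N'.d (f.map_mem i x hx), f.map_d, g.map_d]

end Tensor

/-- The functor `M ↦ M ⊗ N`. -/
def tensorRight (A : DGAlgebra k) (N : DGModule B) : DGModule A ⥤ DGModule (A.tensor B) where
  obj M := M.tensor N
  map f := tensorHom f (𝟙 N)
  map_id M := hom_ext (LinearMap.congr_fun (TensorProduct.map_id (R := k) (M := M) (N := N)))
  map_comp f g := hom_ext (LinearMap.congr_fun
    (TensorProduct.map_comp g.toLin LinearMap.id f.toLin LinearMap.id))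

/-- The functor `N ↦ M ⊗ N`. -/
def tensorLeft (B : DGAlgebra k) (M : DGModule A) : DGModule B ⥤ DGModule (A.tensor B) where
  obj N := M.tensor N
  map f := tensorHom (𝟙 M) f
  map_id N := hom_ext (LinearMap.congr_fun (TensorProduct.map_id (R := k) (M := M) (N := N)))
  map_comp f g := hom_ext (LinearMap.congr_fun
    (TensorProduct.map_comp LinearMap.id g.toLin LinearMap.id f.toLin))

lemma quasiIso_tensorRight (N : DGModule B) {M M' : DGModule A} (f : M ⟶ M')
    (hf : quasiIso A f) : quasiIso (A.tensor B) ((tensorRight A N).map f) := by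
  obtain ⟨b, a, e, hb, ha, he, h₁, h₂, h₃⟩ := exists_homotopyInverse hf
  -- A map of degree `-1` on the first factor anticommutes with the second part of the differential.
  have key : ∀ {L : DGModule A} (c : L →ₗ[k] L)
      (_ : ∀ i, ∀ x ∈ L.grading (i + 1), c x ∈ L.grading i) (i : ℤ), ∀ x ∈ L.grading i, ∀ y : N,
      tensorD L.grading L.d N.d (c x ⊗ₜ y) + TensorProduct.map c LinearMap.id
        (tensorD L.grading L.d N.d (x ⊗ₜ y)) = (L.d (c x) + c (L.d x)) ⊗ₜ y := by
    intro L c hc i x hx y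
    rw [tensorD_tmul L.grading L.d N.d hx,
      tensorD_tmul L.grading L.d N.d (hc (i - 1) x (by rwa [sub_add_cancel])), map_add, map_smul,
      TensorProduct.map_tmul, TensorProduct.map_tmul, add_tmul, sgn_sub_one]
    simp only [LinearMap.id_apply]
    module
  refine quasiIso_of_homotopyInverse _ (tensorMap b LinearMap.id) (tensorMap a LinearMap.id)
    (tensorMap e LinearMap.id) (fun t => ?_) (fun t => ?_) (fun (t : M ⊗[k] N) => ?_)
  · change TensorProduct.map b LinearMap.id (tensorD M'.grading M'.d N.d t) =
      tensorD M.grading M.d N.d (TensorProduct.map b LinearMap.id t)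
    induction t using tensor_induction M'.grading N.grading with
    | add x y hx hy => simp only [map_add, hx, hy]
    | hom i j x hx y hy =>
      rw [tensorD_tmul M'.grading M'.d N.d hx, map_add, map_smul, TensorProduct.map_tmul,
        TensorProduct.map_tmul, TensorProduct.map_tmul,
        tensorD_tmul M.grading M.d N.d (hb i x hx), h₁]
      rfl
  · change tensorD M'.grading M'.d N.d (TensorProduct.map a LinearMap.id t) +
      TensorProduct.map a LinearMap.id (tensorD M'.grading M'.d N.d t) +
      TensorProduct.map f.toLin LinearMap.id (TensorProduct.map b LinearMap.id t) = t
    induction t using tensor_induction M'.grading N.grading with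
    | add x y hx hy =>
      conv_rhs => rw [← hx, ← hy]
      simp only [map_add]
      abel
    | hom i j x hx y hy =>
      conv_rhs => rw [← h₂ x]
      rw [TensorProduct.map_tmul, LinearMap.id_apply, key a ha i x hx, TensorProduct.map_tmul,
        TensorProduct.map_tmul, add_tmul (M'.d (a x) + a (M'.d x))]
      rfl
  · change tensorD M.grading M.d N.d (TensorProduct.map e LinearMap.id t) +
      TensorProduct.map e LinearMap.id (tensorD M.grading M.d N.d t) + t =
      TensorProduct.map b LinearMap.id (TensorProduct.map f.toLin LinearMap.id t)
    induction t using tensor_induction M.grading N.grading with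
    | add x y hx hy =>
      simp only [map_add]
      rw [← hx, ← hy]
      abel
    | hom i j x hx y hy =>
      rw [TensorProduct.map_tmul, LinearMap.id_apply, key e he i x hx, TensorProduct.map_tmul,
        TensorProduct.map_tmul, ← h₃, add_tmul (M.d (e x) + e (M.d x))]
      rfl

lemma quasiIso_tensorLeft (M : DGModule A) {N N' : DGModule B} (f : N ⟶ N')
    (hf : quasiIso B f) : quasiIso (A.tensor B) ((tensorLeft B M).map f) := by
  obtain ⟨b, a, e, hb, ha, he, h₁, h₂, h₃⟩ := exists_homotopyInverse hf
  let σ := signMap M.grading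
  -- The Koszul sign of a map of odd degree on the second factor.
  have key : ∀ {L : DGModule B} (c : L →ₗ[k] L) (i : ℤ), ∀ x ∈ M.grading i, ∀ y : L,
      tensorD M.grading M.d L.d (σ x ⊗ₜ c y) + TensorProduct.map σ c
        (tensorD M.grading M.d L.d (x ⊗ₜ y)) = x ⊗ₜ (L.d (c y) + c (L.d y)) := by
    intro L c i x hx y
    rw [signMap_of_mem M.grading hx, ← smul_tmul', map_smul, tensorD_tmul M.grading M.d L.d hx,
      tensorD_tmul M.grading M.d L.d hx, map_add, map_smul, TensorProduct.map_tmul,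
      TensorProduct.map_tmul, signMap_of_mem M.grading hx,
      signMap_of_mem M.grading (M.d_mem i x hx), ← smul_tmul', ← smul_tmul', tmul_add, sgn_add_one]
    simp only [smul_add, smul_smul, sgn_sq]
    module
  refine quasiIso_of_homotopyInverse _ (tensorMap LinearMap.id b) (tensorMap σ a)
    (tensorMap σ e) (fun t => ?_) (fun t => ?_) (fun (t : M ⊗[k] N) => ?_)
  · change TensorProduct.map LinearMap.id b (tensorD M.grading M.d N'.d t) =
      tensorD M.grading M.d N.d (TensorProduct.map LinearMap.id b t)
    induction t using tensor_induction M.grading N'.grading with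
    | add x y hx hy => simp only [map_add, hx, hy]
    | hom i j x hx y hy =>
      rw [tensorD_tmul M.grading M.d N'.d hx, map_add, map_smul, TensorProduct.map_tmul,
        TensorProduct.map_tmul, TensorProduct.map_tmul, LinearMap.id_apply, LinearMap.id_apply,
        tensorD_tmul M.grading M.d N.d hx, h₁]
  · change tensorD M.grading M.d N'.d (TensorProduct.map σ a t) +
      TensorProduct.map σ a (tensorD M.grading M.d N'.d t) +
      TensorProduct.map LinearMap.id f.toLin (TensorProduct.map LinearMap.id b t) = t
    induction t using tensor_induction M.grading N'.grading with
    | add x y hx hy =>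
      conv_rhs => rw [← hx, ← hy]
      simp only [map_add]
      abel
    | hom i j x hx y hy =>
      conv_rhs => rw [← h₂ y]
      rw [TensorProduct.map_tmul, key a i x hx, TensorProduct.map_tmul,
        TensorProduct.map_tmul, tmul_add _ (N'.d (a y) + a (N'.d y))]
      rfl
  · change tensorD M.grading M.d N.d (TensorProduct.map σ e t) +
      TensorProduct.map σ e (tensorD M.grading M.d N.d t) + t =
      TensorProduct.map LinearMap.id b (TensorProduct.map LinearMap.id f.toLin t)
    induction t using tensor_induction M.grading N.grading with
    | add x y hx hy =>
      simp only [map_add]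
      rw [← hx, ← hy]
      abel
    | hom i j x hx y hy =>
      rw [TensorProduct.map_tmul, key e i x hx, TensorProduct.map_tmul,
        TensorProduct.map_tmul, ← h₃, tmul_add _ (N.d (e y) + e (N.d y))]
      rfl

/-! ### Tensor products of filtered dg modules -/

lemma DIso.tensor {M M' : DGModule A} {N N' : DGModule B} (h : DIso M M') (h' : DIso N N') :
    DIso (M.tensor N) (M'.tensor N') :=
  (h.map (tensorRight A N) (quasiIso_tensorRight N)).trans
    (h'.map (tensorLeft B M') (quasiIso_tensorLeft M'))

lemma prod_tensor_dIso (M M' : DGModule A) (N : DGModule B) :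
    DIso ((M.prod M').tensor N) ((M.tensor N).prod (M'.tensor N)) := by
  refine .of_bijective (prodLift (tensorHom (fst _ _) (𝟙 N)) (tensorHom (snd _ _) (𝟙 N))) ?_
  refine (congrArg Function.Bijective (funext fun t => ?_)).mpr
    (TensorProduct.prodLeft k k M M' N).bijective
  induction t using TensorProduct.induction_on with
  | zero => exact (map_zero _).trans (map_zero _).symm
  | add x y hx hy => exact (map_add _ _ _).trans ((congrArg₂ _ hx hy).trans (map_add _ _ _).symm)
  | tmul x y => rfl

lemma tensor_prod_dIso (M : DGModule A) (N N' : DGModule B) :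
    DIso (M.tensor (N.prod N')) ((M.tensor N).prod (M.tensor N')) := by
  refine .of_bijective (prodLift (tensorHom (𝟙 M) (fst _ _)) (tensorHom (𝟙 M) (snd _ _))) ?_
  refine (congrArg Function.Bijective (funext fun t => ?_)).mpr
    (TensorProduct.prodRight k k M N N').bijective
  induction t using TensorProduct.induction_on with
  | zero => exact (map_zero _).trans (map_zero _).symm
  | add x y hx hy => exact (map_add _ _ _).trans ((congrArg₂ _ hx hy).trans (map_add _ _ _).symm)
  | tmul x y => rfl

/-- A zero dg module is the empty sum of shifts of `E`. -/
lemma isSum_of_subsingleton (E M : DGModule A) [Subsingleton M] : IsSum E M :=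
  (isSum_zero E).of_dIso (.of_bijective (N := zero) ⟨0, fun _ _ _ => zero_mem _, fun _ _ => rfl,
    fun _ => rfl⟩ ⟨fun _ _ _ => Subsingleton.elim _ _, fun _ => ⟨0, rfl⟩⟩)

/-- The operator `x ↦ (-1)^(b|x|) x`. -/
def signPow (M : DGModule A) (b : ℤ) : M →ₗ[k] M :=
  gradedLift M.grading fun i => ((-1 : k) ^ (b * i)) • (M.grading i).subtype

lemma signPow_of_mem {M : DGModule A} (b : ℤ) {i : ℤ} {x : M} (hx : x ∈ M.grading i) :
    M.signPow b x = (-1 : k) ^ (b * i) • x := by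
  simp [signPow, gradedLift_of_mem M.grading _ hx]

lemma signPow_signPow (M : DGModule A) (b : ℤ) (x : M) : M.signPow b (M.signPow b x) = x := by
  induction x using graded_induction M.grading with
  | add x y hx hy => rw [map_add, map_add, hx, hy]
  | hom i x hx => rw [signPow_of_mem b hx, map_smul, signPow_of_mem b hx, smul_smul, sgn_sq,
      one_smul]

/-- The identity map from a shift of `M` to `M`, of degree `n`. -/
def unshift (M : DGModule A) (n : ℤ) : M.shift n →ₗ[k] M := LinearMap.id

/-- The linear map underlying the isomorphism `E[a] ⊗ E'[b] ≅ (E ⊗ E')[a + b]`, which sends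
`x ⊗ y` to `(-1)^(b|x|) x ⊗ y`. -/
def shiftTensorShiftLin (E : DGModule A) (E' : DGModule B) (a b : ℤ) :
    E.shift a ⊗[k] E'.shift b →ₗ[k] E ⊗[k] E' :=
  TensorProduct.map (E.signPow b ∘ₗ E.unshift a) (E'.unshift b)

lemma shiftTensorShiftLin_tmul (E : DGModule A) (E' : DGModule B) (a b : ℤ) {i : ℤ}
    {x : E.shift a} (hx : x ∈ (E.shift a).grading i) (y : E'.shift b) :
    shiftTensorShiftLin E E' a b (x ⊗ₜ y) =
      (-1 : k) ^ (b * (i + a)) • (E.unshift a x ⊗ₜ E'.unshift b y) := by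
  rw [shiftTensorShiftLin, TensorProduct.map_tmul, LinearMap.comp_apply,
    signPow_of_mem (M := E) b (i := i + a) (x := E.unshift a x) hx, smul_tmul']

/-- The isomorphism `E[a] ⊗ E'[b] ≅ (E ⊗ E')[a + b]`. -/
def shiftTensorShift (E : DGModule A) (E' : DGModule B) (a b : ℤ) :
    (E.shift a).tensor (E'.shift b) ⟶ (E.tensor E').shift (a + b) where
  toLin := shiftTensorShiftLin E E' a b
  map_mem n t ht := map_mem_of_tensorGrading (shiftTensorShiftLin E E' a b)
    (tensorGrading E.grading E'.grading (n + (a + b)))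
    (fun i j x y h hx hy => by
      rw [shiftTensorShiftLin_tmul E E' a b hx]
      exact Submodule.smul_mem _ _
        (tmul_mem_tensorGrading (i := i + a) (j := j + b) (by omega) hx hy)) ht
  map_act t z := by
    change A.TensorCarrier B at z
    change shiftTensorShiftLin E E' a b (tensorAct (E.shift a) (E'.shift b) t z) =
        tensorAct E E' (shiftTensorShiftLin E E' a b t) z
    induction t using tensor_induction (E.shift a).grading (E'.shift b).grading with
    | add x y hx hy => simp only [map_add, LinearMap.add_apply, hx, hy]
    | hom i j x hx y hy =>
      induction z using DGAlgebra.toTensor_induction with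
      | add x y hx hy => simp only [map_add, hx, hy]
      | hom p q c hc d hd =>
        have hy' : E'.unshift b y ∈ E'.grading (j + b) := hy
        rw [tensorAct_tmul _ _ x hy hc, map_smul, shiftTensorShiftLin_tmul E E' a b hx,
          shiftTensorShiftLin_tmul E E' a b ((E.shift a).act_mem i p x hx c hc), map_smul,
          LinearMap.smul_apply, tensorAct_tmul E E' _ hy' hc, smul_smul, smul_smul,
          ← sgn_add, ← sgn_add]
        exact congrArg (· • _) (sgn_eq_of_even ⟨0, by ring⟩)
  map_d t := by
    change shiftTensorShiftLin E E' a b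
      (tensorD (E.shift a).grading (E.shift a).d (E'.shift b).d t) = (-1 : k) ^ (a + b) •
        tensorD E.grading E.d E'.d (shiftTensorShiftLin E E' a b t)
    induction t using tensor_induction (E.shift a).grading (E'.shift b).grading with
    | add x y hx hy => simp only [map_add, hx, hy, smul_add]
    | hom i j x hx y hy =>
      have hd : E.unshift a ((E.shift a).d x) = (-1 : k) ^ a • E.d (E.unshift a x) := rfl
      have hd' : E'.unshift b ((E'.shift b).d y) = (-1 : k) ^ b • E'.d (E'.unshift b y) := rfl
      rw [tensorD_tmul (E.shift a).grading _ _ hx, map_add, map_smul,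
        shiftTensorShiftLin_tmul E E' a b hx,
        shiftTensorShiftLin_tmul E E' a b ((E.shift a).d_mem i x hx),
        shiftTensorShiftLin_tmul E E' a b hx, hd, hd', map_smul,
        tensorD_tmul E.grading _ _ (i := i + a) (x := E.unshift a x) hx, tmul_smul, ← smul_tmul',
        smul_add, smul_add]
      simp only [← sgn_add, smul_smul]
      congr 2
      · exact sgn_eq_of_even ⟨0, by ring⟩
      · exact sgn_eq_of_even ⟨-a, by ring⟩

lemma shiftTensorShift_bijective (E : DGModule A) (E' : DGModule B) (a b : ℤ) :
    Function.Bijective (shiftTensorShift E E' a b).toLin := by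
  refine Function.Involutive.bijective (f := TensorProduct.map (E.signPow b) LinearMap.id) ?_
  intro t
  induction t using TensorProduct.induction_on with
  | zero => simp
  | add x y hx hy => rw [map_add, map_add, hx, hy]
  | tmul x y => rw [TensorProduct.map_tmul, TensorProduct.map_tmul, signPow_signPow]; rfl

lemma IsSum.tensor {E M : DGModule A} {E' N : DGModule B} (hM : IsSum E M) (hN : IsSum E' N) :
    IsSum (E.tensor E') (M.tensor N) := by
  obtain ⟨l, hl⟩ := isSum_iff.1 hM
  obtain ⟨l', hl'⟩ := isSum_iff.1 hN
  refine IsSum.of_dIso ?_ (hl.tensor hl')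
  clear hl hl' hM hN
  induction l with
  | nil =>
    have : Subsingleton ((sumOfShifts E []).tensor (sumOfShifts E' l')) :=
      inferInstanceAs (Subsingleton (PUnit.{u + 1} ⊗[k] sumOfShifts E' l'))
    exact isSum_of_subsingleton _ _
  | cons a l ih =>
    refine (IsSum.prod ?_ ih).of_dIso (prod_tensor_dIso _ _ _)
    clear ih
    induction l' with
    | nil =>
      have : Subsingleton ((E.shift a).tensor (sumOfShifts E' [])) :=
        inferInstanceAs (Subsingleton (E.shift a ⊗[k] PUnit.{u + 1}))
      exact isSum_of_subsingleton _ _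
    | cons b l' ih =>
      exact (((isSum_shift _ (a + b)).of_dIso (.of_bijective _
        (shiftTensorShift_bijective E E' a b))).prod ih).of_dIso (tensor_prod_dIso _ _ _)

/-- The tensor product of two twisted direct sums; the ranks add up. -/
def TwistedSum.tensor {I J : Type} [Fintype I] [Fintype J] {r : I → ℕ} {s : J → ℕ}
    {P : I → DGModule A} {R : J → DGModule B} {M : DGModule A} {N : DGModule B}
    (S : TwistedSum r P M) (T : TwistedSum s R N) :
    TwistedSum (fun i : I × J => r i.1 + s i.2) (fun i => (P i.1).tensor (R i.2))
      (M.tensor N) where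
  ι i := tensorMap (S.ι i.1) (T.ι i.2)
  π i := tensorMap (S.π i.1) (T.π i.2)
  ι_graded i := isGradedLinear_tensorMap (S.ι_graded i.1) (T.ι_graded i.2)
  π_graded i := isGradedLinear_tensorMap (S.π_graded i.1) (T.π_graded i.2)
  π_ι_self i := tensor_ext (f := tensorMap (S.π i.1) (T.π i.2) ∘ₗ tensorMap (S.ι i.1) (T.ι i.2))
    (g := LinearMap.id) fun p q x hx y hy => by
      change S.π i.1 (S.ι i.1 x) ⊗ₜ[k] T.π i.2 (T.ι i.2 y) = x ⊗ₜ[k] y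
      rw [S.π_ι_self, T.π_ι_self]
  π_ι_of_ne i j x h := tensor_ext
    (f := tensorMap (S.π i.1) (T.π i.2) ∘ₗ tensorMap (S.ι j.1) (T.ι j.2))
    (g := 0) (fun p q x hx y hy => by
      change S.π i.1 (S.ι j.1 x) ⊗ₜ[k] T.π i.2 (T.ι j.2 y) = 0
      by_cases h₁ : i.1 = j.1
      · rw [T.π_ι_of_ne _ _ _ fun h₂ => h (Prod.ext h₁ h₂), tmul_zero]
      · rw [S.π_ι_of_ne _ _ _ h₁, zero_tmul]) x
  sum_ι_π t := by
    change ∑ i : I × J, TensorProduct.map (S.ι i.1) (T.ι i.2)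
      (TensorProduct.map (S.π i.1) (T.π i.2) t) = t
    induction t using TensorProduct.induction_on with
    | zero => simp
    | add x y hx hy =>
      conv_rhs => rw [← hx, ← hy]
      simp only [map_add, Finset.sum_add_distrib]
    | tmul x y =>
      conv_rhs => rw [← S.sum_ι_π x, ← T.sum_ι_π y, sum_tmul]
      simp only [TensorProduct.map_tmul, Fintype.sum_prod_type, tmul_sum]
  π_d_ι_self i := tensor_ext
    (f := tensorMap (S.π i.1) (T.π i.2) ∘ₗ (M.tensor N).d ∘ₗ tensorMap (S.ι i.1) (T.ι i.2))
    (g := ((P i.1).tensor (R i.2)).d) fun p q x hx y hy => by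
      change TensorProduct.map (S.π i.1) (T.π i.2) (tensorD M.grading M.d N.d
        (S.ι i.1 x ⊗ₜ T.ι i.2 y)) = tensorD (P i.1).grading (P i.1).d (R i.2).d (x ⊗ₜ y)
      rw [tensorD_tmul M.grading M.d N.d ((S.ι_graded i.1).map_mem p x hx),
        tensorD_tmul (P i.1).grading _ _ hx, map_add, map_smul, TensorProduct.map_tmul,
        TensorProduct.map_tmul, S.π_d_ι_self, S.π_ι_self, T.π_ι_self, T.π_d_ι_self]
  π_d_ι i j x h h' := tensor_ext
    (f := tensorMap (S.π i.1) (T.π i.2) ∘ₗ (M.tensor N).d ∘ₗ tensorMap (S.ι j.1) (T.ι j.2))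
    (g := 0) (fun p q x hx y hy => by
      change TensorProduct.map (S.π i.1) (T.π i.2) (tensorD M.grading M.d N.d
        (S.ι j.1 x ⊗ₜ T.ι j.2 y)) = 0
      rw [tensorD_tmul M.grading M.d N.d ((S.ι_graded j.1).map_mem p x hx), map_add, map_smul,
        TensorProduct.map_tmul, TensorProduct.map_tmul]
      -- Each of the two parts of the differential changes only one of the indices.
      by_cases h₁ : i.1 = j.1
      · have h₂ : i.2 ≠ j.2 := fun h₂ => h (Prod.ext h₁ h₂)
        rw [T.π_ι_of_ne _ _ _ h₂, T.π_d_ι _ _ _ h₂ fun h₃ => h' (by rw [h₁]; omega), tmul_zero,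
          tmul_zero, smul_zero, add_zero]
      · rw [S.π_ι_of_ne _ _ _ h₁, zero_tmul, smul_zero, add_zero]
        by_cases h₂ : i.2 = j.2
        · rw [S.π_d_ι _ _ _ h₁ fun h₃ => h' (by rw [h₂]; omega), zero_tmul]
        · rw [T.π_ι_of_ne _ _ _ h₂, tmul_zero]) x

lemma IsFiltered.tensor {E M : DGModule A} {E' N : DGModule B} {m n : ℕ} (hM : IsFiltered E m M)
    (hN : IsFiltered E' n N) : IsFiltered (E.tensor E') (m + n) (M.tensor N) := by
  obtain ⟨I, _, r, P, S, hr, hP⟩ := hM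
  obtain ⟨J, _, s, R, T, hs, hR⟩ := hN
  exact ⟨I × J, inferInstance, _, _, S.tensor T, fun i => add_le_add (hr _) (hs _),
    fun i => (hP _).tensor (hR _)⟩

/-- The exterior tensor product is additive on the number of cones. -/
theorem generated_tensor {E M : DGModule A} {E' N : DGModule B} {m n : ℕ}
    (hM : generated E m ((toDerived A).obj M)) (hN : generated E' n ((toDerived B).obj N)) :
    generated (E.tensor E') (m + n) ((toDerived (A.tensor B)).obj (M.tensor N)) := by
  obtain ⟨M', hM', hM⟩ := generated_iff.1 hM
  obtain ⟨N', hN', hN⟩ := generated_iff.1 hN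
  obtain ⟨ρ⟩ := retract_map (tensorRight A N) (quasiIso_tensorRight N) hM
  obtain ⟨ρ'⟩ := retract_map (tensorLeft B M') (quasiIso_tensorLeft M') hN
  exact generated_iff.2 ⟨_, hM'.tensor hN', ⟨ρ.trans ρ'⟩⟩

end DGModule

/-! ### Restriction of scalars -/

/-- A morphism of dg algebras. -/
structure DGAlgHom (C A : DGAlgebra k) where
  toLin : C →ₗ[k] A
  map_one : toLin 1 = 1
  map_mul : ∀ x y, toLin (x * y) = toLin x * toLin y
  map_mem : ∀ i, ∀ x ∈ C.grading i, toLin x ∈ A.grading i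
  map_d : ∀ x, toLin (C.d x) = A.d (toLin x)

namespace DGModule

variable {A C : DGAlgebra k}

/-- Restriction of scalars along a morphism of dg algebras. -/
def restrict (φ : DGAlgHom C A) (M : DGModule A) : DGModule C where
  carrier := M
  grading := M.grading
  act := M.act.compl₂ φ.toLin
  act_one m := by
    rw [LinearMap.compl₂_apply, φ.map_one, M.act_one]
  act_mul m a b := by
    simp only [LinearMap.compl₂_apply]
    rw [φ.map_mul, M.act_mul]
  act_mem i j m hm a ha := M.act_mem i j m hm _ (φ.map_mem j a ha)
  d := M.d
  d_mem := M.d_mem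
  d_d := M.d_d
  d_act i m hm a := by
    simp only [LinearMap.compl₂_apply]
    rw [φ.map_d, M.d_act i m hm]

/-- Restriction of scalars as a functor. -/
def restrictFunctor (φ : DGAlgHom C A) : DGModule A ⥤ DGModule C where
  obj := restrict φ
  map f := ⟨f.toLin, f.map_mem, fun m a => f.map_act m (φ.toLin a), f.map_d⟩

lemma quasiIso_restrict (φ : DGAlgHom C A) {M N : DGModule A} (f : M ⟶ N) (hf : quasiIso A f) :
    quasiIso C ((restrictFunctor φ).map f) :=
  hf

lemma DIso.restrict (φ : DGAlgHom C A) {M N : DGModule A} (h : DIso M N) :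
    DIso (restrict φ M) (restrict φ N) :=
  h.map (restrictFunctor φ) (quasiIso_restrict φ)

lemma IsSum.restrict (φ : DGAlgHom C A) {E M : DGModule A} (hM : IsSum E M) :
    IsSum (restrict φ E) (restrict φ M) := by
  obtain ⟨l, hl⟩ := isSum_iff.1 hM
  refine IsSum.of_dIso ?_ (hl.restrict φ)
  clear hl hM
  induction l with
  | nil =>
    have : Subsingleton (DGModule.restrict φ (sumOfShifts E [])) :=
      inferInstanceAs (Subsingleton PUnit.{u + 1})
    exact isSum_of_subsingleton _ _
  | cons a l ih =>
    exact ((isSum_shift _ a).prod ih).of_dIso (.of_bijective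
      (N := ((DGModule.restrict φ E).shift a).prod (DGModule.restrict φ (sumOfShifts E l)))
      ⟨LinearMap.id, fun _ _ h => h, fun _ _ => rfl, fun _ => rfl⟩ Function.bijective_id)

/-- A twisted direct sum remains one after restriction of scalars. -/
def TwistedSum.restrict (φ : DGAlgHom C A) {I : Type} [Fintype I] {r : I → ℕ}
    {P : I → DGModule A} {M : DGModule A} (S : TwistedSum r P M) :
    TwistedSum r (fun i => DGModule.restrict φ (P i)) (DGModule.restrict φ M) where
  ι := S.ι
  π := S.π
  ι_graded i := ⟨(S.ι_graded i).map_mem, fun m a => (S.ι_graded i).map_act m (φ.toLin a)⟩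
  π_graded i := ⟨(S.π_graded i).map_mem, fun m a => (S.π_graded i).map_act m (φ.toLin a)⟩
  π_ι_self := S.π_ι_self
  π_ι_of_ne := S.π_ι_of_ne
  sum_ι_π := S.sum_ι_π
  π_d_ι_self := S.π_d_ι_self
  π_d_ι := S.π_d_ι

lemma generated_restrict (φ : DGAlgHom C A) {E M : DGModule A} {n : ℕ}
    (hM : generated E n ((toDerived A).obj M)) :
    generated (restrict φ E) n ((toDerived C).obj (restrict φ M)) := by
  obtain ⟨M', ⟨I, _, r, P, S, hr, hP⟩, hM⟩ := generated_iff.1 hM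
  exact generated_iff.2 ⟨restrict φ M', ⟨I, inferInstance, r, _, S.restrict φ, hr,
    fun i => (hP i).restrict φ⟩, retract_map (restrictFunctor φ) (quasiIso_restrict φ) hM⟩

lemma self_dIso_restrict (φ : DGAlgHom C A) (hφ : Function.Bijective φ.toLin) :
    DIso (self C) (restrict φ (self A)) :=
  .of_bijective (N := restrict φ (self A)) ⟨φ.toLin, φ.map_mem, φ.map_mul, φ.map_d⟩ hφ

lemma self_tensor_self_dIso (A B : DGAlgebra k) :
    DIso ((self A).tensor (self B)) (self (A.tensor B)) := by
  refine .of_bijective (M := (self A).tensor (self B)) (N := self (A.tensor B))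
    ⟨(A.toTensor B).toLinearMap, fun _ _ h => h, fun t z => ?_, fun _ => rfl⟩
    (A.toTensor B).bijective
  change A.TensorCarrier B at z
  let τ : self A ⊗[k] self B →ₗ[k] A.TensorCarrier B := (A.toTensor B).toLinearMap
  have hτ : ∀ (x : A) (y : B), τ (x ⊗ₜ y) = A.toTensor B (x ⊗ₜ y) := fun _ _ => rfl
  change τ (tensorAct (self A) (self B) t z) = τ t * z
  induction t using tensor_induction (self A).grading (self B).grading with
  | add x y hx hy => simp only [map_add, LinearMap.add_apply, add_mul, hx, hy]
  | hom i j x hx y hy =>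
    induction z using DGAlgebra.toTensor_induction with
    | add x y hx hy => simp only [map_add, mul_add, hx, hy]
    | hom p q a ha b hb =>
      rw [tensorAct_tmul (self A) (self B) x hy ha, map_smul]
      exact (DGAlgebra.toTensor_mul x hy ha b).symm

end DGModule

/-! ### Interchange of tensor factors -/

section MiddleSwap

variable {M₁ M₂ N₁ N₂ : Type u} [AddCommGroup M₁] [AddCommGroup M₂] [AddCommGroup N₁]
  [AddCommGroup N₂] [Module k M₁] [Module k M₂] [Module k N₁] [Module k N₂]
  (ℳ₁ : ℤ → Submodule k M₁) (ℳ₂ : ℤ → Submodule k M₂) (𝒩₁ : ℤ → Submodule k N₁)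
  (𝒩₂ : ℤ → Submodule k N₂) [Decomposition ℳ₂] [Decomposition 𝒩₁]

lemma tensor₄_induction [Decomposition ℳ₁] [Decomposition 𝒩₂]
    {p : (M₁ ⊗[k] M₂) ⊗[k] (N₁ ⊗[k] N₂) → Prop}
    (hom : ∀ i₁ i₂ j₁ j₂, ∀ x₁ ∈ ℳ₁ i₁, ∀ x₂ ∈ ℳ₂ i₂, ∀ y₁ ∈ 𝒩₁ j₁, ∀ y₂ ∈ 𝒩₂ j₂,
      p ((x₁ ⊗ₜ x₂) ⊗ₜ (y₁ ⊗ₜ y₂)))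
    (add : ∀ x y, p x → p y → p (x + y)) (t : (M₁ ⊗[k] M₂) ⊗[k] (N₁ ⊗[k] N₂)) : p t := by
  induction t using TensorProduct.induction_on with
  | zero =>
    simpa using hom 0 0 0 0 0 (zero_mem _) 0 (zero_mem _) 0 (zero_mem _) 0 (zero_mem _)
  | add x y hx hy => exact add x y hx hy
  | tmul x y =>
    induction x using tensor_induction ℳ₁ ℳ₂ with
    | add x x' hx hx' => rw [add_tmul]; exact add _ _ hx hx'
    | hom i₁ i₂ x₁ hx₁ x₂ hx₂ =>
      induction y using tensor_induction 𝒩₁ 𝒩₂ with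
      | add y y' hy hy' => rw [tmul_add]; exact add _ _ hy hy'
      | hom j₁ j₂ y₁ hy₁ y₂ hy₂ => exact hom i₁ i₂ j₁ j₂ x₁ hx₁ x₂ hx₂ y₁ hy₁ y₂ hy₂

/-- The interchange `(x₁ ⊗ x₂) ⊗ (y₁ ⊗ y₂) ↦ (-1)^(|x₂||y₁|) (x₁ ⊗ y₁) ⊗ (x₂ ⊗ y₂)`. -/
def middleSwap : (M₁ ⊗[k] M₂) ⊗[k] (N₁ ⊗[k] N₂) →ₗ[k] (M₁ ⊗[k] N₁) ⊗[k] (M₂ ⊗[k] N₂) :=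
  (TensorProduct.assoc k M₁ N₁ (M₂ ⊗[k] N₂)).symm.toLinearMap ∘ₗ
    LinearMap.lTensor M₁ ((TensorProduct.assoc k N₁ M₂ N₂).toLinearMap ∘ₗ
      LinearMap.rTensor N₂ (koszulSwap ℳ₂ 𝒩₁) ∘ₗ
      (TensorProduct.assoc k M₂ N₁ N₂).symm.toLinearMap) ∘ₗ
    (TensorProduct.assoc k M₁ M₂ (N₁ ⊗[k] N₂)).toLinearMap

lemma middleSwap_tmul (x₁ : M₁) {i j : ℤ} {x₂ : M₂} (hx₂ : x₂ ∈ ℳ₂ i) {y₁ : N₁}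
    (hy₁ : y₁ ∈ 𝒩₁ j) (y₂ : N₂) :
    middleSwap ℳ₂ 𝒩₁ ((x₁ ⊗ₜ[k] x₂) ⊗ₜ[k] (y₁ ⊗ₜ[k] y₂)) =
      (-1 : k) ^ (i * j) • ((x₁ ⊗ₜ[k] y₁) ⊗ₜ[k] (x₂ ⊗ₜ[k] y₂)) := by
  simp [middleSwap, koszulSwap_tmul ℳ₂ 𝒩₁ hx₂ hy₁, ← smul_tmul']

lemma middleSwap_middleSwap (t : (M₁ ⊗[k] M₂) ⊗[k] (N₁ ⊗[k] N₂)) :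
    middleSwap 𝒩₁ ℳ₂ (middleSwap ℳ₂ 𝒩₁ t) = t := by
  induction t using TensorProduct.induction_on with
  | zero => simp
  | add x y hx hy => rw [map_add, map_add, hx, hy]
  | tmul x y =>
    induction x using TensorProduct.induction_on with
    | zero => simp
    | add x x' hx hx' => rw [add_tmul, map_add, map_add, hx, hx']
    | tmul x₁ x₂ =>
      induction y using TensorProduct.induction_on with
      | zero => simp
      | add y y' hy hy' => rw [tmul_add, map_add, map_add, hy, hy']
      | tmul y₁ y₂ =>
        induction x₂ using graded_induction ℳ₂ with
        | add x y hx hy => simp only [tmul_add, add_tmul, map_add, hx, hy]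
        | hom i x₂ hx₂ =>
          induction y₁ using graded_induction 𝒩₁ with
          | add x y hx hy => simp only [tmul_add, add_tmul, map_add, hx, hy]
          | hom j y₁ hy₁ =>
            rw [middleSwap_tmul ℳ₂ 𝒩₁ x₁ hx₂ hy₁, map_smul, middleSwap_tmul 𝒩₁ ℳ₂ x₁ hy₁ hx₂,
              smul_smul, mul_comm j i, sgn_sq, one_smul]

lemma middleSwap_bijective :
    Function.Bijective (middleSwap (M₁ := M₁) (N₂ := N₂) ℳ₂ 𝒩₁) :=
  Function.bijective_iff_has_inverse.2 ⟨middleSwap 𝒩₁ ℳ₂, middleSwap_middleSwap ℳ₂ 𝒩₁,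
    middleSwap_middleSwap 𝒩₁ ℳ₂⟩

lemma middleSwap_mem (n : ℤ) (t : (M₁ ⊗[k] M₂) ⊗[k] (N₁ ⊗[k] N₂))
    (ht : t ∈ tensorGrading (tensorGrading ℳ₁ ℳ₂) (tensorGrading 𝒩₁ 𝒩₂) n) :
    middleSwap ℳ₂ 𝒩₁ t ∈ tensorGrading (tensorGrading ℳ₁ 𝒩₁) (tensorGrading ℳ₂ 𝒩₂) n := by
  refine map_mem_of_tensorGrading _ _ (fun i j x y hn hx hy => ?_) ht
  refine map_mem_of_tensorGrading (middleSwap ℳ₂ 𝒩₁ ∘ₗ (TensorProduct.mk k _ _).flip y) _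
    (fun i₁ i₂ x₁ x₂ hi hx₁ hx₂ => ?_) hx
  refine map_mem_of_tensorGrading (middleSwap ℳ₂ 𝒩₁ ∘ₗ TensorProduct.mk k _ _ (x₁ ⊗ₜ x₂)) _
    (fun j₁ j₂ y₁ y₂ hj hy₁ hy₂ => ?_) hy
  rw [LinearMap.comp_apply, TensorProduct.mk_apply, middleSwap_tmul ℳ₂ 𝒩₁ x₁ hx₂ hy₁]
  exact Submodule.smul_mem _ _ (tmul_mem_tensorGrading (i := i₁ + j₁) (j := i₂ + j₂) (by omega)
    (tmul_mem_tensorGrading rfl hx₁ hy₁) (tmul_mem_tensorGrading rfl hx₂ hy₂))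

lemma middleSwap_d [Decomposition ℳ₁] [Decomposition 𝒩₂] {d₁ : M₁ →ₗ[k] M₁}
    {d₂ : M₂ →ₗ[k] M₂} {e₁ : N₁ →ₗ[k] N₁} {e₂ : N₂ →ₗ[k] N₂}
    (hd₂ : ∀ i, ∀ x ∈ ℳ₂ i, d₂ x ∈ ℳ₂ (i + 1))
    (he₁ : ∀ i, ∀ x ∈ 𝒩₁ i, e₁ x ∈ 𝒩₁ (i + 1))
    (t : (M₁ ⊗[k] M₂) ⊗[k] (N₁ ⊗[k] N₂)) :
    middleSwap ℳ₂ 𝒩₁ (tensorD (tensorGrading ℳ₁ ℳ₂) (tensorD ℳ₁ d₁ d₂) (tensorD 𝒩₁ e₁ e₂) t) =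
      tensorD (tensorGrading ℳ₁ 𝒩₁) (tensorD ℳ₁ d₁ e₁) (tensorD ℳ₂ d₂ e₂)
        (middleSwap ℳ₂ 𝒩₁ t) := by
  induction t using tensor₄_induction ℳ₁ ℳ₂ 𝒩₁ 𝒩₂ with
  | add x y hx hy => simp only [map_add, hx, hy]
  | hom i₁ i₂ j₁ j₂ x₁ hx₁ x₂ hx₂ y₁ hy₁ y₂ hy₂ =>
    rw [tensorD_tmul _ _ _ (tmul_mem_tensorGrading rfl hx₁ hx₂), tensorD_tmul ℳ₁ _ _ hx₁,
      tensorD_tmul 𝒩₁ _ _ hy₁, middleSwap_tmul ℳ₂ 𝒩₁ x₁ hx₂ hy₁, map_smul (tensorD _ _ _),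
      tensorD_tmul _ _ _ (tmul_mem_tensorGrading rfl hx₁ hy₁), tensorD_tmul ℳ₁ _ _ hx₁,
      tensorD_tmul ℳ₂ _ _ hx₂]
    simp only [add_tmul, tmul_add, map_add, ← smul_tmul', tmul_smul, map_smul,
      middleSwap_tmul ℳ₂ 𝒩₁ _ hx₂ hy₁, middleSwap_tmul ℳ₂ 𝒩₁ _ (hd₂ _ _ hx₂) hy₁,
      middleSwap_tmul ℳ₂ 𝒩₁ _ hx₂ (he₁ _ _ hy₁), smul_add, smul_smul, ← sgn_add]
    rw [sgn_eq_of_even (m := i₁ + (i₂ + 1) * j₁) (n := i₂ * j₁ + (i₁ + j₁)) ⟨0, by ring⟩,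
      sgn_eq_of_even (m := i₁ + i₂ + i₂ * (j₁ + 1)) (n := i₂ * j₁ + i₁) ⟨i₂, by ring⟩,
      show i₁ + i₂ + j₁ + i₂ * j₁ = i₂ * j₁ + (i₁ + j₁ + i₂) by ring]
    abel

end MiddleSwap

/-! ### Elementary tensors -/

namespace DGAlgebra

variable {A B : DGAlgebra k}

/-- The elementary tensor `a ⊗ b` as an element of the dg algebra `A ⊗ B`. -/
def tmul (a : A) (b : B) : A.tensor B := A.toTensor B (a ⊗ₜ b)

lemma smul_tmul' (c : k) (a : A) (b : B) : tmul (c • a) b = c • tmul a b := rfl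

lemma tmul_smul (c : k) (a : A) (b : B) : tmul a (c • b) = c • tmul a b :=
  (congrArg (A.toTensor B) (TensorProduct.tmul_smul c a b)).trans (map_smul (A.toTensor B) c _)

lemma tmul_mul {i j : ℤ} (a : A) {b : B} (hb : b ∈ B.grading j) {a' : A}
    (ha' : a' ∈ A.grading i) (b' : B) :
    tmul a b * tmul a' b' = (-1 : k) ^ (j * i) • tmul (a * a') (b * b') :=
  toTensor_mul a hb ha' b'

lemma tmul_mem {i j n : ℤ} (h : i + j = n) {a : A} (ha : a ∈ A.grading i) {b : B}
    (hb : b ∈ B.grading j) : tmul a b ∈ (A.tensor B).grading n :=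
  toTensor_mem h ha hb

lemma tmul_induction {p : A.tensor B → Prop}
    (hom : ∀ i j, ∀ a ∈ A.grading i, ∀ b ∈ B.grading j, p (tmul a b))
    (add : ∀ x y, p x → p y → p (x + y)) (x : A.tensor B) : p x :=
  toTensor_induction (p := p) hom add x

lemma d_tmul {i : ℤ} {a : A} (ha : a ∈ A.grading i) (b : B) :
    (A.tensor B).d (tmul a b) = tmul (A.d a) b + (-1 : k) ^ i • tmul a (B.d b) :=
  tensorAlgD_toTensor ha b

end DGAlgebra

/-! ### Interchange and opposites as morphisms of dg algebras -/

namespace DGAlgHom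

open DGAlgebra

section Interchange

variable (A₁ B₁ A₂ B₂ : DGAlgebra k)

/-- The linear map underlying the interchange
`(A₁ ⊗ B₁) ⊗ (A₂ ⊗ B₂) ≅ (A₁ ⊗ A₂) ⊗ (B₁ ⊗ B₂)`. -/
def interchangeLin : (A₁.tensor B₁).tensor (A₂.tensor B₂) →ₗ[k]
    (A₁.tensor A₂).tensor (B₁.tensor B₂) :=
  middleSwap (M₁ := A₁) (N₂ := B₂) B₁.grading A₂.grading

variable {A₁ B₁ A₂ B₂}

lemma interchangeLin_tmul (a₁ : A₁) {i j : ℤ} {b₁ : B₁} (hb₁ : b₁ ∈ B₁.grading i) {a₂ : A₂}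
    (ha₂ : a₂ ∈ A₂.grading j) (b₂ : B₂) :
    interchangeLin A₁ B₁ A₂ B₂ (tmul (tmul a₁ b₁) (tmul a₂ b₂)) =
      (-1 : k) ^ (i * j) • tmul (tmul a₁ a₂) (tmul b₁ b₂) :=
  middleSwap_tmul B₁.grading A₂.grading a₁ hb₁ ha₂ b₂

lemma tmul₄_induction {p : (A₁.tensor B₁).tensor (A₂.tensor B₂) → Prop}
    (hom : ∀ i₁ i₂ j₁ j₂, ∀ a₁ ∈ A₁.grading i₁, ∀ b₁ ∈ B₁.grading i₂, ∀ a₂ ∈ A₂.grading j₁,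
      ∀ b₂ ∈ B₂.grading j₂, p (tmul (tmul a₁ b₁) (tmul a₂ b₂)))
    (add : ∀ x y, p x → p y → p (x + y)) (t : (A₁.tensor B₁).tensor (A₂.tensor B₂)) : p t :=
  tensor₄_induction A₁.grading B₁.grading A₂.grading B₂.grading (p := p) hom add t

lemma tmul₄_mul {a₁ : A₁} {b₁ : B₁} {a₂ : A₂} {b₂ : B₂} {a₁' : A₁} {b₁' : B₁} {a₂' : A₂}
    {b₂' : B₂} {i₂ j₁ j₂ i₁' i₂' j₁' : ℤ} (hb₁ : b₁ ∈ B₁.grading i₂) (ha₂ : a₂ ∈ A₂.grading j₁)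
    (hb₂ : b₂ ∈ B₂.grading j₂) (ha₁' : a₁' ∈ A₁.grading i₁') (hb₁' : b₁' ∈ B₁.grading i₂')
    (ha₂' : a₂' ∈ A₂.grading j₁') :
    tmul (tmul a₁ b₁) (tmul a₂ b₂) * tmul (tmul a₁' b₁') (tmul a₂' b₂') =
      (-1 : k) ^ ((j₁ + j₂) * (i₁' + i₂') + i₂ * i₁' + j₂ * j₁') •
        tmul (tmul (a₁ * a₁') (b₁ * b₁')) (tmul (a₂ * a₂') (b₂ * b₂')) := by
  rw [tmul_mul _ (tmul_mem rfl ha₂ hb₂) (tmul_mem rfl ha₁' hb₁'), tmul_mul a₁ hb₁ ha₁',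
    tmul_mul a₂ hb₂ ha₂', DGAlgebra.smul_tmul', DGAlgebra.tmul_smul, smul_smul, smul_smul,
    ← sgn_add, ← sgn_add]

variable (A₁ B₁ A₂ B₂)

/-- The interchange of tensor factors
`(A₁ ⊗ B₁) ⊗ (A₂ ⊗ B₂) ⟶ (A₁ ⊗ A₂) ⊗ (B₁ ⊗ B₂)` is a morphism of dg algebras. -/
def interchange : DGAlgHom ((A₁.tensor B₁).tensor (A₂.tensor B₂))
    ((A₁.tensor A₂).tensor (B₁.tensor B₂)) where
  toLin := interchangeLin A₁ B₁ A₂ B₂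
  map_one := (interchangeLin_tmul 1 (SetLike.one_mem_graded B₁.grading)
    (SetLike.one_mem_graded A₂.grading) 1).trans (by rw [mul_zero, zpow_zero, one_smul]; rfl)
  map_mul x y := by
    induction x using tmul₄_induction with
    | add x x' hx hx' => simp only [add_mul, map_add, hx, hx']
    | hom i₁ i₂ j₁ j₂ a₁ ha₁ b₁ hb₁ a₂ ha₂ b₂ hb₂ =>
      induction y using tmul₄_induction with
      | add y y' hy hy' => simp only [mul_add, map_add, hy, hy']
      | hom i₁' i₂' j₁' j₂' a₁' ha₁' b₁' hb₁' a₂' ha₂' b₂' hb₂' =>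
        rw [tmul₄_mul hb₁ ha₂ hb₂ ha₁' hb₁' ha₂', map_smul, interchangeLin_tmul _ hb₁ ha₂,
          interchangeLin_tmul _ hb₁' ha₂',
          interchangeLin_tmul _ (SetLike.mul_mem_graded hb₁ hb₁')
            (SetLike.mul_mem_graded ha₂ ha₂'), smul_mul_assoc, mul_smul_comm,
          tmul₄_mul ha₂ hb₁ hb₂ ha₁' ha₂' hb₁', smul_smul, smul_smul, smul_smul, ← sgn_add,
          ← sgn_add, ← sgn_add]
        exact congrArg (· • _) (sgn_eq_of_even ⟨j₁ * i₂', by ring⟩)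
  map_mem n x hx := middleSwap_mem A₁.grading B₁.grading A₂.grading B₂.grading n x hx
  map_d x := by
    have h := middleSwap_d A₁.grading B₁.grading A₂.grading B₂.grading
      (d₁ := A₁.d) (d₂ := B₁.d) (e₁ := A₂.d) (e₂ := B₂.d) B₁.d_mem A₂.d_mem x
    exact h

end Interchange

section Op

variable (A B : DGAlgebra k)

/-- An element of a dg algebra, as an element of the opposite dg algebra. -/
def op {A : DGAlgebra k} : A →ₗ[k] A.op := A.toOp.toLinearMap

lemma op_mem {A : DGAlgebra k} {i : ℤ} {a : A} (ha : a ∈ A.grading i) : op a ∈ A.op.grading i :=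
  ha

lemma op_mul_op {A : DGAlgebra k} {i j : ℤ} {a b : A} (ha : a ∈ A.grading i)
    (hb : b ∈ A.grading j) : op a * op b = (-1 : k) ^ (i * j) • op (b * a) :=
  DGAlgebra.opMul_of_mem ha hb

/-- The linear map underlying `(A ⊗ B)^op ≅ A^op ⊗ B^op`, which is the identity. -/
def opTensorLin : (A.tensor B).op →ₗ[k] A.op.tensor B.op :=
  TensorProduct.map (op (A := A)) (op (A := B))

variable {A B}

lemma opTensorLin_tmul (a : A) (b : B) :
    opTensorLin A B (op (tmul a b)) = tmul (op a) (op b) := rfl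

lemma op_tmul_induction {p : (A.tensor B).op → Prop}
    (hom : ∀ i j, ∀ a ∈ A.grading i, ∀ b ∈ B.grading j, p (op (tmul a b)))
    (add : ∀ x y, p x → p y → p (x + y)) (x : (A.tensor B).op) : p x :=
  tmul_induction (p := p) hom add x

lemma op_tmul_mul_op_tmul {i j p q : ℤ} {a : A} (ha : a ∈ A.grading i) {b : B}
    (hb : b ∈ B.grading j) {c : A} (hc : c ∈ A.grading p) {d : B} (hd : d ∈ B.grading q) :
    op (tmul a b) * op (tmul c d) =
      (-1 : k) ^ ((i + j) * (p + q) + q * i) • op (tmul (c * a) (d * b)) := by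
  refine (op_mul_op (tmul_mem rfl ha hb) (tmul_mem rfl hc hd)).trans ?_
  rw [tmul_mul c hd ha, map_smul op, smul_smul, sgn_add]

lemma tmul_op_mul_tmul_op {i j p q : ℤ} {a : A} (ha : a ∈ A.grading i) {b : B}
    (hb : b ∈ B.grading j) {c : A} (hc : c ∈ A.grading p) {d : B} (hd : d ∈ B.grading q) :
    tmul (op a) (op b) * tmul (op c) (op d) =
      (-1 : k) ^ (j * p + i * p + j * q) • tmul (op (c * a)) (op (d * b)) := by
  rw [tmul_mul (op a) (op_mem hb) (op_mem hc), op_mul_op ha hc, op_mul_op hb hd,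
    DGAlgebra.smul_tmul', DGAlgebra.tmul_smul, smul_smul, smul_smul, ← sgn_add, ← sgn_add]

lemma opTensorLin_mul (x y : (A.tensor B).op) :
    opTensorLin A B (x * y) = opTensorLin A B x * opTensorLin A B y := by
  induction x using op_tmul_induction with
  | add x x' hx hx' => rw [add_mul, map_add, map_add, hx, hx', add_mul]
  | hom i j a ha b hb =>
    induction y using op_tmul_induction with
    | add y y' hy hy' => rw [mul_add, map_add, map_add, hy, hy', mul_add]
    | hom p q c hc d hd =>
      refine (congrArg _ (op_tmul_mul_op_tmul ha hb hc hd)).trans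
        (((map_smul (opTensorLin A B) _ _).trans ?_).trans
          (tmul_op_mul_tmul_op ha hb hc hd).symm)
      rw [opTensorLin_tmul]
      exact congrArg (· • _) (sgn_eq_of_even ⟨i * q, by ring⟩)

lemma opTensorLin_d (x : (A.tensor B).op) :
    opTensorLin A B ((A.tensor B).op.d x) = (A.op.tensor B.op).d (opTensorLin A B x) := by
  induction x using op_tmul_induction with
  | add x x' hx hx' => rw [map_add, map_add, map_add, map_add, hx, hx']
  | hom i j a ha b hb =>
    refine Eq.trans ?_ (d_tmul (op_mem ha) (op b)).symm
    refine (congrArg (opTensorLin A B ∘ op) (d_tmul ha b)).trans ?_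
    exact (map_add (opTensorLin A B) _ _).trans (congrArg _ (map_smul (opTensorLin A B) _ _))

variable (A B)

/-- The identity `(A ⊗ B)^op ⟶ A^op ⊗ B^op` is a morphism of dg algebras. -/
def opTensor : DGAlgHom (A.tensor B).op (A.op.tensor B.op) where
  toLin := opTensorLin A B
  map_one := rfl
  map_mul := opTensorLin_mul
  map_mem n _ hx := map_mem_of_tensorGrading (opTensorLin A B) ((A.op.tensor B.op).grading n)
    (fun _ _ _ _ h ha hb => tmul_mem_tensorGrading h ha hb) hx
  map_d := opTensorLin_d

lemma opTensor_bijective : Function.Bijective (opTensor A B).toLin :=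
  (TensorProduct.congr A.toOp B.toOp).bijective

end Op

/-- The tensor product of a morphism of dg algebras with an identity. -/
def tensorRight {C A : DGAlgebra k} (φ : DGAlgHom C A) (B : DGAlgebra k) :
    DGAlgHom (C.tensor B) (A.tensor B) where
  toLin := LinearMap.rTensor B φ.toLin
  map_one := congrArg (fun x => tmul x (1 : B)) φ.map_one
  map_mul := by
    let f : C.tensor B →ₗ[k] A.tensor B := LinearMap.rTensor B φ.toLin
    have hf : ∀ c b, f (tmul c b) = tmul (φ.toLin c) b := fun _ _ => rfl
    change ∀ x y, f (x * y) = f x * f y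
    intro x y
    induction x using tmul_induction with
    | add x x' hx hx' => simp only [add_mul, map_add, hx, hx']
    | hom i j a ha b hb =>
      induction y using tmul_induction with
      | add y y' hy hy' => simp only [mul_add, map_add, hy, hy']
      | hom p q c hc d hd =>
        rw [tmul_mul a hb hc, map_smul, hf, hf, hf, tmul_mul _ hb (φ.map_mem _ _ hc), φ.map_mul]
  map_mem n x hx := map_mem_of_tensorGrading (LinearMap.rTensor B φ.toLin) _
    (fun i j a b h ha hb => tmul_mem_tensorGrading h (φ.map_mem i a ha) hb) hx
  map_d := by
    let f : C.tensor B →ₗ[k] A.tensor B := LinearMap.rTensor B φ.toLin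
    have hf : ∀ c b, f (tmul c b) = tmul (φ.toLin c) b := fun _ _ => rfl
    change ∀ x, f ((C.tensor B).d x) = (A.tensor B).d (f x)
    intro x
    induction x using tmul_induction with
    | add x x' hx hx' => simp only [map_add, hx, hx']
    | hom i j a ha b hb =>
      rw [d_tmul ha, map_add, map_smul, hf, hf, hf, d_tmul (φ.map_mem i a ha), φ.map_d]

end DGAlgHom

namespace DGModule

open DGAlgHom

/-! ### Comparison of exterior tensor products -/

section Elementary

variable {A B : DGAlgebra k} {M : DGModule A} {N : DGModule B}

/-- The elementary tensor `m ⊗ n` as an element of the dg module `M ⊗ N`. -/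
def tmul (m : M) (n : N) : M.tensor N := m ⊗ₜ[k] n

lemma smul_tmul' (c : k) (m : M) (n : N) : tmul (c • m) n = c • tmul m n := rfl

lemma tmul_smul (c : k) (m : M) (n : N) : tmul m (c • n) = c • tmul m n :=
  TensorProduct.tmul_smul c m n

lemma act_tmul (m : M) {i j : ℤ} {n : N} (hn : n ∈ N.grading i) {a : A} (ha : a ∈ A.grading j)
    (b : B) : (M.tensor N).act (tmul m n) (DGAlgebra.tmul a b) =
      (-1 : k) ^ (i * j) • tmul (M.act m a) (N.act n b) :=
  tensorAct_tmul M N m hn ha b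

lemma tmul_mem {i j n : ℤ} (h : i + j = n) {x : M} (hx : x ∈ M.grading i) {y : N}
    (hy : y ∈ N.grading j) : tmul x y ∈ (M.tensor N).grading n :=
  tmul_mem_tensorGrading h hx hy

end Elementary

section Interchange

variable {A₁ B₁ A₂ B₂ : DGAlgebra k}

/-- The linear map underlying the interchange of exterior tensor products. -/
def interchangeLin (M₁ : DGModule A₁) (M₂ : DGModule B₁) (N₁ : DGModule A₂) (N₂ : DGModule B₂) :
    (M₁.tensor M₂).tensor (N₁.tensor N₂) →ₗ[k] (M₁.tensor N₁).tensor (M₂.tensor N₂) :=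
  middleSwap (M₁ := M₁) (N₂ := N₂) M₂.grading N₁.grading

variable {M₁ : DGModule A₁} {M₂ : DGModule B₁} {N₁ : DGModule A₂} {N₂ : DGModule B₂}

lemma interchangeLin_tmul (x₁ : M₁) {i j : ℤ} {x₂ : M₂} (hx₂ : x₂ ∈ M₂.grading i) {y₁ : N₁}
    (hy₁ : y₁ ∈ N₁.grading j) (y₂ : N₂) :
    interchangeLin M₁ M₂ N₁ N₂ (tmul (tmul x₁ x₂) (tmul y₁ y₂)) =
      (-1 : k) ^ (i * j) • tmul (tmul x₁ y₁) (tmul x₂ y₂) :=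
  middleSwap_tmul M₂.grading N₁.grading x₁ hx₂ hy₁ y₂

lemma tmul₄_induction {p : (M₁.tensor M₂).tensor (N₁.tensor N₂) → Prop}
    (hom : ∀ i₁ i₂ j₁ j₂, ∀ x₁ ∈ M₁.grading i₁, ∀ x₂ ∈ M₂.grading i₂, ∀ y₁ ∈ N₁.grading j₁,
      ∀ y₂ ∈ N₂.grading j₂, p (tmul (tmul x₁ x₂) (tmul y₁ y₂)))
    (add : ∀ x y, p x → p y → p (x + y)) (t : (M₁.tensor M₂).tensor (N₁.tensor N₂)) : p t :=
  tensor₄_induction M₁.grading M₂.grading N₁.grading N₂.grading (p := p) hom add t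

lemma tmul₄_act {x₁ : M₁} {x₂ : M₂} {y₁ : N₁} {y₂ : N₂} {a₁ : A₁} {b₁ : B₁} {a₂ : A₂} {b₂ : B₂}
    {i₂ j₁ j₂ p₁ q₁ p₂ : ℤ} (hx₂ : x₂ ∈ M₂.grading i₂) (hy₁ : y₁ ∈ N₁.grading j₁)
    (hy₂ : y₂ ∈ N₂.grading j₂) (ha₁ : a₁ ∈ A₁.grading p₁) (hb₁ : b₁ ∈ B₁.grading q₁)
    (ha₂ : a₂ ∈ A₂.grading p₂) :
    ((M₁.tensor M₂).tensor (N₁.tensor N₂)).act (tmul (tmul x₁ x₂) (tmul y₁ y₂))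
        (DGAlgebra.tmul (DGAlgebra.tmul a₁ b₁) (DGAlgebra.tmul a₂ b₂)) =
      (-1 : k) ^ ((j₁ + j₂) * (p₁ + q₁) + i₂ * p₁ + j₂ * p₂) •
        tmul (tmul (M₁.act x₁ a₁) (M₂.act x₂ b₁)) (tmul (N₁.act y₁ a₂) (N₂.act y₂ b₂)) := by
  rw [act_tmul _ (tmul_mem rfl hy₁ hy₂) (DGAlgebra.tmul_mem rfl ha₁ hb₁), act_tmul x₁ hx₂ ha₁,
    act_tmul y₁ hy₂ ha₂, smul_tmul', tmul_smul, smul_smul, smul_smul, ← sgn_add, ← sgn_add]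

variable (M₁ M₂ N₁ N₂)

/-- `(M₁ ⊠ M₂) ⊠ (N₁ ⊠ N₂)` is isomorphic to `(M₁ ⊠ N₁) ⊠ (M₂ ⊠ N₂)`, along the interchange
morphism of dg algebras. -/
lemma interchange_dIso : DIso ((M₁.tensor M₂).tensor (N₁.tensor N₂))
    (restrict (interchange A₁ B₁ A₂ B₂) ((M₁.tensor N₁).tensor (M₂.tensor N₂))) := by
  have h_act : ∀ t z, interchangeLin M₁ M₂ N₁ N₂
      (((M₁.tensor M₂).tensor (N₁.tensor N₂)).act t z) =
      ((M₁.tensor N₁).tensor (M₂.tensor N₂)).act (interchangeLin M₁ M₂ N₁ N₂ t)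
        (DGAlgHom.interchangeLin A₁ B₁ A₂ B₂ z) := by
    intro t z
    induction t using tmul₄_induction with
    | add x y hx hy => simp only [map_add, LinearMap.add_apply, hx, hy]
    | hom i₁ i₂ j₁ j₂ x₁ hx₁ x₂ hx₂ y₁ hy₁ y₂ hy₂ =>
      induction z using DGAlgHom.tmul₄_induction with
      | add x y hx hy => simp only [map_add, hx, hy]
      | hom p₁ q₁ p₂ q₂ a₁ ha₁ b₁ hb₁ a₂ ha₂ b₂ hb₂ =>
        rw [tmul₄_act hx₂ hy₁ hy₂ ha₁ hb₁ ha₂, map_smul, interchangeLin_tmul _ hx₂ hy₁,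
          DGAlgHom.interchangeLin_tmul _ hb₁ ha₂,
          interchangeLin_tmul _ (M₂.act_mem _ _ x₂ hx₂ b₁ hb₁) (N₁.act_mem _ _ y₁ hy₁ a₂ ha₂),
          map_smul, map_smul, LinearMap.smul_apply, tmul₄_act hy₁ hx₂ hy₂ ha₁ ha₂ hb₁, smul_smul,
          smul_smul, smul_smul, ← sgn_add, ← sgn_add, ← sgn_add]
        exact congrArg (· • _) (sgn_eq_of_even ⟨j₁ * q₁, by ring⟩)
  refine .of_bijective
    (N := restrict (interchange A₁ B₁ A₂ B₂) ((M₁.tensor N₁).tensor (M₂.tensor N₂)))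
    ⟨interchangeLin M₁ M₂ N₁ N₂, fun n x hx => ?_, h_act, fun x => ?_⟩
    (middleSwap_bijective (M₁ := M₁) (N₂ := N₂) M₂.grading N₁.grading)
  · exact middleSwap_mem M₁.grading M₂.grading N₁.grading N₂.grading n x hx
  · have h := middleSwap_d M₁.grading M₂.grading N₁.grading N₂.grading
      (d₁ := M₁.d) (d₂ := M₂.d) (e₁ := N₁.d) (e₂ := N₂.d) M₂.d_mem N₁.d_mem x
    exact h

end Interchange

lemma restrict_tensor_dIso {A B C : DGAlgebra k} (φ : DGAlgHom C A) (M : DGModule A)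
    (N : DGModule B) :
    DIso ((restrict φ M).tensor N) (restrict (φ.tensorRight B) (M.tensor N)) := by
  let f : (restrict φ M).tensor N →ₗ[k] M.tensor N := LinearMap.id
  have hf : ∀ (m : restrict φ M) (n : N), f (tmul m n) = tmul (M := M) m n := fun _ _ => rfl
  have hφ : ∀ c b, (φ.tensorRight B).toLin (DGAlgebra.tmul c b) = DGAlgebra.tmul (φ.toLin c) b :=
    fun _ _ => rfl
  refine .of_bijective (N := restrict (φ.tensorRight B) (M.tensor N)) ⟨f, fun _ _ h => h,
    fun t z => ?_, fun _ => rfl⟩ Function.bijective_id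
  change f (((restrict φ M).tensor N).act t z) =
    (M.tensor N).act (f t) ((φ.tensorRight B).toLin z)
  induction t using tensor_induction (restrict φ M).grading N.grading with
  | add x y hx hy =>
    exact (congrArg f (LinearMap.map_add₂ ((restrict φ M).tensor N).act x y z)).trans
      ((map_add f _ _).trans ((congrArg₂ _ hx hy).trans
        (LinearMap.map_add₂ (M.tensor N).act (f x) (f y) _).symm))
  | hom i j x hx y hy =>
    induction z using DGAlgebra.tmul_induction with
    | add z z' hz hz' =>
      exact (congrArg f (map_add _ z z')).trans ((map_add f _ _).trans
        ((congrArg₂ _ hz hz').trans ((congrArg _ (map_add _ z z')).trans (map_add _ _ _)).symm))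
    | hom p q c hc b hb =>
      have h := act_tmul (M := restrict φ M) x hy hc b
      have h' := act_tmul (M := M) x hy (φ.map_mem p c hc) b
      rw [hφ]
      exact (congrArg f h).trans ((map_smul f _ _).trans h'.symm)

lemma diagonal_act {A : DGAlgebra k} {i j : ℤ} {x a : A} (hx : x ∈ A.grading i)
    (ha : a ∈ A.grading j) (b : A) :
    (diagonal A).act x (DGAlgebra.tmul (op a) b) = ((-1 : k) ^ (i * j) • (a * x * b) : A) := by
  have : (diagonal A).act x (DGAlgebra.tmul (op a) b) = (A.opMul x a * b : A) := rfl
  rw [this, DGAlgebra.opMul_of_mem hx ha, smul_mul_assoc]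

/-- `(A ⊗ B)^op ⊗ (A ⊗ B)` is spanned by elementary tensors of homogeneous elements. -/
lemma op_tmul₄_induction {A B : DGAlgebra k} {p : (A.tensor B).op.tensor (A.tensor B) → Prop}
    (hom : ∀ i₁ i₂ j₁ j₂, ∀ a₁ ∈ A.grading i₁, ∀ b₁ ∈ B.grading i₂, ∀ a₂ ∈ A.grading j₁,
      ∀ b₂ ∈ B.grading j₂,
        p (DGAlgebra.tmul (op (DGAlgebra.tmul a₁ b₁)) (DGAlgebra.tmul a₂ b₂)))
    (add : ∀ x y, p x → p y → p (x + y)) (t : (A.tensor B).op.tensor (A.tensor B)) : p t :=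
  tensor₄_induction A.grading B.grading A.grading B.grading (p := p) hom add t

/-- The diagonal module of `A ⊗ B` is the exterior tensor product of the diagonal modules, along
the identification of `(A ⊗ B)^op ⊗ (A ⊗ B)` with `(A^op ⊗ A) ⊗ (B^op ⊗ B)`. -/
lemma diagonal_tensor_dIso (A B : DGAlgebra k) :
    DIso (diagonal (A.tensor B)) (restrict ((opTensor A B).tensorRight (A.tensor B))
      (restrict (interchange A.op B.op A B) ((diagonal A).tensor (diagonal B)))) := by
  let ψ : (A.tensor B).op.tensor (A.tensor B) →ₗ[k] (A.op.tensor A).tensor (B.op.tensor B) :=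
    (interchange A.op B.op A B).toLin ∘ₗ ((opTensor A B).tensorRight (A.tensor B)).toLin
  have hψ : ∀ {p q : ℤ} (a : A) {b : B} (_ : b ∈ B.grading p) {a' : A} (_ : a' ∈ A.grading q)
      (b' : B), ψ (DGAlgebra.tmul (op (DGAlgebra.tmul a b)) (DGAlgebra.tmul a' b')) =
        (-1 : k) ^ (p * q) • DGAlgebra.tmul (DGAlgebra.tmul (op a) a')
          (DGAlgebra.tmul (op b) b') :=
    fun a b hb a' ha' b' => DGAlgHom.interchangeLin_tmul (op a) (op_mem hb) ha' b'
  let f : A.tensor B →ₗ[k] (diagonal A).tensor (diagonal B) := LinearMap.id (M := A ⊗[k] B)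
  have hf : ∀ (a : A) (b : B), f (DGAlgebra.tmul a b) =
    tmul (M := diagonal A) (N := diagonal B) a b := fun _ _ => rfl
  have hf' : ∀ (c d : k) (u : A) (v : B), tmul (M := diagonal A) (N := diagonal B) (c • u : A)
      (d • v : B) = (c * d) • f (DGAlgebra.tmul u v) := fun c d u v =>
    (smul_tmul' (M := diagonal A) (N := diagonal B) c u (d • v : B)).trans
      ((congrArg (c • ·) (tmul_smul (M := diagonal A) (N := diagonal B) d u v)).trans
        (smul_smul _ _ _))
  have key : ∀ (t : A.tensor B) z, f ((diagonal (A.tensor B)).act t z) =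
      ((diagonal A).tensor (diagonal B)).act (f t) (ψ z) := by
    intro t z
    induction t using DGAlgebra.tmul_induction with
    | add x y hx hy =>
      exact (congrArg f (LinearMap.map_add₂ (diagonal (A.tensor B)).act x y z)).trans
        ((map_add f _ _).trans ((congrArg₂ _ hx hy).trans
          ((congrArg (fun s => ((diagonal A).tensor (diagonal B)).act s (ψ z))
            (map_add f x y)).trans
            (LinearMap.map_add₂ ((diagonal A).tensor (diagonal B)).act (f x) (f y) _)).symm))
    | hom i j x hx y hy =>
      induction z using op_tmul₄_induction with
      | add z z' hz hz' =>
        exact (congrArg f (map_add _ z z')).trans ((map_add f _ _).trans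
          ((congrArg₂ _ hz hz').trans ((congrArg _ (map_add ψ z z')).trans (map_add _ _ _)).symm))
      | hom p q r s a ha b hb a' ha' b' hb' =>
        have h₁ : (diagonal (A.tensor B)).act (DGAlgebra.tmul x y)
            (DGAlgebra.tmul (op (DGAlgebra.tmul a b)) (DGAlgebra.tmul a' b')) =
            ((-1 : k) ^ ((i + j) * (p + q) + q * i + (q + j) * r) •
              DGAlgebra.tmul (a * x * a') (b * y * b') : A.tensor B) := by
          rw [diagonal_act (DGAlgebra.tmul_mem rfl hx hy) (DGAlgebra.tmul_mem rfl ha hb),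
            DGAlgebra.tmul_mul a hb hx, smul_mul_assoc,
            DGAlgebra.tmul_mul _ (SetLike.mul_mem_graded hb hy) ha', smul_smul, smul_smul,
            ← sgn_add, ← sgn_add]
        have h₂ : ((diagonal A).tensor (diagonal B)).act (tmul (M := diagonal A)
            (N := diagonal B) x y) (DGAlgebra.tmul (DGAlgebra.tmul (op a) a')
              (DGAlgebra.tmul (op b) b')) = (-1 : k) ^ (j * (p + r) + j * q + i * p) •
                f (DGAlgebra.tmul (a * x * a') (b * y * b')) := by
          rw [act_tmul (M := diagonal A) (N := diagonal B) x hy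
            (DGAlgebra.tmul_mem rfl (op_mem ha) ha'), diagonal_act hx ha, diagonal_act hy hb]
          refine (congrArg _ (hf' _ _ _ _)).trans ((smul_smul _ _ _).trans ?_)
          rw [← sgn_add, ← sgn_add]
          exact congrArg (· • _) (congrArg _ (by ring))
        rw [h₁, hψ a hb ha' b', map_smul, map_smul, hf x y, h₂, smul_smul, ← sgn_add]
        exact congrArg (· • _) (sgn_eq_of_even ⟨q * i, by ring⟩)
  exact .of_bijective (M := diagonal (A.tensor B))
    (N := restrict ((opTensor A B).tensorRight (A.tensor B))
      (restrict (interchange A.op B.op A B) ((diagonal A).tensor (diagonal B))))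
    ⟨f, fun _ _ h => h, key, fun _ => rfl⟩ Function.bijective_id

/-! ### Perfect modules and the diagonal dimension -/

lemma IsPerfect.tensor {A B : DGAlgebra k} {M : DGModule A} {N : DGModule B} (hM : IsPerfect M)
    (hN : IsPerfect N) : IsPerfect (M.tensor N) := by
  obtain ⟨m, hM⟩ := hM
  obtain ⟨n, hN⟩ := hN
  exact ⟨m + n, generated_mono (self_tensor_self_dIso A B) (generated_tensor hM hN)⟩

lemma IsPerfect.restrict {A C : DGAlgebra k} (φ : DGAlgHom C A)
    (hφ : Function.Bijective φ.toLin) {M : DGModule A} (hM : IsPerfect M) :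
    IsPerfect (restrict φ M) := by
  obtain ⟨n, hM⟩ := hM
  exact ⟨n, generated_mono (self_dIso_restrict φ hφ).symm (generated_restrict φ hM)⟩

/-- If the diagonal modules of `A` and `B` are generated by `F₁ ⊠ G₁` and `F₂ ⊠ G₂`, the diagonal
module of `A ⊗ B` is generated by `(F₁ ⊠ F₂) ⊠ (G₁ ⊠ G₂)`, and the numbers of steps add up. -/
lemma generated_diagonal_tensor {A B : DGAlgebra k} {F₁ : DGModule A.op} {G₁ : DGModule A}
    {F₂ : DGModule B.op} {G₂ : DGModule B} {m n : ℕ}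
    (hA : generated (F₁.tensor G₁) m ((toDerived (A.op.tensor A)).obj (diagonal A)))
    (hB : generated (F₂.tensor G₂) n ((toDerived (B.op.tensor B)).obj (diagonal B))) :
    generated ((restrict (opTensor A B) (F₁.tensor F₂)).tensor (G₁.tensor G₂)) (m + n)
      ((toDerived _).obj (diagonal (A.tensor B))) := by
  obtain ⟨e⟩ := diagonal_tensor_dIso A B
  exact generated_of_iso e (generated_mono (restrict_tensor_dIso _ _ _).symm
    (generated_restrict _ (generated_mono (interchange_dIso F₁ F₂ G₁ G₂).symm
      (generated_restrict _ (generated_tensor hA hB)))))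

end DGModule

open DGModule

lemma exists_of_diagonalDimension_ne_top {A : DGAlgebra k} (h : diagonalDimension A ≠ ⊤) :
    ∃ n : ℕ, diagonalDimension A = n ∧ ∃ (F : DGModule A.op) (G : DGModule A), IsPerfect F ∧
      IsPerfect G ∧
        generated (F.tensor G) n ((toDerived (A.op.tensor A)).obj (DGModule.diagonal A)) := by
  have hne : ((fun n : ℕ => (n : ℕ∞)) '' {n | ∃ (F : DGModule A.op) (G : DGModule A),
      IsPerfect F ∧ IsPerfect G ∧
        generated (F.tensor G) n ((toDerived (A.op.tensor A)).obj (diagonal A))}).Nonempty := by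
    rw [Set.nonempty_iff_ne_empty]
    intro h'
    exact h (by rw [diagonalDimension, h', sInf_empty])
  obtain ⟨n, hn, h'⟩ := csInf_mem hne
  exact ⟨n, h'.symm, hn⟩

lemma diagonalDimension_le {A : DGAlgebra k} {n : ℕ} {F : DGModule A.op} {G : DGModule A}
    (hF : IsPerfect F) (hG : IsPerfect G)
    (h : generated (F.tensor G) n ((toDerived (A.op.tensor A)).obj (DGModule.diagonal A))) :
    diagonalDimension A ≤ n :=
  sInf_le ⟨n, ⟨F, G, hF, hG, h⟩, rfl⟩

end DG

theorem mainTheorem3 {k : Type u} [Field k] (A B : DG.DGAlgebra k) :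
    DG.diagonalDimension (A.tensor B) ≤ DG.diagonalDimension A + DG.diagonalDimension B := by
  by_cases hA : DG.diagonalDimension A = ⊤
  · rw [hA, top_add]
    exact le_top
  by_cases hB : DG.diagonalDimension B = ⊤
  · rw [hB, add_top]
    exact le_top
  obtain ⟨m, hm, F₁, G₁, hF₁, hG₁, hA⟩ := DG.exists_of_diagonalDimension_ne_top hA
  obtain ⟨n, hn, F₂, G₂, hF₂, hG₂, hB⟩ := DG.exists_of_diagonalDimension_ne_top hB
  rw [hm, hn, ← Nat.cast_add]
  exact DG.diagonalDimension_le
    (DG.DGModule.IsPerfect.restrict _ (DG.DGAlgHom.opTensor_bijective A B)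
      (DG.DGModule.IsPerfect.tensor hF₁ hF₂))
    (DG.DGModule.IsPerfect.tensor hG₁ hG₂) (DG.DGModule.generated_diagonal_tensor hA hB)

end
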